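/- **Conventions.** $|X|$ is the Euclidean norm on $\mathbb{R}^{d\times m}$, and $|A|$ is the Lebesgue measure of $A\subset\mathbb{R}^m$. A *regular domain* $\Omega\subset\mathbb{R}^m$ is a nonempty, open, bounded, connected set with $|\partial\Omega|=0$. A map $w$ on $\Omega$ is *piecewise affine* if, up to a null set, $\Omega$ is an at most countable union of pairwise disjoint regular domains on each of which $w$ agrees with an affine map. A probability measure $\mu$ on $\mathbb{R}^{d\times m}$ is obtained from $\nu$ by an *elementary splitting originating from* $U$ if, for some $t\in[0,1]$, $s\in(0,1)$, $X\in U$, matrices $B,B'$ and a probability measure $\tilde\nu$, we have $\nu=t\delta_X+(1-t)\tilde\nu$, $X=sB+(1-s)B'$, $\operatorname{rank}(B'-B)=1$ and $\mu=t\big(s\delta_B+(1-s)\delta_{B'}\big)+(1-t)\tilde\nu$. A *laminate of finite order with construction steps in $U$ and barycenter $X$* is a measure obtained from $\delta_X$ by finitely many elementary splittings originating from $U$. A probability measure $\nu^\infty$ is a *staircase laminate supported on $K$ with construction steps in $U$ and barycenter $X_0$*, written $\nu^\infty\in SL(K,U)$, if there are pairwise different matrices $X_n\in U\setminus K$ ($n\ge0$),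 probability measures $\mu_n$ ($n\ge1$), each a finite sum of weighted Dirac masses at points of $K$, and $\gamma_n\in(0,1)$ ($n\ge 1$) such that - for each $n\ge1$, $(1-\gamma_n)\mu_n+\gamma_n\delta_{X_n}$ is a laminate of finite order with construction steps in $U$ and barycenter $X_{n-1}$; - $|X_n|$ is strictly increasing with $|X_n|\to\infty$, and $\beta_n:=\prod_{k=1}^n\gamma_k\to0$ (with $\beta_0=1$); - for every Borel set $E$, $\nu^\infty(E)=\lim_{N\to\infty}\nu^N(E)$, where $\nu^N=\sum_{n=1}^N\beta_{n-1}(1-\gamma_n)\mu_n+\beta_N\delta_{X_N}$; - $\nu^\infty$ has barycenter $X_0$, i.e. $\int|X|\,d\nu^\infty<\infty$ and $\int X\,d\nu^\infty=X_0$. **Proposition 3.9.** Let $K\subset\mathbb{R}^{d\times m}$ be any set, $U\subset\mathbb{R}^{d\times m}$ open, $\alpha\in(0,1)$ and $q\in(1,\infty)$. Let $\nu^\infty\in SL(K,U)$ have barycenter $X_0$, and assume that for some $p>1$ and $M>0$ $$\nu^\infty(\{X: |X|>t\})\le M\,t^{-p}\qquad\text{for all } t>0 .$$ Then for each $b\in\mathbb{R}^d$,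 each $\varepsilon>0$ and each regular domain $\Omega\subset\mathbb{R}^m$ there exist a piecewise affine map $w\in W^{1,1}(\Omega,\mathbb{R}^d)\cap C^\alpha(\bar\Omega,\mathbb{R}^d)$ and a measurable set $\Omega_{err}\subset\Omega$ with $\Omega_{err}\supset\{x\in\Omega:\nabla w(x)\notin K\}$ such that 1. $w(x)=X_0x+b$ for $x\in\partial\Omega$; 2. $\displaystyle\int_{\Omega_{err}}(1+|\nabla w|)^q\,dx\le\varepsilon|\Omega|$; 3. for each Borel set $E\subset\mathbb{R}^{d\times m}$, $$(1-\varepsilon)\,\nu^\infty(E)\le\frac{|\{x\in\Omega\setminus\Omega_{err}:\nabla w(x)\in E\}|}{|\Omega|}\le(1+\varepsilon)\,\nu^\infty(E);$$ 4. $\nabla w(x)\in U$ for a.e. $x\in\Omega_{err}$. -/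

import Mathlib

open MeasureTheory Filter Topology
open scoped NNReal ENNReal

noncomputable section

namespace ConvexIntegration

/-- The space `ℝ^m` with its Euclidean norm and Lebesgue measure. -/
abbrev Vec (m : ℕ) : Type := EuclideanSpace ℝ (Fin m)

/-- The space `ℝ^{d × m}` of matrices, a matrix being given by its entries `X (i, j)`. This type
carries the Euclidean (Frobenius) norm, the usual topology and the Borel `σ`-algebra. -/
abbrev Mat (d m : ℕ) : Type := EuclideanSpace ℝ (Fin d × Fin m)

/-- The underlying matrix, in Mathlib's sense. -/
def Mat.toMatrix {d m : ℕ} (X : Mat d m) : Matrix (Fin d) (Fin m) ℝ := Matrix.of fun i j => X (i, j)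

variable {d m : ℕ}

/-! ### Domains and maps -/

/-- A regular domain: open, bounded, connected (in particular nonempty), with a Lebesgue-null
boundary. -/
structure IsRegularDomain (Ω : Set (Vec m)) : Prop where
  isOpen : IsOpen Ω
  isBounded : Bornology.IsBounded Ω
  isConnected : IsConnected Ω
  frontier_null : volume (frontier Ω) = 0

/-- The affine map `x ↦ X x + b`. -/
def affineMap (X : Mat d m) (b : Vec d) (x : Vec m) : Vec d :=
  WithLp.toLp 2 ((Mat.toMatrix X).mulVec (WithLp.ofLp x)) + b

/-- Up to a null set, `Ω` is an at most countable disjoint union of regular domains on each of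
which `w` is affine. -/
def IsPiecewiseAffine (Ω : Set (Vec m)) (w : Vec m → Vec d) : Prop :=
  ∃ S : Set (Set (Vec m)), S.Countable ∧ S.PairwiseDisjoint id ∧
    (∀ D ∈ S, IsRegularDomain D ∧ D ⊆ Ω ∧
      ∃ (X : Mat d m) (b : Vec d), ∀ x ∈ D, w x = affineMap X b x) ∧
    volume (Ω \ ⋃₀ S) = 0

/-- `G` is a weak (distributional) gradient of `w` on `Ω`: for all test functions
`φ ∈ C_c^∞(Ω)` and all `i, j`, `∫_Ω w_i ∂_j φ = - ∫_Ω G_{ij} φ`. (It is only used for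
integrable `w` and `G`.) -/
def IsWeakGradient (Ω : Set (Vec m)) (w : Vec m → Vec d) (G : Vec m → Mat d m) : Prop :=
  ∀ φ : Vec m → ℝ, ContDiff ℝ (⊤ : ℕ∞) φ → HasCompactSupport φ → tsupport φ ⊆ Ω →
    ∀ (i : Fin d) (j : Fin m),
      ∫ x in Ω, w x i * fderiv ℝ φ x (EuclideanSpace.single j 1) = - ∫ x in Ω, G x (i, j) * φ x

/-- `w ∈ W^{1,1}(Ω, ℝ^d)`, and the function `G` represents `∇w`. -/
structure IsSobolevW11 (Ω : Set (Vec m)) (w : Vec m → Vec d) (G : Vec m → Mat d m) : Prop where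
  integrableOn : IntegrableOn w Ω
  integrableOn_gradient : IntegrableOn G Ω
  isWeakGradient : IsWeakGradient Ω w G

/-! ### Laminates -/

/-- `μ` is obtained from `ν` by an elementary splitting originating from `U`:
`ν = t δ_X + (1 - t) ν'` with `X ∈ U`, `X = s B + (1 - s) B'` with `s ∈ (0,1)` and
`rank (B' - B) = 1`, and `μ = t (s δ_B + (1 - s) δ_{B'}) + (1 - t) ν'`. -/
def IsElementarySplitting (U : Set (Mat d m)) (ν μ : Measure (Mat d m)) : Prop :=
  ∃ (t s : ℝ) (X B B' : Mat d m) (ν' : Measure (Mat d m)),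
    t ∈ Set.Icc (0 : ℝ) 1 ∧ s ∈ Set.Ioo (0 : ℝ) 1 ∧ X ∈ U ∧ IsProbabilityMeasure ν' ∧
    X = s • B + (1 - s) • B' ∧ (Mat.toMatrix (B' - B)).rank = 1 ∧
    ν = ENNReal.ofReal t • Measure.dirac X + ENNReal.ofReal (1 - t) • ν' ∧
    μ = ENNReal.ofReal t •
          (ENNReal.ofReal s • Measure.dirac B + ENNReal.ofReal (1 - s) • Measure.dirac B')
        + ENNReal.ofReal (1 - t) • ν'

/-- `ν` is a laminate of finite order with construction steps in `U`, starting from `δ_X`: it is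
reached from `δ_X` by finitely many elementary splittings originating from `U`. Elementary
splittings preserve the barycenter, so `X` is the barycenter of `ν`. -/
def IsLaminateOfFiniteOrder (U : Set (Mat d m)) (X : Mat d m) (ν : Measure (Mat d m)) : Prop :=
  Relation.ReflTransGen (IsElementarySplitting U) (Measure.dirac X) ν

/-- A probability measure that is a finite sum of weighted Dirac masses at points of `K`. -/
def IsFiniteAtomicOn (K : Set (Mat d m)) (μ : Measure (Mat d m)) : Prop :=
  IsProbabilityMeasure μ ∧ ∃ (s : Finset (Mat d m)) (θ : Mat d m → ℝ≥0),
    (∀ Y ∈ s, Y ∈ K) ∧ μ = ∑ Y ∈ s, θ Y • Measure.dirac Y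

/-- The products `β_n = γ_1 ⋯ γ_n`, with `β_0 = 1`. -/
def stairBeta (γ : ℕ → ℝ) (n : ℕ) : ℝ := ∏ k ∈ Finset.range n, γ (k + 1)

/-- The measures `ω_n = (1 - γ_n) μ_n + γ_n δ_{X_n}`. -/
def stairOmega (X : ℕ → Mat d m) (μ : ℕ → Measure (Mat d m)) (γ : ℕ → ℝ) (n : ℕ) :
    Measure (Mat d m) :=
  ENNReal.ofReal (1 - γ n) • μ n + ENNReal.ofReal (γ n) • Measure.dirac (X n)

/-- The measures `ν^N = ∑_{n=1}^N β_{n-1} (1 - γ_n) μ_n + β_N δ_{X_N}`. -/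
def stairNu (X : ℕ → Mat d m) (μ : ℕ → Measure (Mat d m)) (γ : ℕ → ℝ) (N : ℕ) :
    Measure (Mat d m) :=
  ∑ n ∈ Finset.range N, ENNReal.ofReal (stairBeta γ n * (1 - γ (n + 1))) • μ (n + 1)
    + ENNReal.ofReal (stairBeta γ N) • Measure.dirac (X N)

/-- `ν` is a staircase laminate supported on `K`, with construction steps in `U`, with soaring
sequence `X_0, X_1, …`, measures `μ_1, μ_2, …` and scalars `γ_1, γ_2, …` (the values `μ_0`, `γ_0`
play no role), and with barycenter `X_0`. Since `β_N → 0`, the limit `ν` is carried by the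
countably many atoms of the `μ_n`, which lie in `K`. -/
structure IsStaircaseWith (K U : Set (Mat d m)) (X : ℕ → Mat d m)
    (μ : ℕ → Measure (Mat d m)) (γ : ℕ → ℝ) (ν : Measure (Mat d m)) : Prop where
  injective : Function.Injective X
  notMem : ∀ n, X n ∉ K
  mem : ∀ n, X n ∈ U
  atomic : ∀ n, IsFiniteAtomicOn K (μ (n + 1))
  gamma_mem : ∀ n, γ (n + 1) ∈ Set.Ioo (0 : ℝ) 1
  laminate : ∀ n, IsLaminateOfFiniteOrder U (X n) (stairOmega X μ γ (n + 1))
  norm_strictMono : StrictMono fun n => ‖X n‖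
  norm_tendsto : Tendsto (fun n => ‖X n‖) atTop atTop
  beta_tendsto : Tendsto (stairBeta γ) atTop (𝓝 0)
  isProbabilityMeasure : IsProbabilityMeasure ν
  tendsto : ∀ E, MeasurableSet E → Tendsto (fun N => stairNu X μ γ N E) atTop (𝓝 (ν E))
  integrable_id : Integrable (fun Y : Mat d m => Y) ν
  barycenter : ∫ Y, Y ∂ν = X 0

/-- `ν ∈ SL(K, U)` with barycenter `X₀`: `ν` is a staircase laminate supported on `K`, with
construction steps in `U`, whose soaring sequence starts at `X₀`. -/
def IsStaircaseLaminate (K U : Set (Mat d m)) (X₀ : Mat d m) (ν : Measure (Mat d m)) : Prop :=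
  ∃ (X : ℕ → Mat d m) (μ : ℕ → Measure (Mat d m)) (γ : ℕ → ℝ),
    X 0 = X₀ ∧ IsStaircaseWith K U X μ γ ν

end ConvexIntegration

end

noncomputable section

namespace ConvexIntegration

variable {d m : ℕ}

/-! ### Affine maps and local gradients -/

/-! A laminate of finite order is, up to small errors, the gradient distribution of a map close to
an affine one. For one splitting `X = s B + (1 - s) B'` with `B' - B = a ⊗ n`, add `h • a` to the
affine map, where `h` is a fine sawtooth with slopes `s` and `-(1 - s)` along `n`, cut off near the
boundary of a cube by a cone of small slope. The gradient is `B'` or `B` except in a thin layer,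
where it stays close to `X` and hence in the open set `U` (`exists_scalar_block`,
`block_proportions`, `realizable_splitting`). Vitali coverings by cubes extend this to bounded open
sets. Iterating over the splittings gives `IsLaminateOfFiniteOrder.realizable`: volumes are right up
to a factor `1 ± ε`, and the perturbation is at most `ε` in sup norm, with a Lipschitz constant
independent of `ε`.

The staircase is then climbed step by step (`IsStaircaseWith.exists_next`). On `O_n` the map has
gradient `X_n`, and a realization of `ω_{n+1}` is added there. The points that get gradient
`X_{n+1}` form `O_{n+1}`, of measure about `β_{n+1} |Ω|`. The other good points, distributed nearly
like `β_n (1 - γ_{n+1}) μ_{n+1}`, and the error points are never touched again. Since the Lipschitz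
constant of a step is known before its precision is chosen, the precision can make all errors
summable: the relative volume errors, the integral of `(1 + |∇w|)^q` over the error sets, and, by
interpolation between the Lipschitz and sup bounds, the Hölder seminorm of the increment.

The sets `O_n` decrease to a null set because `β_n → 0`, so the limit is locally affine almost
everywhere, with good gradients distributed like `ν` up to `1 ± ε`. For the pointwise gradient to be
the weak one, nothing may concentrate on `O_n`: `|X_n| |O_n| → 0` is required. This follows from the
barycenter condition, as `β_n X_n` is the tail of the series for `∫ Y dν`
(`IsStaircaseWith.tendsto_beta_smul`). -/

theorem affineMap_apply (Y : Mat d m) (b : Vec d) (x : Vec m) (i : Fin d) :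
    affineMap Y b x i = ∑ j, Y (i, j) * x j + b i := by
  simp [affineMap, Mat.toMatrix, Matrix.mulVec, dotProduct]

theorem affineMap_add (Y Z : Mat d m) (b c : Vec d) (x : Vec m) :
    affineMap Y b x + affineMap Z c x = affineMap (Y + Z) (b + c) x := by
  ext i
  simp only [PiLp.add_apply, affineMap_apply, add_mul, Finset.sum_add_distrib]
  ring

theorem affineMap_zero (x : Vec m) : affineMap (0 : Mat d m) 0 x = 0 := by
  ext i
  simp [affineMap_apply]

/-- The continuous linear map attached to a matrix. -/
def linMap (Y : Mat d m) : Vec m →L[ℝ] Vec d :=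
  LinearMap.toContinuousLinearMap
    { toFun := fun x => affineMap Y 0 x
      map_add' := fun x y => by
        ext i
        simp [affineMap_apply, mul_add, Finset.sum_add_distrib]
      map_smul' := fun c x => by
        ext i
        simp only [affineMap_apply, PiLp.smul_apply, smul_eq_mul, RingHom.id_apply,
          Finset.mul_sum, PiLp.zero_apply, add_zero]
        exact Finset.sum_congr rfl fun j _ => by ring }

theorem affineMap_eq (Y : Mat d m) (b : Vec d) (x : Vec m) :
    affineMap Y b x = linMap Y x + b := by
  ext i
  simp [linMap, affineMap_apply]

theorem linMap_single (Y : Mat d m) (i : Fin d) (j : Fin m) :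
    linMap Y (EuclideanSpace.single j 1) i = Y (i, j) := by
  simp [linMap, affineMap_apply]

theorem affineMap_lipschitz (Y : Mat d m) (b : Vec d) :
    LipschitzWith ‖linMap Y‖₊ (affineMap Y b) := by
  refine LipschitzWith.of_dist_le_mul fun x y => ?_
  rw [affineMap_eq, affineMap_eq, dist_add_right]
  exact (linMap Y).lipschitz.dist_le_mul x y

/-- Near `x`, the map `w` is affine with gradient `Y`. -/
def HasLocGrad (w : Vec m → Vec d) (Y : Mat d m) (x : Vec m) : Prop :=
  ∃ b, ∀ᶠ y in 𝓝 x, w y = affineMap Y b y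

/-- The gradient matrix of `w`. -/
def grad (w : Vec m → Vec d) (x : Vec m) : Mat d m :=
  WithLp.toLp 2 fun p => fderiv ℝ w x (EuclideanSpace.single p.2 1) p.1

theorem grad_apply (w : Vec m → Vec d) (x : Vec m) (i : Fin d) (j : Fin m) :
    grad w x (i, j) = fderiv ℝ w x (EuclideanSpace.single j 1) i := rfl

theorem HasLocGrad.hasFDerivAt {w : Vec m → Vec d} {Y : Mat d m} {x : Vec m}
    (h : HasLocGrad w Y x) : HasFDerivAt w (linMap Y) x := by
  obtain ⟨b, hb⟩ := h
  have h1 : HasFDerivAt (fun y => linMap Y y + b) (linMap Y) x :=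
    (linMap Y).hasFDerivAt.add_const b
  refine h1.congr_of_eventuallyEq ?_
  filter_upwards [hb] with y hy
  rw [hy, affineMap_eq]

theorem HasLocGrad.grad_eq {w : Vec m → Vec d} {Y : Mat d m} {x : Vec m}
    (h : HasLocGrad w Y x) : grad w x = Y := by
  ext ⟨i, j⟩
  rw [grad_apply, h.hasFDerivAt.fderiv, linMap_single]

theorem HasLocGrad.unique {w : Vec m → Vec d} {Y Z : Mat d m} {x : Vec m}
    (h : HasLocGrad w Y x) (h' : HasLocGrad w Z x) : Y = Z := by
  rw [← h.grad_eq, h'.grad_eq]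

theorem HasLocGrad.congr {w v : Vec m → Vec d} {Y : Mat d m} {x : Vec m}
    (h : HasLocGrad w Y x) (hv : ∀ᶠ y in 𝓝 x, v y = w y) : HasLocGrad v Y x := by
  obtain ⟨b, hb⟩ := h
  exact ⟨b, by filter_upwards [hb, hv] with y h1 h2; rw [h2, h1]⟩

theorem HasLocGrad.add {w v : Vec m → Vec d} {Y Z : Mat d m} {x : Vec m}
    (h : HasLocGrad w Y x) (h' : HasLocGrad v Z x) :
    HasLocGrad (fun y => w y + v y) (Y + Z) x := by
  obtain ⟨b, hb⟩ := h
  obtain ⟨c, hc⟩ := h'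
  exact ⟨b + c, by filter_upwards [hb, hc] with y h1 h2; rw [h1, h2, affineMap_add]⟩

theorem HasLocGrad.affine (Y : Mat d m) (b : Vec d) (x : Vec m) :
    HasLocGrad (affineMap Y b) Y x := ⟨b, Eventually.of_forall fun _ => rfl⟩

theorem HasLocGrad.zero (x : Vec m) : HasLocGrad (fun _ => (0 : Vec d)) (0 : Mat d m) x :=
  ⟨0, Eventually.of_forall fun y => (affineMap_zero y).symm⟩

theorem HasLocGrad.eventually {w : Vec m → Vec d} {Y : Mat d m} {x : Vec m}
    (h : HasLocGrad w Y x) : ∀ᶠ y in 𝓝 x, HasLocGrad w Y y := by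
  obtain ⟨b, hb⟩ := h
  filter_upwards [eventually_eventually_nhds.2 hb] with y hy using ⟨b, hy⟩

/-- A local gradient is constant near the point, so `P` needs no continuity. The sets where a
gradient takes, or avoids, a prescribed value are thus open, and further perturbations can be
inserted there. -/
theorem isOpen_hasLocGrad (w : Vec m → Vec d) (P : Mat d m → Prop) :
    IsOpen {x | ∃ Y, P Y ∧ HasLocGrad w Y x} := by
  refine isOpen_iff_mem_nhds.2 fun x hx => ?_
  obtain ⟨Y, hP, hY⟩ := hx
  filter_upwards [hY.eventually] with y hy using ⟨Y, hP, hy⟩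

theorem measurable_grad (w : Vec m → Vec d) : Measurable (grad w) := by
  refine (WithLp.measurable_toLp 2 _).comp (measurable_pi_lambda _ fun p => ?_)
  have h := measurable_fderiv_apply_const ℝ w (EuclideanSpace.single p.2 (1 : ℝ))
  exact ((measurable_pi_apply p.1).comp (WithLp.measurable_ofLp 2 _)).comp h

theorem norm_le_sum_abs {ι : Type*} [Fintype ι] (Y : EuclideanSpace ℝ ι) :
    ‖Y‖ ≤ ∑ i, |Y i| := by
  rw [EuclideanSpace.norm_eq]
  refine Real.sqrt_le_iff.2 ⟨Finset.sum_nonneg fun i _ => abs_nonneg _, ?_⟩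
  exact Finset.sum_sq_le_sq_sum_of_nonneg fun i _ => norm_nonneg _

theorem norm_grad_le {w : Vec m → Vec d} {L : ℝ≥0} (hw : LipschitzWith L w) (x : Vec m) :
    ‖grad w x‖ ≤ (d * m) * L := by
  refine (norm_le_sum_abs _).trans ?_
  have h : ∀ p ∈ (Finset.univ : Finset (Fin d × Fin m)), |grad w x p| ≤ L := by
    rintro ⟨i, j⟩ -
    rw [grad_apply, ← Real.norm_eq_abs]
    refine (PiLp.norm_apply_le _ i).trans ?_
    refine ((fderiv ℝ w x).le_opNorm _).trans ?_
    simpa using norm_fderiv_le_of_lipschitz ℝ hw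
  refine (Finset.sum_le_card_nsmul _ _ _ h).trans ?_
  simp

/-! ### Cubes -/

/-- The closed cube with center `c` and half side length `r`. -/
def cube (c : Vec m) (r : ℝ) : Set (Vec m) := WithLp.ofLp ⁻¹' Metric.closedBall (WithLp.ofLp c) r

/-- The open cube with center `c` and half side length `r`. -/
def openCube (c : Vec m) (r : ℝ) : Set (Vec m) := WithLp.ofLp ⁻¹' Metric.ball (WithLp.ofLp c) r

theorem openCube_subset_cube (c : Vec m) (r : ℝ) : openCube c r ⊆ cube c r :=
  Set.preimage_mono Metric.ball_subset_closedBall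

theorem isOpen_openCube (c : Vec m) (r : ℝ) : IsOpen (openCube c r) :=
  Metric.isOpen_ball.preimage (PiLp.continuous_ofLp 2 _)

theorem volume_openCube (c : Vec m) {r : ℝ} (hr : 0 < r) :
    volume (openCube c r) = ENNReal.ofReal ((2 * r) ^ m) := by
  rw [openCube, (PiLp.volume_preserving_ofLp (Fin m)).measure_preimage
    Metric.isOpen_ball.measurableSet.nullMeasurableSet, Real.volume_pi_ball _ hr, Fintype.card_fin]

theorem volume_cube (c : Vec m) {r : ℝ} (hr : 0 < r) :
    volume (cube c r) = ENNReal.ofReal ((2 * r) ^ m) := by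
  rw [cube, (PiLp.volume_preserving_ofLp (Fin m)).measure_preimage
    Metric.isClosed_closedBall.measurableSet.nullMeasurableSet, Real.volume_pi_closedBall _ hr.le,
    Fintype.card_fin]

theorem volume_cube_diff_openCube (c : Vec m) {r : ℝ} (hr : 0 < r) :
    volume (cube c r \ openCube c r) = 0 := by
  rw [measure_sdiff (openCube_subset_cube c r) (isOpen_openCube c r).nullMeasurableSet,
    volume_cube c hr, volume_openCube c hr, tsub_self]
  rw [volume_openCube c hr]
  exact ENNReal.ofReal_ne_top

theorem isRegularDomain_openCube (c : Vec m) {r : ℝ} (hr : 0 < r) :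
    IsRegularDomain (openCube c r) := by
  have hconv : Convex ℝ (openCube c r) := by
    have := (convex_ball (WithLp.ofLp c) r).linear_preimage
      (WithLp.linearEquiv 2 ℝ (Fin m → ℝ)).toLinearMap
    exact this
  refine ⟨isOpen_openCube c r, ?_, ⟨⟨c, ?_⟩, hconv.isPreconnected⟩, hconv.addHaar_frontier _⟩
  · exact (PiLp.antilipschitzWith_ofLp 2 _).isBounded_preimage Metric.isBounded_ball
  · exact Metric.mem_ball_self hr

/-- Cubes are balls of the sup norm, so Vitali's theorem in `Fin m → ℝ` applies, tripling a cube
costing a factor `3 ^ m`. The measure preserving map `WithLp.ofLp` transfers the covering. Closed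
and open cubes differ by null sets. -/
theorem exists_disjoint_cubes (V : Set (Vec m)) (hV : IsOpen V) (P : Vec m → ℝ → Prop)
    (hP : ∀ x ∈ V, ∃ δ > 0, ∀ r, 0 < r → r ≤ δ → P x r) :
    ∃ T : Set (Vec m × ℝ), T.Countable ∧ (∀ p ∈ T, 0 < p.2 ∧ cube p.1 p.2 ⊆ V ∧ P p.1 p.2) ∧
      T.PairwiseDisjoint (fun p => cube p.1 p.2) ∧
      volume (V \ ⋃ p ∈ T, openCube p.1 p.2) = 0 := by
  let t : Set (Vec m × ℝ) := {p | 0 < p.2 ∧ cube p.1 p.2 ⊆ V ∧ P p.1 p.2}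
  have hcl : ∀ a : Vec m × ℝ, IsClosed (cube a.1 a.2) := fun a =>
    Metric.isClosed_closedBall.preimage (PiLp.continuous_ofLp 2 _)
  obtain ⟨u, hut, hu, hdis, hcov⟩ := Vitali.exists_disjoint_covering_ae
    (volume : Measure (Fin m → ℝ)) (WithLp.toLp 2 ⁻¹' V) t (3 ^ m) (fun p => p.2)
    (fun p => WithLp.ofLp p.1) (fun p => Metric.closedBall (WithLp.ofLp p.1) p.2)
    (fun _ _ => subset_rfl) (by
      intro a ha
      rw [Real.volume_pi_closedBall _ ha.1.le,
        Real.volume_pi_closedBall _ (by linarith [ha.1]), Fintype.card_fin,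
        show 2 * (3 * a.2) = 3 * (2 * a.2) by ring, mul_pow,
        ENNReal.ofReal_mul (by positivity)]
      simp)
    (fun a ha => ⟨_, Metric.ball_subset_interior_closedBall (Metric.mem_ball_self ha.1)⟩)
    (fun a _ => Metric.isClosed_closedBall) (by
      intro x hx ε hε
      obtain ⟨δ, hδ, hδP⟩ := hP _ hx
      obtain ⟨ρ, hρ, hρV⟩ := Metric.isOpen_iff.1 (hV.preimage (PiLp.continuous_toLp 2 _)) x hx
      -- Halving `ρ` keeps the closed cube inside the open ball contained in `V`.
      refine ⟨(WithLp.toLp 2 x, min (min δ ε) (ρ / 2)), ⟨by positivity, ?_, ?_⟩, ?_, rfl⟩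
      · intro y hy
        have : WithLp.ofLp y ∈ Metric.ball x ρ := by
          refine Metric.closedBall_subset_ball ?_ hy
          exact (min_le_right _ _).trans_lt (by linarith)
        exact hρV this
      · exact hδP _ (by positivity) ((min_le_left _ _).trans (min_le_left _ _))
      · exact (min_le_left _ _).trans (min_le_right _ _))
  refine ⟨u, hu, fun p hp => hut hp, fun p hp q hq hpq => (hdis hp hq hpq).preimage _, ?_⟩
  have hsub : V \ ⋃ p ∈ u, openCube p.1 p.2 ⊆
      (V \ ⋃ p ∈ u, cube p.1 p.2) ∪ ⋃ p ∈ u, (cube p.1 p.2 \ openCube p.1 p.2) := by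
    rintro x ⟨hx, hx'⟩
    by_cases h : x ∈ ⋃ p ∈ u, cube p.1 p.2
    · right
      simp only [Set.mem_iUnion, exists_prop] at h hx' ⊢
      obtain ⟨p, hp, hxp⟩ := h
      exact ⟨p, hp, hxp, fun h' => hx' ⟨p, hp, h'⟩⟩
    · exact Or.inl ⟨hx, h⟩
  refine measure_mono_null hsub (measure_union_null ?_ ?_)
  · have h0 : V \ ⋃ p ∈ u, cube p.1 p.2 = WithLp.ofLp ⁻¹' (WithLp.toLp 2 ⁻¹' V \
        ⋃ a ∈ u, Metric.closedBall (WithLp.ofLp a.1) a.2) := by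
      ext x
      simp [cube]
    rw [h0, (PiLp.volume_preserving_ofLp (Fin m)).measure_preimage]
    · exact hcov
    · refine ((hV.preimage (PiLp.continuous_toLp 2 _)).measurableSet.diff ?_).nullMeasurableSet
      exact MeasurableSet.biUnion hu fun a _ => Metric.isClosed_closedBall.measurableSet
  · exact (measure_biUnion_null_iff hu).2 fun p hp => volume_cube_diff_openCube _ (hut hp).1

/-- Sufficiently small cubes lie in a single affine piece, and they serve as the regular domains. -/
theorem isPiecewiseAffine_of_hasLocGrad {Ω V : Set (Vec m)} {w : Vec m → Vec d} (hV : IsOpen V)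
    (hVΩ : V ⊆ Ω) (h0 : volume (Ω \ V) = 0) (hw : ∀ x ∈ V, ∃ Y, HasLocGrad w Y x) :
    IsPiecewiseAffine Ω w := by
  obtain ⟨T, hT, hTV, hdis, hcov⟩ := exists_disjoint_cubes V hV
    (fun c r => ∃ (X : Mat d m) (b : Vec d), ∀ x ∈ openCube c r, w x = affineMap X b x) (by
      intro x hx
      obtain ⟨Y, b, hb⟩ := hw x hx
      obtain ⟨ρ, hρ, hball⟩ := Metric.eventually_nhds_iff_ball.1
        ((PiLp.continuous_toLp 2 (fun _ : Fin m => ℝ)).tendsto (WithLp.ofLp x) |>.eventually hb)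
      refine ⟨ρ, hρ, fun r _ hr' => ⟨Y, b, fun y hy => ?_⟩⟩
      exact hball _ (Metric.ball_subset_ball hr' hy))
  have hdis' : T.PairwiseDisjoint (fun p => openCube p.1 p.2) := fun p hp q hq hpq =>
    (hdis hp hq hpq).mono (openCube_subset_cube _ _) (openCube_subset_cube _ _)
  refine ⟨(fun p => openCube p.1 p.2) '' T, hT.image _, ?_, ?_, ?_⟩
  · rintro _ ⟨p, hp, rfl⟩ _ ⟨q, hq, rfl⟩ hpq
    exact hdis' hp hq fun h => hpq (by rw [h])
  · rintro _ ⟨p, hp, rfl⟩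
    exact ⟨isRegularDomain_openCube _ (hTV p hp).1,
      ((openCube_subset_cube _ _).trans (hTV p hp).2.1).trans hVΩ, (hTV p hp).2.2⟩
  · rw [Set.sUnion_image]
    refine measure_mono_null ?_ (measure_union_null h0 hcov)
    intro x hx
    by_cases h : x ∈ V
    · exact Or.inr ⟨h, hx.2⟩
    · exact Or.inl ⟨hx.1, h⟩

/-! ### The scalar building block -/

/-- Near `x`, the function `h` is affine with gradient `v`. -/
def HasScalarGrad (h : Vec m → ℝ) (v : Vec m) (x : Vec m) : Prop :=
  ∃ c, ∀ᶠ y in 𝓝 x, h y = inner ℝ v y + c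

theorem HasScalarGrad.congr {h k : Vec m → ℝ} {v x : Vec m} (H : HasScalarGrad h v x)
    (hk : ∀ᶠ y in 𝓝 x, k y = h y) : HasScalarGrad k v x := by
  obtain ⟨c, hc⟩ := H
  exact ⟨c, by filter_upwards [hc, hk] with y h1 h2; rw [h2, h1]⟩

theorem HasScalarGrad.hasFDerivAt {h : Vec m → ℝ} {v x : Vec m} (H : HasScalarGrad h v x) :
    HasFDerivAt h (innerSL ℝ v) x := by
  obtain ⟨c, hc⟩ := H
  refine HasFDerivAt.congr_of_eventuallyEq (f := fun y => innerSL ℝ v y + c) ?_ ?_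
  · exact (innerSL ℝ v).hasFDerivAt.add_const c
  · filter_upwards [hc] with y hy
    simpa using hy

theorem HasScalarGrad.lineDeriv {h : Vec m → ℝ} {v x : Vec m} (H : HasScalarGrad h v x)
    (u : Vec m) : lineDeriv ℝ h x u = inner ℝ v u := by
  have := (H.hasFDerivAt.hasLineDerivAt u).lineDeriv
  simpa using this

theorem HasScalarGrad.norm_le {h : Vec m → ℝ} {v x : Vec m} (H : HasScalarGrad h v x)
    {L : ℝ≥0} (hL : LipschitzWith L h) : ‖v‖ ≤ L := by
  have h1 := norm_fderiv_le_of_lipschitz ℝ hL (x₀ := x)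
  rwa [H.hasFDerivAt.fderiv, innerSL_apply_norm] at h1

theorem HasScalarGrad.eventually {h : Vec m → ℝ} {v x : Vec m} (H : HasScalarGrad h v x) :
    ∀ᶠ y in 𝓝 x, HasScalarGrad h v y := by
  obtain ⟨b, hb⟩ := H
  filter_upwards [eventually_eventually_nhds.2 hb] with y hy using ⟨b, hy⟩

theorem isOpen_hasScalarGrad (h : Vec m → ℝ) : IsOpen {x | ∃ v, HasScalarGrad h v x} := by
  refine isOpen_iff_mem_nhds.2 fun x hx => ?_
  obtain ⟨v, hv⟩ := hx
  filter_upwards [hv.eventually] with y hy using ⟨v, hy⟩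

theorem volume_inner_eq (v : Vec m) (hv : v ≠ 0) (t : ℝ) :
    volume {x : Vec m | inner ℝ v x = t} = 0 := by
  have hne : (ℝ ∙ v)ᗮ ≠ ⊤ := by
    intro h
    have : v ∈ (ℝ ∙ v)ᗮ := h ▸ Submodule.mem_top
    rw [Submodule.mem_orthogonal_singleton_iff_inner_right, inner_self_eq_zero] at this
    exact hv this
  rcases Set.eq_empty_or_nonempty {x : Vec m | inner ℝ v x = t} with h | ⟨x₀, hx₀⟩
  · rw [h, measure_empty]
  · have h0 := Measure.addHaar_submodule volume _ hne
    rw [← measure_preimage_add_right volume (-x₀)] at h0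
    refine measure_mono_null (fun x hx => ?_) h0
    have hx₀' : inner ℝ v x₀ = t := hx₀
    have hx' : inner ℝ v x = t := hx
    simp [Submodule.mem_orthogonal_singleton_iff_inner_right, inner_add_right, inner_neg_right,
      hx', hx₀']

/-- The sup norm. -/
def supNorm (x : Vec m) : ℝ := ‖WithLp.ofLp x‖

theorem supNorm_lipschitz : LipschitzWith 1 (supNorm (m := m)) := by
  have h := lipschitzWith_one_norm.comp (PiLp.lipschitzWith_ofLp 2 (fun _ : Fin m => ℝ))
  rw [one_mul] at h
  exact h

theorem mem_openCube_iff {c x : Vec m} {r : ℝ} : x ∈ openCube c r ↔ supNorm (x - c) < r := by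
  simp [openCube, supNorm, dist_eq_norm]

/-- Off the hyperplanes `x_i = ± x_j` and `x_i = 0` one coordinate strictly dominates, and the norm
is `x_i` or `-x_i` nearby. -/
theorem hasScalarGrad_supNorm_ae (hm : 0 < m) :
    volume {x : Vec m | ¬ ∃ v, HasScalarGrad (supNorm (m := m)) v x} = 0 := by
  have : Nonempty (Fin m) := ⟨⟨0, hm⟩⟩
  let e : Fin m → Vec m := fun i => EuclideanSpace.single i 1
  have he : ∀ i x, inner ℝ (e i) x = x i := fun i x => by
    simp [e, EuclideanSpace.inner_single_left]
  have hne : ∀ i j, i ≠ j → ∀ σ : ℝ, e i + σ • e j ≠ 0 := by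
    intro i j hij σ h
    have := congrArg (fun y : Vec m => y i) h
    simp [e, hij] at this
  have hnull : volume (⋃ i, ⋃ j, ⋃ (_ : i ≠ j), ({x : Vec m | inner ℝ (e i + (1 : ℝ) • e j) x = 0} ∪
      {x : Vec m | inner ℝ (e i + (-1 : ℝ) • e j) x = 0})) = 0 := by
    refine measure_iUnion_null fun i => measure_iUnion_null fun j => measure_iUnion_null fun hij => ?_
    exact measure_union_null (volume_inner_eq _ (hne i j hij _) _)
      (volume_inner_eq _ (hne i j hij _) _)
  have hnull2 : volume (⋃ i, {x : Vec m | inner ℝ (e i) x = 0}) = 0 := by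
    refine measure_iUnion_null fun i => volume_inner_eq _ (fun h => ?_) _
    have := congrArg (fun y : Vec m => y i) h
    simp [e] at this
  refine measure_mono_null (fun x hx => ?_) (measure_union_null hnull hnull2)
  by_contra hx'
  simp only [Set.mem_union, Set.mem_iUnion, not_or, not_exists, Set.mem_ofPred_eq, inner_add_left,
    inner_smul_left, he] at hx'
  obtain ⟨h1, h2⟩ := hx'
  refine hx ?_
  obtain ⟨i, -, hi⟩ := Finset.exists_max_image Finset.univ (fun i => |x i|) Finset.univ_nonempty
  have hlt : ∀ j, j ≠ i → |x j| < |x i| := by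
    intro j hj
    refine lt_of_le_of_ne (hi j (Finset.mem_univ _)) fun h => ?_
    have h3 := h1 i j hj.symm
    rcases abs_eq_abs.1 h with h | h <;> simp [h] at h3
  have hcont : ∀ j, Continuous fun y : Vec m => y j := fun j => by fun_prop
  have hev : ∀ᶠ y in 𝓝 x, ∀ j, j ≠ i → |y j| < |y i| := by
    rw [eventually_all]
    intro j
    rcases eq_or_ne j i with rfl | hj
    · exact Eventually.of_forall fun y h => (h rfl).elim
    · filter_upwards [(hcont j).abs.continuousAt.eventually_lt (hcont i).abs.continuousAt
        (hlt j hj)] with y hy _ using hy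
  have hsup : ∀ᶠ y in 𝓝 x, supNorm y = |y i| := by
    filter_upwards [hev] with y hy
    refine le_antisymm ((pi_norm_le_iff_of_nonneg (abs_nonneg _)).2 fun j => ?_) ?_
    · rcases eq_or_ne j i with rfl | hj
      · exact le_rfl
      · exact (hy j hj).le
    · exact norm_le_pi_norm (WithLp.ofLp y) i
  rcases lt_or_gt_of_ne (h2 i) with hneg | hpos
  · refine ⟨-e i, 0, ?_⟩
    filter_upwards [hsup, (hcont i).continuousAt.eventually_lt continuousAt_const hneg] with y hy h
    rw [hy, abs_of_neg h, inner_neg_left, he, add_zero]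
  · refine ⟨e i, 0, ?_⟩
    filter_upwards [hsup, continuousAt_const.eventually_lt (hcont i).continuousAt hpos] with y hy h
    rw [hy, abs_of_pos h, he, add_zero]

/-! ### Sawtooth plane waves -/

/-- The sawtooth of period one with slopes `s` and `-(1 - s)`. -/
def saw (s u : ℝ) : ℝ := min (s * Int.fract u) ((1 - s) * (1 - Int.fract u))

theorem saw_nonneg {s : ℝ} (hs : s ∈ Set.Ioo (0 : ℝ) 1) (u : ℝ) : 0 ≤ saw s u :=
  le_min (mul_nonneg hs.1.le (Int.fract_nonneg _))
    (mul_nonneg (by linarith [hs.2]) (by linarith [Int.fract_lt_one u]))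

theorem saw_le {s : ℝ} (hs : s ∈ Set.Ioo (0 : ℝ) 1) (u : ℝ) : saw s u ≤ 1 := by
  refine (min_le_left _ _).trans ?_
  nlinarith [hs.1, hs.2, Int.fract_lt_one u, Int.fract_nonneg u]

theorem saw_le_fract {s : ℝ} (hs : s ∈ Set.Ioo (0 : ℝ) 1) (u : ℝ) : saw s u ≤ Int.fract u := by
  refine (min_le_left _ _).trans ?_
  nlinarith [hs.1, hs.2, Int.fract_lt_one u, Int.fract_nonneg u]

theorem saw_le_one_sub_fract {s : ℝ} (hs : s ∈ Set.Ioo (0 : ℝ) 1) (u : ℝ) :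
    saw s u ≤ 1 - Int.fract u := by
  refine (min_le_right _ _).trans ?_
  nlinarith [hs.1, hs.2, Int.fract_lt_one u, Int.fract_nonneg u]

/-- Within one period the profile is a minimum of two 1-Lipschitz functions. Otherwise the value at
`u` is at most the distance to the next integer and the value at `v` at most the distance to the
previous one, and these two distances together do not exceed `v - u`. -/
theorem saw_sub_le {s : ℝ} (hs : s ∈ Set.Ioo (0 : ℝ) 1) {u v : ℝ} (huv : u ≤ v) :
    |saw s u - saw s v| ≤ v - u := by
  have hu := Int.floor_add_fract u
  have hv := Int.floor_add_fract v
  rcases eq_or_lt_of_le (Int.floor_mono huv) with h | h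
  · rw [saw, saw]
    refine (abs_min_sub_min_le_max _ _ _ _).trans (max_le ?_ ?_)
    · rw [← mul_sub, abs_mul, abs_of_pos hs.1]
      have : Int.fract u - Int.fract v = -(v - u) := by rw [h] at hu; linarith
      rw [this, abs_neg, abs_of_nonneg (sub_nonneg.2 huv)]
      nlinarith [hs.2]
    · rw [← mul_sub, abs_mul, abs_of_pos (by linarith [hs.2] : 0 < 1 - s)]
      have : 1 - Int.fract u - (1 - Int.fract v) = v - u := by rw [h] at hu; linarith
      rw [this, abs_of_nonneg (sub_nonneg.2 huv)]
      nlinarith [hs.1]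
  · have h1 : (⌊u⌋ : ℝ) + 1 ≤ ⌊v⌋ := by exact_mod_cast h
    have h2 := saw_le_one_sub_fract hs u
    have h3 := saw_le_fract hs v
    have h4 := saw_nonneg hs u
    have h5 := saw_nonneg hs v
    have := Int.fract_nonneg v
    have := Int.fract_lt_one u
    rw [abs_le]
    constructor <;> linarith

theorem saw_lipschitz {s : ℝ} (hs : s ∈ Set.Ioo (0 : ℝ) 1) : LipschitzWith 1 (saw s) := by
  refine LipschitzWith.of_dist_le_mul fun u v => ?_
  rw [Real.dist_eq, Real.dist_eq, NNReal.coe_one, one_mul]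
  rcases le_total u v with h | h
  · rw [abs_sub_comm u v, abs_of_nonneg (sub_nonneg.2 h)]
    exact saw_sub_le hs h
  · rw [abs_of_nonneg (sub_nonneg.2 h), abs_sub_comm]
    exact saw_sub_le hs h

theorem eventually_floor_eq {u : ℝ} (h0 : 0 < Int.fract u) : ∀ᶠ v in 𝓝 u, ⌊v⌋ = ⌊u⌋ := by
  have h1 : (⌊u⌋ : ℝ) < u := by linarith [Int.floor_add_fract u]
  filter_upwards [Ioo_mem_nhds h1 (Int.lt_floor_add_one u)] with v hv
  exact Int.floor_eq_iff.2 ⟨hv.1.le, hv.2⟩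

theorem saw_eventually_left {s u : ℝ} (h0 : 0 < Int.fract u)
    (h1 : Int.fract u < 1 - s) : ∀ᶠ v in 𝓝 u, saw s v = s * (v - ⌊u⌋) := by
  have h2 : u < ⌊u⌋ + (1 - s) := by linarith [Int.floor_add_fract u]
  filter_upwards [eventually_floor_eq h0, Iio_mem_nhds h2] with v hv hv'
  have hfr : Int.fract v = v - ⌊u⌋ := by rw [Int.fract, hv]
  rw [saw, hfr, min_eq_left]
  have : v < ⌊u⌋ + (1 - s) := hv'
  nlinarith

theorem saw_eventually_right {s u : ℝ} (h0 : 0 < Int.fract u)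
    (h1 : 1 - s < Int.fract u) : ∀ᶠ v in 𝓝 u, saw s v = (1 - s) * (1 - (v - ⌊u⌋)) := by
  have h2 : ⌊u⌋ + (1 - s) < u := by linarith [Int.floor_add_fract u]
  filter_upwards [eventually_floor_eq h0, Ioi_mem_nhds h2] with v hv hv'
  have hfr : Int.fract v = v - ⌊u⌋ := by rw [Int.fract, hv]
  rw [saw, hfr, min_eq_right]
  have : ⌊u⌋ + (1 - s) < v := hv'
  nlinarith

/-- The plane wave with profile `saw`. -/
def planeWave (s η : ℝ) (n x : Vec m) : ℝ := η * saw s (inner ℝ n x / η)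

theorem planeWave_lipschitz {s : ℝ} (hs : s ∈ Set.Ioo (0 : ℝ) 1) {η : ℝ} (hη : 0 < η)
    (n : Vec m) : LipschitzWith ‖n‖₊ (planeWave s η n) := by
  refine LipschitzWith.of_dist_le_mul fun x y => ?_
  rw [Real.dist_eq, planeWave, planeWave, ← mul_sub, abs_mul, abs_of_pos hη]
  have h := (saw_lipschitz hs).dist_le_mul (inner ℝ n x / η) (inner ℝ n y / η)
  rw [Real.dist_eq, Real.dist_eq, ← sub_div, abs_div, abs_of_pos hη, ← inner_sub_right,
    NNReal.coe_one, one_mul, le_div_iff₀ hη] at h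
  rw [mul_comm, dist_eq_norm]
  exact h.trans (abs_real_inner_le_norm _ _)

theorem planeWave_left {s η : ℝ} (hη : 0 < η) {n x : Vec m}
    (h0 : 0 < Int.fract (inner ℝ n x / η)) (h1 : Int.fract (inner ℝ n x / η) < 1 - s) :
    HasScalarGrad (planeWave s η n) (s • n) x := by
  have hc : Continuous fun y : Vec m => inner ℝ n y / η := by fun_prop
  refine ⟨-(η * s * ⌊inner ℝ n x / η⌋), ?_⟩
  filter_upwards [hc.continuousAt.eventually (saw_eventually_left h0 h1)] with y hy
  rw [planeWave, hy, inner_smul_left]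
  simp only [conj_trivial]
  field_simp
  ring

theorem planeWave_right {s η : ℝ} (hη : 0 < η) {n x : Vec m}
    (h0 : 0 < Int.fract (inner ℝ n x / η)) (h1 : 1 - s < Int.fract (inner ℝ n x / η)) :
    HasScalarGrad (planeWave s η n) (-(1 - s) • n) x := by
  have hc : Continuous fun y : Vec m => inner ℝ n y / η := by fun_prop
  refine ⟨η * (1 - s) * (1 + ⌊inner ℝ n x / η⌋), ?_⟩
  filter_upwards [hc.continuousAt.eventually (saw_eventually_right h0 h1)] with y hy
  rw [planeWave, hy, inner_smul_left]
  simp only [conj_trivial]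
  field_simp
  ring

theorem volume_fract_inner_eq {η : ℝ} (hη : 0 < η) {n : Vec m} (hn : n ≠ 0) (t : ℝ) :
    volume {x : Vec m | Int.fract (inner ℝ n x / η) = t} = 0 := by
  refine measure_mono_null (fun x hx => ?_)
    (measure_iUnion_null fun k : ℤ => volume_inner_eq n hn (η * (k + t)))
  refine Set.mem_iUnion.2 ⟨⌊inner ℝ n x / η⌋, ?_⟩
  have hx' : Int.fract (inner ℝ n x / η) = t := hx
  simp only [Set.mem_ofPred_eq]
  rw [← hx', Int.floor_add_fract]
  field_simp

/-! ### The truncated wave and its volume proportions -/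

theorem integral_lineDeriv_eq_zero {h : Vec m → ℝ} {L : ℝ≥0} (hL : LipschitzWith L h)
    (hc : HasCompactSupport h) (v : Vec m) : ∫ x, lineDeriv ℝ h x v = 0 := by
  have h1 := LipschitzWith.integral_lineDeriv_mul_eq (μ := volume)
    (LipschitzWith.const (1 : ℝ) : LipschitzWith 0 fun _ : Vec m => (1 : ℝ)) hL hc (-v)
  have h2 : ∀ x, lineDeriv ℝ (fun _ : Vec m => (1 : ℝ)) x (-v) = 0 := fun x => by
    simp [lineDeriv]
  simpa [h2] using h1.symm

/-- Take the positive part of `min h₁ h₂`, with `h₁` a plane wave of small amplitude and `h₂` a cone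
of slope less than `δ` vanishing on the boundary of the cube. The wave wins away from a thin
boundary layer; where the cone wins, the gradient is small. The Lipschitz constant depends neither
on `κ` nor on the cube. -/
theorem exists_scalar_block {n : Vec m} (hn : n ≠ 0) {s : ℝ} (hs : s ∈ Set.Ioo (0 : ℝ) 1)
    {δ : ℝ} (hδ : 0 < δ) (hδn : δ ≤ ‖n‖) {κ : ℝ} (hκ : 0 < κ) (c : Vec m) {r : ℝ} (hr : 0 < r) :
    ∃ (h : Vec m → ℝ) (g₁ g₂ e : Set (Vec m)),
      LipschitzWith (2 * ‖n‖₊) h ∧ (∀ x, |h x| ≤ κ) ∧ (∀ x ∉ openCube c r, h x = 0) ∧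
      IsOpen g₁ ∧ IsOpen g₂ ∧ IsOpen e ∧ g₁ ⊆ openCube c r ∧ g₂ ⊆ openCube c r ∧
      e ⊆ openCube c r ∧ Disjoint g₁ g₂ ∧ Disjoint g₁ e ∧ Disjoint g₂ e ∧
      volume (openCube c r \ (g₁ ∪ g₂ ∪ e)) = 0 ∧
      (∀ x ∈ g₁, HasScalarGrad h (s • n) x) ∧ (∀ x ∈ g₂, HasScalarGrad h (-(1 - s) • n) x) ∧
      (∀ x ∈ e, ∃ v, ‖v‖ ≤ δ ∧ HasScalarGrad h v x) ∧
      volume.real e ≤ κ * volume.real (openCube c r) := by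
  have hm : 0 < m := by
    rcases Nat.eq_zero_or_pos m with rfl | h
    · exact (hn (Subsingleton.elim _ _)).elim
    · exact h
  -- `ρ` is the width of a boundary layer with relative volume at most `κ`.
  obtain ⟨ρ, hρ, hρr, hρV⟩ : ∃ ρ, 0 < ρ ∧ ρ < r ∧
      (2 * r) ^ m - (2 * (r - ρ)) ^ m ≤ κ * (2 * r) ^ m := by
    have hc : ContinuousAt (fun ρ : ℝ => (2 * r) ^ m - (2 * (r - ρ)) ^ m) 0 := by fun_prop
    have h1 := hc.eventually_lt (continuousAt_const (y := κ * (2 * r) ^ m)) (by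
      simp only [sub_zero, sub_self]; positivity)
    have h2 : ∀ᶠ ρ in 𝓝[>] (0 : ℝ), 0 < ρ ∧ ρ < r ∧
        (2 * r) ^ m - (2 * (r - ρ)) ^ m ≤ κ * (2 * r) ^ m := by
      filter_upwards [self_mem_nhdsWithin, nhdsWithin_le_nhds h1,
        nhdsWithin_le_nhds (Iio_mem_nhds hr)] with ρ h3 h4 h5 using ⟨h3, h5, h4.le⟩
    exact h2.exists
  -- `η` is both the period in the variable `⟨n, x⟩` and a bound for the wave. At depth `ρ` the cone
  -- is already higher than `δ / 2 * ρ ≥ η`, which confines `e` to the layer.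
  obtain ⟨η, hη, hηκ, hηρ⟩ : ∃ η, 0 < η ∧ η ≤ κ ∧ η ≤ δ / 2 * ρ :=
    ⟨min κ (δ / 2 * ρ), by positivity, min_le_left _ _, min_le_right _ _⟩
  set h₁ := planeWave s η n with hh₁
  have h₁nn : ∀ x, 0 ≤ h₁ x := fun x => mul_nonneg hη.le (saw_nonneg hs _)
  have h₁le : ∀ x, h₁ x ≤ η := fun x => mul_le_of_le_one_right hη.le (saw_le hs _)
  have h₁c : Continuous h₁ := (planeWave_lipschitz hs hη n).continuous
  have hSl : LipschitzWith 1 fun x : Vec m => supNorm (x - c) := by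
    refine LipschitzWith.of_dist_le_mul fun x y => ?_
    have := supNorm_lipschitz.dist_le_mul (x - c) (y - c)
    rwa [dist_sub_right] at this
  have hSc : Continuous fun x : Vec m => supNorm (x - c) := hSl.continuous
  -- Only countably many levels of the quotient have positive measure, so a generic slope makes the
  -- interface `h₁ = h₂` null.
  obtain ⟨δ', hδ1, hδ2, hδ'⟩ : ∃ δ', δ / 2 < δ' ∧ δ' < δ ∧
      volume.restrict (openCube c r) {x | h₁ x / (r - supNorm (x - c)) = δ'} = 0 := by
    have hcount := Measure.countable_meas_level_set_pos (μ := volume.restrict (openCube c r))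
      (g := fun x => h₁ x / (r - supNorm (x - c)))
      (h₁c.measurable.div (measurable_const.sub hSc.measurable))
    obtain ⟨δ', hmem, h3⟩ := (hcount.dense_compl ℝ).exists_between (half_lt_self hδ)
    refine ⟨δ', h3.1, h3.2, ?_⟩
    simpa using hmem
  have hδ0 : 0 < δ' := by linarith
  set h₂ : Vec m → ℝ := fun x => δ' * (r - supNorm (x - c)) with hh₂
  have h₂c : Continuous h₂ := by fun_prop
  have h₂l : LipschitzWith δ'.toNNReal h₂ := by
    refine LipschitzWith.of_dist_le_mul fun x y => ?_
    have := hSl.dist_le_mul x y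
    rw [Real.dist_eq, NNReal.coe_one, one_mul] at this
    rw [Real.dist_eq, hh₂, Real.coe_toNNReal _ hδ0.le]
    simp only
    rw [← mul_sub, abs_mul, abs_of_pos hδ0]
    refine mul_le_mul_of_nonneg_left ?_ hδ0.le
    rwa [sub_sub_sub_cancel_left, abs_sub_comm]
  have h₂pos : ∀ x, x ∈ openCube c r ↔ 0 < h₂ x := fun x => by
    rw [mem_openCube_iff]
    simp only [hh₂]
    rw [mul_pos_iff_of_pos_left hδ0, sub_pos]
  let Q := openCube c r
  have hQ : IsOpen Q := isOpen_openCube c r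
  let h : Vec m → ℝ := fun x => max 0 (min (h₁ x) (h₂ x))
  have hfc : Continuous fun y : Vec m => inner ℝ n y / η := by fun_prop
  let A₁ : Set (Vec m) := {x | 0 < Int.fract (inner ℝ n x / η) ∧ Int.fract (inner ℝ n x / η) < 1 - s}
  let A₂ : Set (Vec m) := {x | 0 < Int.fract (inner ℝ n x / η) ∧ 1 - s < Int.fract (inner ℝ n x / η)}
  have hfr : ∀ x : Vec m, 0 < Int.fract (inner ℝ n x / η) →
      ∀ᶠ y in 𝓝 x, Int.fract (inner ℝ n y / η) = inner ℝ n y / η - ⌊inner ℝ n x / η⌋ := by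
    intro x hx
    filter_upwards [hfc.continuousAt.eventually (eventually_floor_eq hx)] with y hy
    rw [Int.fract, hy]
  have hcx : ∀ x : Vec m, ContinuousAt
      (fun y : Vec m => inner ℝ n y / η - ⌊inner ℝ n x / η⌋) x := fun x => by fun_prop
  have hA₁ : IsOpen A₁ := by
    refine isOpen_iff_mem_nhds.2 fun x hx => ?_
    filter_upwards [hfr x hx.1, continuousAt_const.eventually_lt (hcx x) hx.1,
      (hcx x).eventually_lt continuousAt_const hx.2] with y h1 h2 h3
    exact ⟨by rw [h1]; exact h2, by rw [h1]; exact h3⟩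
  have hA₂ : IsOpen A₂ := by
    refine isOpen_iff_mem_nhds.2 fun x hx => ?_
    filter_upwards [hfr x hx.1, continuousAt_const.eventually_lt (hcx x) hx.1,
      continuousAt_const.eventually_lt (hcx x) hx.2] with y h1 h2 h3
    exact ⟨by rw [h1]; exact h2, by rw [h1]; exact h3⟩
  let W : Set (Vec m) := {x | ∃ v, HasScalarGrad h₂ v x}
  have hW0 : volume Wᶜ = 0 := by
    have h1 := hasScalarGrad_supNorm_ae hm
    rw [← measure_preimage_add_right volume (-c)] at h1
    refine measure_mono_null (fun x hx => ?_) h1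
    simp only [Set.mem_preimage, Set.mem_ofPred_eq]
    rintro ⟨v, b, hb⟩
    refine hx ⟨-(δ' • v), δ' * (r + inner ℝ v c - b), ?_⟩
    have hcc : ContinuousAt (fun y : Vec m => y + -c) x := by fun_prop
    filter_upwards [hcc.eventually hb] with y hy
    simp only [hh₂, sub_eq_add_neg y c, hy]
    rw [inner_neg_left, inner_smul_left, inner_add_right, inner_neg_right]
    simp only [conj_trivial]
    ring
  refine ⟨h, Q ∩ {x | h₁ x < h₂ x} ∩ A₁, Q ∩ {x | h₁ x < h₂ x} ∩ A₂,
    Q ∩ {x | h₂ x < h₁ x} ∩ W, ?_, ?_, ?_, ?_, ?_, ?_, ?_, ?_, ?_, ?_, ?_, ?_, ?_, ?_, ?_, ?_, ?_⟩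
  · have h3 := (LipschitzWith.const (0 : ℝ) : LipschitzWith 0 fun _ : Vec m => (0 : ℝ)).max
      ((planeWave_lipschitz hs hη n).min h₂l)
    refine h3.weaken ?_
    refine max_le zero_le (max_le ?_ ?_)
    · rw [two_mul]; exact le_add_self
    · refine (Real.toNNReal_le_iff_le_coe).2 ?_
      push_cast
      linarith [norm_nonneg n]
  · intro x
    rw [abs_of_nonneg (le_max_left _ _)]
    exact max_le hκ.le ((min_le_left _ _).trans ((h₁le x).trans hηκ))
  · intro x hx
    rw [h₂pos, not_lt] at hx
    exact max_eq_left ((min_le_right _ _).trans hx)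
  · exact (hQ.inter (isOpen_lt h₁c h₂c)).inter hA₁
  · exact (hQ.inter (isOpen_lt h₁c h₂c)).inter hA₂
  · exact (hQ.inter (isOpen_lt h₂c h₁c)).inter (isOpen_hasScalarGrad _)
  · exact fun x hx => hx.1.1
  · exact fun x hx => hx.1.1
  · exact fun x hx => hx.1.1
  · exact Set.disjoint_left.2 fun x hx hx' => lt_asymm hx.2.2 hx'.2.2
  · exact Set.disjoint_left.2 fun x hx hx' => lt_asymm (show h₁ x < h₂ x from hx.1.2) hx'.1.2
  · exact Set.disjoint_left.2 fun x hx hx' => lt_asymm (show h₁ x < h₂ x from hx.1.2) hx'.1.2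
  · rw [Measure.restrict_apply'
      hQ.measurableSet] at hδ'
    refine measure_mono_null (fun x hx => ?_) (measure_union_null hδ' (measure_union_null hW0
      (measure_union_null (volume_fract_inner_eq hη hn 0) (volume_fract_inner_eq hη hn (1 - s)))))
    by_contra hx'
    simp only [Set.mem_union, Set.mem_inter_iff, Set.mem_compl_iff, not_or, not_and, not_not,
      Set.mem_ofPred_eq] at hx'
    obtain ⟨k1, k2, k3, k4⟩ := hx'
    have hxQ : x ∈ Q := hx.1
    have hpos := (h₂pos x).1 hxQ
    have hne : h₁ x ≠ h₂ x := by
      intro heq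
      refine k1 ?_ hxQ
      have : 0 < r - supNorm (x - c) := (mul_pos_iff_of_pos_left hδ0).1 hpos
      rw [heq]
      simp only [hh₂]
      field_simp
    have hf0 : 0 < Int.fract (inner ℝ n x / η) := lt_of_le_of_ne (Int.fract_nonneg _) (Ne.symm k3)
    refine hx.2 ?_
    rcases lt_or_gt_of_ne hne with hlt | hlt
    · left
      rcases lt_or_gt_of_ne k4 with h4 | h4
      · exact Or.inl ⟨⟨hxQ, hlt⟩, hf0, h4⟩
      · exact Or.inr ⟨⟨hxQ, hlt⟩, hf0, h4⟩
    · exact Or.inr ⟨⟨hxQ, hlt⟩, k2⟩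
  · rintro x ⟨⟨hxQ, hlt⟩, h0, h1⟩
    refine (planeWave_left hη h0 h1).congr ?_
    filter_upwards [(isOpen_lt h₁c h₂c).mem_nhds hlt] with y hy
    have hy' : h₁ y < h₂ y := hy
    simp only [h]
    rw [min_eq_left hy'.le, max_eq_right (h₁nn y)]
  · rintro x ⟨⟨hxQ, hlt⟩, h0, h1⟩
    refine (planeWave_right hη h0 h1).congr ?_
    filter_upwards [(isOpen_lt h₁c h₂c).mem_nhds hlt] with y hy
    have hy' : h₁ y < h₂ y := hy
    simp only [h]
    rw [min_eq_left hy'.le, max_eq_right (h₁nn y)]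
  · rintro x ⟨⟨hxQ, hlt⟩, v, hv⟩
    refine ⟨v, (hv.norm_le h₂l).trans ?_, hv.congr ?_⟩
    · rw [Real.coe_toNNReal _ hδ0.le]
      exact hδ2.le
    · filter_upwards [(isOpen_lt h₂c h₁c).mem_nhds hlt, hQ.mem_nhds hxQ] with y hy hyQ
      have hy' : h₂ y < h₁ y := hy
      simp only [h]
      rw [min_eq_right hy'.le, max_eq_right ((h₂pos y).1 hyQ).le]
  · have hrρ : 0 < r - ρ := by linarith
    have hsub : Q ∩ {x | h₂ x < h₁ x} ∩ W ⊆ openCube c r \ openCube c (r - ρ) := by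
      rintro x ⟨⟨hxQ, hlt⟩, -⟩
      refine ⟨hxQ, fun hx => ?_⟩
      rw [mem_openCube_iff] at hx
      have hlt' : h₂ x < h₁ x := hlt
      have h5 : δ' * (r - supNorm (x - c)) < η := hlt'.trans_le (h₁le x)
      have h6 : δ / 2 * ρ ≤ δ' * (r - supNorm (x - c)) :=
        mul_le_mul hδ1.le (by linarith) hρ.le hδ0.le
      linarith
    have hsub2 : openCube c (r - ρ) ⊆ openCube c r :=
      Set.preimage_mono (Metric.ball_subset_ball (by linarith))
    have hv : ∀ r' : ℝ, 0 < r' → volume.real (openCube c r') = (2 * r') ^ m := fun r' hr' => by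
      rw [Measure.real, volume_openCube c hr', ENNReal.toReal_ofReal (by positivity)]
    refine (measureReal_mono hsub ?_).trans ?_
    · refine ne_top_of_le_ne_top ?_ (measure_mono Set.sdiff_subset)
      rw [volume_openCube c hr]; exact ENNReal.ofReal_ne_top
    · rw [measureReal_sdiff hsub2 (isOpen_openCube _ _).measurableSet
        (by rw [volume_openCube c hr]; exact ENNReal.ofReal_ne_top), hv r hr, hv _ hrρ]
      exact hρV

/-- The derivative of `h` along `n` has integral zero. Its integrals over `g₁` and `g₂` are `s ‖n‖²
|g₁|` and `-(1 - s) ‖n‖² |g₂|`, and over `e` it contributes at most `‖n‖² |e|`. Together with the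
total volume this fixes both proportions, without counting periods. -/
theorem block_proportions {n : Vec m} (hn : n ≠ 0) {s : ℝ} (hs : s ∈ Set.Ioo (0 : ℝ) 1)
    {δ : ℝ} (hδn : δ ≤ ‖n‖) {κ : ℝ} {c : Vec m} {r : ℝ} (hr : 0 < r)
    {h : Vec m → ℝ} {g₁ g₂ e : Set (Vec m)} {L : ℝ≥0}
    (hL : LipschitzWith L h) (hz : ∀ x ∉ openCube c r, h x = 0)
    (hg₁ : IsOpen g₁) (hg₂ : IsOpen g₂) (he : IsOpen e) (hg₁Q : g₁ ⊆ openCube c r)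
    (hg₂Q : g₂ ⊆ openCube c r) (heQ : e ⊆ openCube c r) (d12 : Disjoint g₁ g₂)
    (d1 : Disjoint g₁ e) (d2 : Disjoint g₂ e)
    (hcov : volume (openCube c r \ (g₁ ∪ g₂ ∪ e)) = 0)
    (hG₁ : ∀ x ∈ g₁, HasScalarGrad h (s • n) x) (hG₂ : ∀ x ∈ g₂, HasScalarGrad h (-(1 - s) • n) x)
    (hE : ∀ x ∈ e, ∃ v, ‖v‖ ≤ δ ∧ HasScalarGrad h v x)
    (hκ : volume.real e ≤ κ * volume.real (openCube c r)) :
    |volume.real g₁ - (1 - s) * volume.real (openCube c r)| ≤ 2 * κ * volume.real (openCube c r) ∧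
    |volume.real g₂ - s * volume.real (openCube c r)| ≤ 2 * κ * volume.real (openCube c r) := by
  have hQfin : volume (openCube c r) < ∞ := by
    rw [volume_openCube c hr]; exact ENNReal.ofReal_lt_top
  have hfin : ∀ {t : Set (Vec m)}, t ⊆ openCube c r → volume t < ∞ := fun ht =>
    (measure_mono ht).trans_lt hQfin
  have hsubQ : g₁ ∪ g₂ ∪ e ⊆ openCube c r := Set.union_subset (Set.union_subset hg₁Q hg₂Q) heQ
  have hae : (g₁ ∪ g₂ ∪ e : Set (Vec m)) =ᵐ[volume] openCube c r :=
    (hsubQ.eventuallyLE).antisymm (ae_le_set.2 hcov)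
  have hd : Disjoint (g₁ ∪ g₂) e := d1.union_left d2
  have hclosed : IsClosed (cube c r) :=
    Metric.isClosed_closedBall.preimage (PiLp.continuous_ofLp 2 _)
  have hbdd : Bornology.IsBounded (cube c r) :=
    (PiLp.antilipschitzWith_ofLp 2 _).isBounded_preimage Metric.isBounded_closedBall
  have hcs : HasCompactSupport h := by
    refine HasCompactSupport.intro (Metric.isCompact_of_isClosed_isBounded hclosed hbdd)
      fun x hx => hz x fun hx' => hx (openCube_subset_cube c r hx')
  set F : Vec m → ℝ := fun x => lineDeriv ℝ h x n with hF
  have hint : ∀ {t : Set (Vec m)}, t ⊆ openCube c r → IntegrableOn F t := fun {t} ht => by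
    have : IsFiniteMeasure (volume.restrict t) := ⟨by simpa using hfin ht⟩
    exact (hL.memLp_lineDeriv n).integrable le_top
  have h0 : ∫ x in openCube c r, F x = 0 := by
    rw [setIntegral_eq_integral_of_ae_compl_eq_zero, hF, integral_lineDeriv_eq_zero hL hcs n]
    have h1 := measure_eq_zero_iff_ae_notMem.1 (volume_cube_diff_openCube c hr)
    filter_upwards [h1] with x hx hxQ
    have hxc : x ∈ (cube c r)ᶜ := fun hxc => hx ⟨hxc, hxQ⟩
    have h2 : HasScalarGrad h 0 x := by
      refine ⟨0, ?_⟩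
      filter_upwards [hclosed.isOpen_compl.mem_nhds hxc] with y hy
      rw [hz y fun hy' => hy (openCube_subset_cube c r hy')]
      simp
    simp [hF, h2.lineDeriv]
  have h1 : ∫ x in g₁, F x = volume.real g₁ * (s * ‖n‖ ^ 2) := by
    rw [setIntegral_congr_fun hg₁.measurableSet (g := fun _ => s * ‖n‖ ^ 2), setIntegral_const,
      smul_eq_mul]
    intro x hx
    simp only [hF, (hG₁ x hx).lineDeriv, inner_smul_left, real_inner_self_eq_norm_sq, conj_trivial]
  have h2 : ∫ x in g₂, F x = volume.real g₂ * (-(1 - s) * ‖n‖ ^ 2) := by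
    rw [setIntegral_congr_fun hg₂.measurableSet (g := fun _ => -(1 - s) * ‖n‖ ^ 2),
      setIntegral_const, smul_eq_mul]
    intro x hx
    simp only [hF, (hG₂ x hx).lineDeriv, inner_smul_left, real_inner_self_eq_norm_sq, conj_trivial]
  have h3 : |∫ x in e, F x| ≤ ‖n‖ ^ 2 * volume.real e := by
    rw [← Real.norm_eq_abs]
    refine norm_setIntegral_le_of_norm_le_const (hfin heQ) fun x hx => ?_
    obtain ⟨v, hv, hv'⟩ := hE x hx
    simp only [hF, hv'.lineDeriv]
    refine (norm_inner_le_norm v n).trans ?_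
    rw [sq]
    exact mul_le_mul_of_nonneg_right (hv.trans hδn) (norm_nonneg _)
  have hsum : volume.real g₁ * (s * ‖n‖ ^ 2) + volume.real g₂ * (-(1 - s) * ‖n‖ ^ 2) +
      ∫ x in e, F x = 0 := by
    rw [← h1, ← h2, ← setIntegral_union d12 hg₂.measurableSet (hint hg₁Q) (hint hg₂Q),
      ← setIntegral_union hd he.measurableSet (hint (Set.union_subset hg₁Q hg₂Q)) (hint heQ),
      setIntegral_congr_set hae, h0]
  have hvol : volume.real g₁ + volume.real g₂ + volume.real e = volume.real (openCube c r) := by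
    rw [← measureReal_congr hae, measureReal_union hd he.measurableSet
      (hfin (Set.union_subset hg₁Q hg₂Q)).ne (hfin heQ).ne,
      measureReal_union d12 hg₂.measurableSet (hfin hg₁Q).ne (hfin hg₂Q).ne]
  have hnn : 0 < ‖n‖ ^ 2 := by positivity
  have hEpos : 0 ≤ volume.real e := measureReal_nonneg
  have hkey : |s * volume.real g₁ - (1 - s) * volume.real g₂| ≤ volume.real e := by
    have h4 : ∫ x in e, F x = -(‖n‖ ^ 2 * (s * volume.real g₁ - (1 - s) * volume.real g₂)) := by
      linarith
    rw [h4, abs_neg, abs_mul, abs_of_pos hnn] at h3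
    exact le_of_mul_le_mul_left h3 hnn
  obtain ⟨hk1, hk2⟩ := abs_le.1 hkey
  have hs1 := hs.1
  have hs2 := hs.2
  rw [← hvol] at hκ ⊢
  constructor <;> rw [abs_le] <;> constructor <;> nlinarith

theorem grad_congr {w v : Vec m → Vec d} {x : Vec m} (h : ∀ᶠ y in 𝓝 x, w y = v y) :
    grad w x = grad v x := by
  ext ⟨i, j⟩
  rw [grad_apply, grad_apply, Filter.EventuallyEq.fderiv_eq h]

/-! ### Realizing measures by gradients -/

/-- The perturbation `f`, supported in `O`, realizes the measure `ρ` up to the factor `1 ± ε` as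
the distribution of `X + ∇f` on the good set `g`, while `X + ∇f ∈ U` on the rest `e` of `O`. -/
structure Realizes (U : Set (Mat d m)) (X : Mat d m) (ρ : Measure (Mat d m)) (L : ℝ≥0) (ε : ℝ)
    (O : Set (Vec m)) (f : Vec m → Vec d) (g e : Set (Vec m)) : Prop where
  lipschitz : LipschitzWith L f
  small : ∀ x, ‖f x‖ ≤ ε
  zero : ∀ x ∉ O, f x = 0
  isOpen_good : IsOpen g
  isOpen_err : IsOpen e
  good_subset : g ⊆ O
  err_subset : e ⊆ O
  disjoint : Disjoint g e
  cover : volume (O \ (g ∪ e)) = 0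
  grad_good : ∀ x ∈ g, ∃ Y, HasLocGrad f Y x
  grad_err : ∀ x ∈ e, ∃ Y, X + Y ∈ U ∧ HasLocGrad f Y x
  lower : ∀ E, MeasurableSet E →
    ENNReal.ofReal (1 - ε) * volume O * ρ E ≤ volume {x ∈ g | X + grad f x ∈ E}
  upper : ∀ E, MeasurableSet E →
    volume {x ∈ g | X + grad f x ∈ E} ≤ ENNReal.ofReal (1 + ε) * volume O * ρ E

/-- `ρ` can be realized on every bounded open set, with arbitrary precision and with a uniform
Lipschitz constant. -/
def Realizable (U : Set (Mat d m)) (X : Mat d m) (ρ : Measure (Mat d m)) : Prop :=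
  ∃ L : ℝ≥0, ∀ ε > 0, ∀ O : Set (Vec m), IsOpen O → Bornology.IsBounded O →
    ∃ (f : Vec m → Vec d) (g e : Set (Vec m)), Realizes U X ρ L ε O f g e

theorem measurableSet_good {X : Mat d m} {f : Vec m → Vec d} {g : Set (Vec m)} (hg : IsOpen g)
    {E : Set (Mat d m)} (hE : MeasurableSet E) : MeasurableSet {x ∈ g | X + grad f x ∈ E} :=
  hg.measurableSet.inter ((measurable_const.add (measurable_grad f)) hE)

/-! ### Gluing over disjoint open sets -/

open Classical in
/-- The function equal to `f i` on `Q i`, and to zero outside the `Q i`. -/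
def glue {ι : Type*} (Q : ι → Set (Vec m)) (f : ι → Vec m → Vec d) (x : Vec m) : Vec d :=
  if h : ∃ i, x ∈ Q i then f h.choose x else 0

theorem glue_of_mem {ι : Type*} {Q : ι → Set (Vec m)} {f : ι → Vec m → Vec d}
    (hQ : Pairwise (Function.onFun Disjoint Q)) {i : ι} {x : Vec m} (hx : x ∈ Q i) :
    glue Q f x = f i x := by
  have h : ∃ i, x ∈ Q i := ⟨i, hx⟩
  rw [glue, dif_pos h]
  have : h.choose = i := by
    by_contra hne
    exact Set.disjoint_left.1 (hQ hne) h.choose_spec hx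
  rw [this]

theorem glue_of_notMem {ι : Type*} {Q : ι → Set (Vec m)} {f : ι → Vec m → Vec d}
    {x : Vec m} (hx : ∀ i, x ∉ Q i) : glue Q f x = 0 := by
  rw [glue, dif_neg (by simpa using hx)]

/-- For `x ∈ Q i` and `y ∈ Q j` with `i ≠ j`, both `f i y` and `f j x` vanish, so each of `f i x`
and `f j y` is bounded by `L * dist x y`; hence the factor 2, whatever the number of pieces. -/
theorem glue_lipschitz {ι : Type*} {Q : ι → Set (Vec m)} {f : ι → Vec m → Vec d}
    (hQ : Pairwise (Function.onFun Disjoint Q)) {L : ℝ≥0} (hL : ∀ i, LipschitzWith L (f i))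
    (hz : ∀ i, ∀ x ∉ Q i, f i x = 0) : LipschitzWith (2 * L) (glue Q f) := by
  refine LipschitzWith.of_dist_le_mul fun x y => ?_
  push_cast
  have hnn : 0 ≤ L * dist x y := by positivity
  by_cases hx : ∃ i, x ∈ Q i
  · obtain ⟨i, hi⟩ := hx
    rw [glue_of_mem hQ hi]
    by_cases hyi : y ∈ Q i
    · rw [glue_of_mem hQ hyi]
      have := (hL i).dist_le_mul x y
      linarith
    by_cases hy : ∃ j, y ∈ Q j
    · obtain ⟨j, hj⟩ := hy
      have hij : i ≠ j := fun h => hyi (h ▸ hj)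
      have hxj : x ∉ Q j := fun h => Set.disjoint_left.1 (hQ hij) hi h
      rw [glue_of_mem hQ hj]
      have h1 := (hL i).dist_le_mul x y
      have h2 := (hL j).dist_le_mul x y
      rw [hz i y hyi] at h1
      rw [hz j x hxj] at h2
      have h3 := dist_triangle (f i x) 0 (f j y)
      linarith
    · rw [glue_of_notMem (not_exists.1 hy)]
      have h1 := (hL i).dist_le_mul x y
      rw [hz i y hyi] at h1
      linarith
  · rw [glue_of_notMem (not_exists.1 hx)]
    by_cases hy : ∃ j, y ∈ Q j
    · obtain ⟨j, hj⟩ := hy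
      rw [glue_of_mem hQ hj]
      have h2 := (hL j).dist_le_mul x y
      rw [hz j x (not_exists.1 hx j)] at h2
      linarith
    · rw [glue_of_notMem (not_exists.1 hy), dist_self]
      linarith

/-- The volume bounds are relative to the volume of the domain, so they add up over countably many
pieces with the same `ε`. -/
theorem Realizes.glue {ι : Type*} [Countable ι] {U : Set (Mat d m)} {X : Mat d m}
    {ρ : Measure (Mat d m)} {L : ℝ≥0} {ε : ℝ} (hε : 0 < ε) {Q : ι → Set (Vec m)}
    {f : ι → Vec m → Vec d} {g e : ι → Set (Vec m)}
    (hR : ∀ i, Realizes U X ρ L ε (Q i) (f i) (g i) (e i)) (hQo : ∀ i, IsOpen (Q i))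
    (hQ : Pairwise (Function.onFun Disjoint Q)) {O : Set (Vec m)} (hQO : ∀ i, Q i ⊆ O)
    (hcov : volume (O \ ⋃ i, Q i) = 0) :
    Realizes U X ρ (2 * L) ε O (glue Q f) (⋃ i, g i) (⋃ i, e i) := by
  have hev : ∀ i, ∀ x ∈ Q i, ∀ᶠ y in 𝓝 x, ConvexIntegration.glue Q f y = f i y := fun i x hx => by
    filter_upwards [(hQo i).mem_nhds hx] with y hy using glue_of_mem hQ hy
  have hvolO : volume O = ∑' i, volume (Q i) := by
    rw [← measure_iUnion hQ fun i => (hQo i).measurableSet]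
    refine measure_congr (Filter.EventuallyLE.antisymm (ae_le_set.2 hcov) ?_)
    exact (Set.iUnion_subset hQO).eventuallyLE
  have hset : ∀ E, MeasurableSet E → volume {x ∈ ⋃ i, g i | X + grad (ConvexIntegration.glue Q f) x ∈ E} =
      ∑' i, volume {x ∈ g i | X + grad (f i) x ∈ E} := by
    intro E hE
    rw [← measure_iUnion _ fun i => measurableSet_good (hR i).isOpen_good hE]
    · congr 1
      ext x
      simp only [Set.mem_iUnion, Set.mem_ofPred_eq]
      constructor
      · rintro ⟨⟨i, hi⟩, h⟩
        refine ⟨i, hi, ?_⟩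
        rwa [grad_congr (hev i x ((hR i).good_subset hi))] at h
      · rintro ⟨i, hi, h⟩
        refine ⟨⟨i, hi⟩, ?_⟩
        rwa [grad_congr (hev i x ((hR i).good_subset hi))]
    · intro i j hij
      exact (hQ hij).mono (fun x hx => (hR i).good_subset hx.1) fun x hx => (hR j).good_subset hx.1
  refine ⟨glue_lipschitz hQ (fun i => (hR i).lipschitz) fun i => (hR i).zero, ?_, ?_,
    isOpen_iUnion fun i => (hR i).isOpen_good, isOpen_iUnion fun i => (hR i).isOpen_err,
    Set.iUnion_subset fun i => (hR i).good_subset.trans (hQO i),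
    Set.iUnion_subset fun i => (hR i).err_subset.trans (hQO i), ?_, ?_, ?_, ?_, ?_, ?_⟩
  · intro x
    by_cases hx : ∃ i, x ∈ Q i
    · obtain ⟨i, hi⟩ := hx
      rw [glue_of_mem hQ hi]
      exact (hR i).small x
    · rw [glue_of_notMem (not_exists.1 hx), norm_zero]
      exact hε.le
  · intro x hx
    exact glue_of_notMem fun i hi => hx (hQO i hi)
  · rw [Set.disjoint_iUnion_left]
    intro i
    rw [Set.disjoint_iUnion_right]
    intro j
    rcases eq_or_ne i j with rfl | hij
    · exact (hR i).disjoint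
    · exact (hQ hij).mono (hR i).good_subset (hR j).err_subset
  · refine measure_mono_null ?_ (measure_union_null hcov
      (measure_iUnion_null fun i => (hR i).cover))
    intro x hx
    by_cases h : x ∈ ⋃ i, Q i
    · right
      obtain ⟨i, hi⟩ := Set.mem_iUnion.1 h
      refine Set.mem_iUnion.2 ⟨i, hi, fun h' => hx.2 ?_⟩
      exact h'.imp (fun h' => Set.mem_iUnion.2 ⟨i, h'⟩) fun h' => Set.mem_iUnion.2 ⟨i, h'⟩
    · exact Or.inl ⟨hx.1, h⟩
  · intro x hx
    obtain ⟨i, hi⟩ := Set.mem_iUnion.1 hx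
    obtain ⟨Y, hY⟩ := (hR i).grad_good x hi
    exact ⟨Y, hY.congr (hev i x ((hR i).good_subset hi))⟩
  · intro x hx
    obtain ⟨i, hi⟩ := Set.mem_iUnion.1 hx
    obtain ⟨Y, hYU, hY⟩ := (hR i).grad_err x hi
    exact ⟨Y, hYU, hY.congr (hev i x ((hR i).err_subset hi))⟩
  · intro E hE
    rw [hset E hE, hvolO, ← ENNReal.tsum_mul_left, ← ENNReal.tsum_mul_right]
    exact ENNReal.tsum_le_tsum fun i => (hR i).lower E hE
  · intro E hE
    rw [hset E hE, hvolO, ← ENNReal.tsum_mul_left, ← ENNReal.tsum_mul_right]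
    exact ENNReal.tsum_le_tsum fun i => (hR i).upper E hE

theorem realizable_of_cubes {U : Set (Mat d m)} {X : Mat d m} {ρ : Measure (Mat d m)} {L : ℝ≥0}
    (h : ∀ ε > 0, ∀ (c : Vec m) (r : ℝ), 0 < r → ∃ (f : Vec m → Vec d) (g e : Set (Vec m)),
      Realizes U X ρ L ε (openCube c r) f g e) : Realizable U X ρ := by
  refine ⟨2 * L, fun ε hε O hO _ => ?_⟩
  obtain ⟨T, hT, hTO, hdis, hcov⟩ := exists_disjoint_cubes O hO (fun _ _ => True)
    fun x _ => ⟨1, one_pos, fun _ _ _ => trivial⟩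
  have : Countable T := hT.to_subtype
  choose f g e hR using fun p : T => h ε hε p.1.1 p.1.2 (hTO p.1 p.2).1
  refine ⟨_, _, _, Realizes.glue hε hR (fun p => isOpen_openCube _ _) ?_ ?_ ?_⟩
  · intro p q hpq
    exact (hdis p.2 q.2 fun h => hpq (Subtype.ext h)).mono (openCube_subset_cube _ _)
      (openCube_subset_cube _ _)
  · exact fun p => (openCube_subset_cube _ _).trans (hTO p.1 p.2).2.1
  · rwa [← Set.biUnion_eq_iUnion T fun p _ => openCube p.1 p.2]

/-! ### Rank-one splittings -/

/-- The rank-one matrix `a ⊗ n`. -/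
def outer (a : Vec d) (n : Vec m) : Mat d m := WithLp.toLp 2 fun p => a p.1 * n p.2

theorem outer_smul (a : Vec d) (t : ℝ) (n : Vec m) : outer a (t • n) = t • outer a n := by
  ext p
  simp only [outer, PiLp.smul_apply, smul_eq_mul]
  ring

theorem continuous_outer (a : Vec d) : Continuous (outer a : Vec m → Mat d m) := by
  unfold outer
  fun_prop

/-- Every column is a multiple `c j` of a vector `v` spanning the range; these coefficients form the
vector `n`. -/
theorem exists_eq_outer {D : Mat d m} (h : (Mat.toMatrix D).rank = 1) :
    ∃ (a : Vec d) (n : Vec m), n ≠ 0 ∧ D = outer a n := by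
  rw [Matrix.rank, finrank_eq_one_iff'] at h
  obtain ⟨v, hv, hspan⟩ := h
  choose c hc using fun j : Fin m => hspan ⟨(Mat.toMatrix D).mulVecLin (Pi.single j 1), ⟨_, rfl⟩⟩
  have hD : D = outer (WithLp.toLp 2 (v : Fin d → ℝ)) (WithLp.toLp 2 c) := by
    ext ⟨i, j⟩
    have := congrFun (congrArg Subtype.val (hc j)) i
    simp only [Matrix.mulVecLin_apply, Matrix.mulVec_single_one] at this
    simp only [Submodule.coe_smul, Pi.smul_apply, smul_eq_mul] at this
    simp only [outer]
    rw [mul_comm, this]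
    rfl
  refine ⟨_, _, fun h0 => hv ?_, hD⟩
  have hD0 : D = 0 := by
    rw [hD, h0]
    ext p
    simp [outer]
  have : Mat.toMatrix D = 0 := by
    rw [hD0]
    ext
    simp [Mat.toMatrix]
  obtain ⟨y, hy⟩ := v.2
  refine Subtype.ext ?_
  rw [← hy, this]
  simp

theorem HasScalarGrad.hasLocGrad {h : Vec m → ℝ} {v x : Vec m} (H : HasScalarGrad h v x)
    (a : Vec d) : HasLocGrad (fun y => h y • a) (outer a v) x := by
  obtain ⟨c, hc⟩ := H
  refine ⟨c • a, ?_⟩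
  filter_upwards [hc] with y hy
  ext i
  simp only [hy, PiLp.smul_apply, smul_eq_mul, affineMap_apply, outer, PiLp.inner_apply, add_mul,
    Finset.sum_mul, RCLike.inner_apply, conj_trivial]
  congr 1
  exact Finset.sum_congr rfl fun j _ => by ring

/-- The slopes `s` and `-(1 - s)` turn `X` into `B'` and `B`. The wave has slope `s` on the fraction
`1 - s` of its period, which is the weight of `B'`. -/
theorem realizable_splitting {U : Set (Mat d m)} (hU : IsOpen U) {X B B' : Mat d m} (hX : X ∈ U)
    {s : ℝ} (hs : s ∈ Set.Ioo (0 : ℝ) 1) (hXB : X = s • B + (1 - s) • B')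
    (hrank : (Mat.toMatrix (B' - B)).rank = 1) :
    Realizable U X
      (ENNReal.ofReal s • Measure.dirac B + ENNReal.ofReal (1 - s) • Measure.dirac B') := by
  obtain ⟨a, n, hn, hD⟩ := exists_eq_outer hrank
  have hB' : X + outer a (s • n) = B' := by
    rw [outer_smul, ← hD, hXB]
    module
  have hB : X + outer a (-(1 - s) • n) = B := by
    rw [outer_smul, ← hD, hXB]
    module
  have hs0 := hs.1
  have hs1 : 0 < 1 - s := by linarith [hs.2]
  obtain ⟨δ₀, hδ₀, hδU⟩ : ∃ δ > 0, ∀ v : Vec m, ‖v‖ ≤ δ → X + outer a v ∈ U := by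
    have hc : ContinuousAt (fun v : Vec m => X + outer a v) 0 :=
      (continuous_const.add (continuous_outer a)).continuousAt
    have h0 : X + outer a (0 : Vec m) = X := by
      ext p
      simp [outer]
    have := hc.preimage_mem_nhds (hU.mem_nhds (by rw [h0]; exact hX))
    obtain ⟨δ, hδ, hball⟩ := Metric.nhds_basis_closedBall.mem_iff.1 this
    exact ⟨δ, hδ, fun v hv => hball (by simpa using hv)⟩
  have hnpos : 0 < ‖n‖ := norm_pos_iff.2 hn
  refine realizable_of_cubes (L := 2 * ‖n‖₊ * ‖a‖₊) fun ε hε c r hr => ?_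
  set V := volume.real (openCube c r) with hV
  have hVfin : volume (openCube c r) ≠ ∞ := by
    rw [volume_openCube c hr]; exact ENNReal.ofReal_ne_top
  have hV0 : 0 ≤ V := measureReal_nonneg
  have hVeq : volume (openCube c r) = ENNReal.ofReal V := by
    rw [hV, Measure.real, ENNReal.ofReal_toReal hVfin]
  -- `block_proportions` has absolute error `2 κ`; to be a relative error `ε` it must be small
  -- against both weights `s` and `1 - s`. The last condition gives the sup bound for `h • a`.
  obtain ⟨κ, hκ, hκ1, hκ2, hκ3⟩ : ∃ κ > 0, 2 * κ ≤ ε * s ∧ 2 * κ ≤ ε * (1 - s) ∧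
      κ * ‖a‖ ≤ ε := by
    refine ⟨min (min (ε * s / 2) (ε * (1 - s) / 2)) (ε / (‖a‖ + 1)), by positivity, ?_, ?_, ?_⟩
    · have := (min_le_left (min (ε * s / 2) (ε * (1 - s) / 2)) (ε / (‖a‖ + 1))).trans
        (min_le_left _ _)
      linarith
    · have := (min_le_left (min (ε * s / 2) (ε * (1 - s) / 2)) (ε / (‖a‖ + 1))).trans
        (min_le_right _ _)
      linarith
    · have h1 := min_le_right (min (ε * s / 2) (ε * (1 - s) / 2)) (ε / (‖a‖ + 1))
      rw [le_div_iff₀ (by positivity)] at h1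
      refine le_trans ?_ h1
      refine mul_le_mul_of_nonneg_left (by linarith) (by positivity)
  obtain ⟨h, g₁, g₂, e, hL, hsm, hz, hg₁, hg₂, he, hg₁Q, hg₂Q, heQ, d12, d1, d2, hcov, hG₁, hG₂,
    hE, hvol⟩ := exists_scalar_block hn hs (δ := min δ₀ ‖n‖) (by positivity) (min_le_right _ _)
      hκ c hr
  obtain ⟨hp1, hp2⟩ := block_proportions hn hs (min_le_right _ _) hr hL hz hg₁ hg₂ he hg₁Q hg₂Q
    heQ d12 d1 d2 hcov hG₁ hG₂ hE hvol
  rw [← hV] at hp1 hp2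
  have hgr₁ : ∀ x ∈ g₁, X + grad (fun y => h y • a) x = B' := fun x hx => by
    rw [((hG₁ x hx).hasLocGrad a).grad_eq, hB']
  have hgr₂ : ∀ x ∈ g₂, X + grad (fun y => h y • a) x = B := fun x hx => by
    rw [((hG₂ x hx).hasLocGrad a).grad_eq, hB]
  have hsplit : ∀ E, MeasurableSet E →
      volume {x ∈ g₁ ∪ g₂ | X + grad (fun y => h y • a) x ∈ E} =
        ENNReal.ofReal (volume.real g₁) * Measure.dirac B' E +
        ENNReal.ofReal (volume.real g₂) * Measure.dirac B E := by
    intro E hEm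
    have h1 : {x ∈ g₁ ∪ g₂ | X + grad (fun y => h y • a) x ∈ E} =
        {x ∈ g₁ | X + grad (fun y => h y • a) x ∈ E} ∪
        {x ∈ g₂ | X + grad (fun y => h y • a) x ∈ E} := by
      ext x
      simp only [Set.mem_ofPred_eq, Set.mem_union]
      tauto
    rw [h1, measure_union (d12.mono (fun x hx => hx.1) fun x hx => hx.1)
      (measurableSet_good hg₂ hEm)]
    have aux : ∀ (g : Set (Vec m)) (Z : Mat d m), g ⊆ openCube c r →
        (∀ x ∈ g, X + grad (fun y => h y • a) x = Z) →
        volume {x ∈ g | X + grad (fun y => h y • a) x ∈ E} =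
          ENNReal.ofReal (volume.real g) * Measure.dirac Z E := by
      intro g Z hgQ hgZ
      rw [Measure.dirac_apply' _ hEm, Measure.real,
        ENNReal.ofReal_toReal (ne_top_of_le_ne_top hVfin (measure_mono hgQ))]
      by_cases hZ : Z ∈ E
      · rw [Set.indicator_of_mem hZ, Pi.one_apply, mul_one]
        congr 1
        ext x
        exact ⟨fun hx => hx.1, fun hx => ⟨hx, by rw [hgZ x hx]; exact hZ⟩⟩
      · rw [Set.indicator_of_notMem hZ, mul_zero]
        convert measure_empty
        · ext x
          simp only [Set.mem_ofPred_eq, Set.mem_empty_iff_false, iff_false, not_and]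
          intro hx
          rwa [hgZ x hx]
        · infer_instance
    rw [aux g₁ B' hg₁Q hgr₁, aux g₂ B hg₂Q hgr₂]
  obtain ⟨l1, u1⟩ := abs_le.1 hp1
  obtain ⟨l2, u2⟩ := abs_le.1 hp2
  have q1 : 2 * κ * V ≤ ε * s * V := mul_le_mul_of_nonneg_right hκ1 hV0
  have q2 : 2 * κ * V ≤ ε * (1 - s) * V := mul_le_mul_of_nonneg_right hκ2 hV0
  refine ⟨fun y => h y • a, g₁ ∪ g₂, e, ?_, ?_, ?_, hg₁.union hg₂, he,
    Set.union_subset hg₁Q hg₂Q, heQ, d1.union_left d2, hcov, ?_, ?_, ?_, ?_⟩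
  · refine LipschitzWith.of_dist_le_mul fun x y => ?_
    rw [dist_eq_norm, ← sub_smul, norm_smul, ← dist_eq_norm]
    refine (mul_le_mul_of_nonneg_right (hL.dist_le_mul x y) (norm_nonneg a)).trans (le_of_eq ?_)
    push_cast
    ring
  · intro x
    rw [norm_smul, Real.norm_eq_abs]
    exact (mul_le_mul_of_nonneg_right (hsm x) (norm_nonneg a)).trans hκ3
  · intro x hx
    rw [hz x hx, zero_smul]
  · rintro x (hx | hx)
    · exact ⟨_, (hG₁ x hx).hasLocGrad a⟩
    · exact ⟨_, (hG₂ x hx).hasLocGrad a⟩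
  · intro x hx
    obtain ⟨v, hv, hv'⟩ := hE x hx
    exact ⟨_, hδU v (hv.trans (min_le_left _ _)), hv'.hasLocGrad a⟩
  · intro E hEm
    rw [hsplit E hEm, hVeq, Measure.add_apply, Measure.smul_apply, Measure.smul_apply, smul_eq_mul,
      smul_eq_mul, mul_add, add_comm, ← mul_assoc, ← mul_assoc, ← ENNReal.ofReal_mul' hV0,
      ← ENNReal.ofReal_mul' hs0.le, ← ENNReal.ofReal_mul' hs1.le]
    gcongr <;> nlinarith
  · intro E hEm
    rw [hsplit E hEm, hVeq, Measure.add_apply, Measure.smul_apply, Measure.smul_apply, smul_eq_mul,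
      smul_eq_mul, mul_add, add_comm, ← mul_assoc, ← mul_assoc, ← ENNReal.ofReal_mul' hV0,
      ← ENNReal.ofReal_mul' hs0.le, ← ENNReal.ofReal_mul' hs1.le]
    gcongr <;> nlinarith

/-! ### Laminates of finite order are realizable -/

/-- Hyperplanes are null, so the volume below level `t` is continuous in `t` by dominated
convergence, and it takes every intermediate value. -/
theorem exists_slice {O : Set (Vec m)} (hO : IsOpen O) (hb : Bornology.IsBounded O) {n : Vec m}
    (hn : n ≠ 0) {θ : ℝ} (hθ : θ ∈ Set.Icc (0 : ℝ) 1) :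
    ∃ τ : ℝ, volume (O ∩ {x | inner ℝ n x < τ}) = ENNReal.ofReal θ * volume O ∧
      volume (O ∩ {x | τ < inner ℝ n x}) = ENNReal.ofReal (1 - θ) * volume O := by
  have hOfin : volume O ≠ ∞ := hb.measure_lt_top.ne
  have hlt : ∀ t : ℝ, IsOpen {x : Vec m | inner ℝ n x < t} := fun t =>
    isOpen_lt (by fun_prop) continuous_const
  have hgt : ∀ t : ℝ, IsOpen {x : Vec m | t < inner ℝ n x} := fun t =>
    isOpen_lt continuous_const (by fun_prop)
  have : IsFiniteMeasure (volume.restrict O) := ⟨by simpa using hb.measure_lt_top⟩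
  let F : ℝ → ℝ := fun t => volume.real (O ∩ {x : Vec m | inner ℝ n x < t})
  have hF : Continuous F := by
    have hFeq : F = fun t => ∫ x in O, Set.indicator {x : Vec m | inner ℝ n x < t} 1 x := by
      ext t
      rw [integral_indicator_one (hlt t).measurableSet, measureReal_restrict_apply
        (hlt t).measurableSet, Set.inter_comm]
    rw [hFeq, continuous_iff_continuousAt]
    intro t₀
    refine continuousAt_of_dominated (bound := fun _ => 1) (Eventually.of_forall fun t => ?_)
      (Eventually.of_forall fun t => Eventually.of_forall fun x => ?_) (integrable_const _) ?_
    · exact (measurable_one.indicator (hlt t).measurableSet).aestronglyMeasurable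
    · refine (norm_indicator_le_norm_self _ _).trans ?_
      simp
    · have h0 : ∀ᵐ x ∂(volume : Measure (Vec m)), inner ℝ n x ≠ t₀ :=
        measure_eq_zero_iff_ae_notMem.1 (volume_inner_eq n hn t₀)
      filter_upwards [ae_restrict_of_ae h0] with x hx
      rcases lt_or_gt_of_ne hx with h | h
      · refine (continuousAt_const (y := (1 : ℝ))).congr ?_
        filter_upwards [Ioi_mem_nhds h] with t ht
        rw [Set.indicator_of_mem (show x ∈ {x : Vec m | inner ℝ n x < t} from ht), Pi.one_apply]
      · refine (continuousAt_const (y := (0 : ℝ))).congr ?_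
        filter_upwards [Iio_mem_nhds h] with t ht
        rw [Set.indicator_of_notMem]
        exact fun h' : inner ℝ n x < t => lt_asymm h' ht
  obtain ⟨R, hR⟩ := hb.exists_norm_le
  have hin : ∀ x ∈ O, |inner ℝ n x| ≤ ‖n‖ * R := fun x hx =>
    (abs_real_inner_le_norm n x).trans (mul_le_mul_of_nonneg_left (hR x hx) (norm_nonneg _))
  -- The absolute value covers a possibly negative `R`, when `O` is empty.
  set a := -(|‖n‖ * R| + 1) with ha
  set b := |‖n‖ * R| + 1 with hbdef
  have hFa : F a = 0 := by
    have : O ∩ {x : Vec m | inner ℝ n x < a} = ∅ := by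
      ext x
      simp only [Set.mem_inter_iff, Set.mem_ofPred_eq, Set.mem_empty_iff_false, iff_false, not_and,
        not_lt]
      intro hx
      have := (abs_le.1 (hin x hx)).1
      have := le_abs_self (‖n‖ * R)
      linarith
    simp only [F, this, measureReal_empty]
  have hFb : F b = volume.real O := by
    have : O ∩ {x : Vec m | inner ℝ n x < b} = O := by
      refine Set.inter_eq_left.2 fun x hx => ?_
      have := (abs_le.1 (hin x hx)).2
      have := le_abs_self (‖n‖ * R)
      simp only [Set.mem_ofPred_eq]
      linarith
    simp only [F, this]
  have hab : a ≤ b := by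
    have := abs_nonneg (‖n‖ * R)
    linarith
  have hmem : θ * volume.real O ∈ Set.Icc (F a) (F b) := by
    rw [hFa, hFb]
    exact ⟨mul_nonneg hθ.1 measureReal_nonneg,
      mul_le_of_le_one_left measureReal_nonneg hθ.2⟩
  obtain ⟨τ, -, hτ⟩ := intermediate_value_Icc hab hF.continuousOn hmem
  have hfin1 : volume (O ∩ {x : Vec m | inner ℝ n x < τ}) ≠ ∞ :=
    ne_top_of_le_ne_top hOfin (measure_mono Set.inter_subset_left)
  have hfin2 : volume (O ∩ {x : Vec m | τ < inner ℝ n x}) ≠ ∞ :=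
    ne_top_of_le_ne_top hOfin (measure_mono Set.inter_subset_left)
  have hOr : volume O = ENNReal.ofReal (volume.real O) := (ENNReal.ofReal_toReal hOfin).symm
  refine ⟨τ, ?_, ?_⟩
  · rw [hOr, ← ENNReal.ofReal_mul hθ.1, ← hτ]
    exact (ENNReal.ofReal_toReal hfin1).symm
  · have hae : ((O ∩ {x : Vec m | inner ℝ n x < τ}) ∪ (O ∩ {x : Vec m | τ < inner ℝ n x}) :
        Set (Vec m)) =ᵐ[volume] O := by
      refine Filter.EventuallyLE.antisymm (Set.union_subset Set.inter_subset_left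
        Set.inter_subset_left).eventuallyLE (ae_le_set.2 ?_)
      refine measure_mono_null (fun x hx => ?_) (volume_inner_eq n hn τ)
      by_contra hne
      rcases lt_or_gt_of_ne hne with h | h
      · exact hx.2 (Or.inl ⟨hx.1, h⟩)
      · exact hx.2 (Or.inr ⟨hx.1, h⟩)
    have hd : Disjoint (O ∩ {x : Vec m | inner ℝ n x < τ}) (O ∩ {x : Vec m | τ < inner ℝ n x}) :=
      Set.disjoint_left.2 fun x hx hx' =>
        lt_asymm (show inner ℝ n x < τ from hx.2) hx'.2
    have hsum := measureReal_congr hae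
    rw [measureReal_union hd (hO.inter (hgt τ)).measurableSet hfin1 hfin2] at hsum
    have hτ' : volume.real (O ∩ {x : Vec m | inner ℝ n x < τ}) = θ * volume.real O := hτ
    rw [hOr, ← ENNReal.ofReal_mul (by linarith [hθ.2]),
      show (1 - θ) * volume.real O = volume.real (O ∩ {x : Vec m | τ < inner ℝ n x}) by linarith,
      Measure.real, ENNReal.ofReal_toReal hfin2]

theorem Realizable.dirac (U : Set (Mat d m)) (X : Mat d m) : Realizable U X (Measure.dirac X) := by
  refine ⟨0, fun ε hε O hO _ => ⟨fun _ => 0, O, ∅, ?_⟩⟩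
  have h0 : ∀ x : Vec m, X + grad (fun _ => (0 : Vec d)) x = X := fun x => by
    rw [(HasLocGrad.zero x).grad_eq, add_zero]
  have hvol : ∀ E, MeasurableSet E → volume {x ∈ O | X + grad (fun _ => (0 : Vec d)) x ∈ E} =
      volume O * Measure.dirac X E := by
    intro E hE
    simp only [h0]
    rw [Measure.dirac_apply' _ hE]
    by_cases hX : X ∈ E <;> simp [hX]
  refine ⟨LipschitzWith.const _, fun _ => by simpa using hε.le, fun _ _ => rfl, hO, isOpen_empty,
    subset_rfl, Set.empty_subset _, Set.disjoint_empty _, by simp,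
    fun x _ => ⟨0, HasLocGrad.zero x⟩, fun x hx => hx.elim, fun E hE => ?_, fun E hE => ?_⟩
  · rw [hvol E hE]
    gcongr
    refine mul_le_of_le_one_left zero_le (ENNReal.ofReal_le_one.2 (by linarith))
  · rw [hvol E hE]
    gcongr
    refine le_mul_of_one_le_left zero_le (ENNReal.one_le_ofReal.2 (by linarith))

/-- Realize `ν`, then perturb again where the gradient is `X`. As `ν'` may itself charge `X`, only
the fraction `t / ν {X}` of that set is perturbed; the rest keeps the gradient `X`. -/
theorem Realizable.splitting {U : Set (Mat d m)} (hU : IsOpen U) {X₀ : Mat d m}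
    {ν μ : Measure (Mat d m)} (hν : Realizable U X₀ ν) (hs : IsElementarySplitting U ν μ) :
    Realizable U X₀ μ := by
  obtain ⟨t, s, X, B, B', ν', ht, hs, hX, hν'p, hXB, hrank, hνeq, hμeq⟩ := hs
  rcases eq_or_lt_of_le ht.1 with ht0 | ht0
  · have : μ = ν := by rw [hμeq, hνeq, ← ht0]; simp
    rwa [this]
  -- Only some nonzero vector is needed, as the normal of the slicing hyperplane.
  obtain ⟨a, n, hn, -⟩ := exists_eq_outer hrank
  obtain ⟨L₂, hρ⟩ := realizable_splitting hU hX hs hXB hrank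
  set ρ := ENNReal.ofReal s • Measure.dirac B + ENNReal.ofReal (1 - s) • Measure.dirac B' with hρdef
  obtain ⟨L₁, hν⟩ := hν
  set k := ENNReal.ofReal (1 - t) * ν' {X} with hk
  have hkfin : k ≠ ∞ := ENNReal.mul_ne_top ENNReal.ofReal_ne_top (measure_ne_top _ _)
  have hνX : ν {X} = ENNReal.ofReal t + k := by
    rw [hνeq]
    simp [hk]
  have hmass : 0 < t + k.toReal := by positivity
  obtain ⟨θ, hθ, hθt, hθk⟩ : ∃ θ ∈ Set.Icc (0 : ℝ) 1, ENNReal.ofReal θ * ν {X} = ENNReal.ofReal t ∧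
      ENNReal.ofReal (1 - θ) * ν {X} = k := by
    have hkr : k = ENNReal.ofReal k.toReal := (ENNReal.ofReal_toReal hkfin).symm
    have hk0 : 0 ≤ k.toReal := ENNReal.toReal_nonneg
    have hle : t / (t + k.toReal) ≤ 1 := by rw [div_le_one hmass]; linarith
    refine ⟨t / (t + k.toReal), ⟨by positivity, hle⟩, ?_, ?_⟩
    · rw [hνX, hkr, ← ENNReal.ofReal_add ht.1 hk0, ← ENNReal.ofReal_mul (by positivity),
        ENNReal.toReal_ofReal hk0, div_mul_cancel₀ _ hmass.ne']
    · rw [hνX, hkr, ← ENNReal.ofReal_add ht.1 hk0, ENNReal.toReal_ofReal hk0,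
        ← ENNReal.ofReal_mul (sub_nonneg.2 hle)]
      congr 1
      field_simp
      ring
  -- The three terms correspond to the sets `N`, `O''` and `O'` below: gradient other than `X`,
  -- gradient `X` kept, gradient `X` split.
  have hμE : ∀ E, MeasurableSet E → μ E = ν (E \ {X}) +
      ENNReal.ofReal (1 - θ) * ν {X} * Measure.dirac X E + ENNReal.ofReal θ * ν {X} * ρ E := by
    intro E hE
    have h1 : ν (E \ {X}) = ENNReal.ofReal (1 - t) * ν' (E \ {X}) := by
      rw [hνeq, Measure.add_apply, Measure.smul_apply, Measure.smul_apply,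
        Measure.dirac_apply' _ (hE.diff (measurableSet_singleton X))]
      simp
    have h2 : ν' E = ν' (E \ {X}) + ν' {X} * Measure.dirac X E := by
      rw [Measure.dirac_apply' _ hE, ← measure_sdiff_add_inter E (measurableSet_singleton X)]
      congr 1
      by_cases hXE : X ∈ E
      · rw [Set.inter_eq_right.2 (Set.singleton_subset_iff.2 hXE)]
        simp [hXE]
      · have : E ∩ {X} = ∅ := by simpa using hXE
        rw [this]
        simp [hXE]
    rw [hθt, hθk, h1, hμeq, Measure.add_apply, Measure.smul_apply, Measure.smul_apply, smul_eq_mul,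
      smul_eq_mul, h2, hk]
    ring
  refine ⟨L₁ + L₂, fun ε hε O hO hOb => ?_⟩
  -- Two relative errors are multiplied: for `ε' ≤ 1`, `(1 + ε')² ≤ 1 + 3 ε'` and `(1 - ε')² ≥ 1 - 3
  -- ε'`.
  obtain ⟨ε', hε', hε1, hεle⟩ : ∃ ε' > 0, ε' ≤ 1 ∧ 3 * ε' ≤ ε :=
    ⟨min 1 (ε / 3), by positivity, min_le_left _ _, by
      have := min_le_right 1 (ε / 3)
      linarith⟩
  obtain ⟨f₁, g₁, e₁, R₁⟩ := hν ε' hε' O hO hOb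
  let O₁ : Set (Vec m) := g₁ ∩ {x | ∃ Y, Y = X - X₀ ∧ HasLocGrad f₁ Y x}
  have hO₁ : IsOpen O₁ := R₁.isOpen_good.inter (isOpen_hasLocGrad f₁ _)
  have hO₁b : Bornology.IsBounded O₁ := hOb.subset fun x hx => R₁.good_subset hx.1
  have hO₁eq : O₁ = {x ∈ g₁ | X₀ + grad f₁ x ∈ ({X} : Set (Mat d m))} := by
    ext x
    constructor
    · rintro ⟨hx, Y, rfl, hY⟩
      exact ⟨hx, by rw [hY.grad_eq]; simp⟩
    · rintro ⟨hx, h⟩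
      obtain ⟨Y, hY⟩ := R₁.grad_good x hx
      rw [hY.grad_eq, Set.mem_singleton_iff] at h
      exact ⟨hx, Y, by rw [← h]; abel, hY⟩
  have hO₁l := R₁.lower {X} (measurableSet_singleton X)
  have hO₁u := R₁.upper {X} (measurableSet_singleton X)
  rw [← hO₁eq] at hO₁l hO₁u
  obtain ⟨τ, hτ1, hτ2⟩ := exists_slice hO₁ hO₁b hn hθ
  set O' := O₁ ∩ {x : Vec m | inner ℝ n x < τ} with hO'def
  set O'' := O₁ ∩ {x : Vec m | τ < inner ℝ n x} with hO''def
  have hO' : IsOpen O' := hO₁.inter (isOpen_lt (by fun_prop) continuous_const)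
  have hO'' : IsOpen O'' := hO₁.inter (isOpen_lt continuous_const (by fun_prop))
  obtain ⟨f₂, g₂, e₂, R₂⟩ := hρ ε' hε' O' hO' (hO₁b.subset Set.inter_subset_left)
  let N : Set (Vec m) := g₁ ∩ {x | ∃ Y, Y ≠ X - X₀ ∧ HasLocGrad f₁ Y x}
  have hN : IsOpen N := R₁.isOpen_good.inter (isOpen_hasLocGrad f₁ _)
  have hNO : Disjoint N O₁ := by
    refine Set.disjoint_left.2 ?_
    rintro x ⟨-, Y, hne, hY⟩ ⟨-, Z, rfl, hZ⟩
    exact hne (hY.unique hZ)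
  have hOO : Disjoint O'' O' := Set.disjoint_left.2 fun x hx hx' =>
    lt_asymm (show τ < inner ℝ n x from hx.2) hx'.2
  have hO'g : O' ⊆ g₁ := fun x hx => hx.1.1
  have heO : Disjoint e₁ O' := (R₁.disjoint.mono_left hO'g).symm
  have hNO' : Disjoint N O' := hNO.mono_right Set.inter_subset_left
  have hf₂ : ∀ {V : Set (Vec m)}, IsOpen V → Disjoint V O' → ∀ x ∈ V,
      ∀ᶠ y in 𝓝 x, f₁ y + f₂ y = f₁ y := fun {V} hV hd x hx => by
    filter_upwards [hV.mem_nhds hx] with y hy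
    rw [R₂.zero y (Set.disjoint_left.1 hd hy), add_zero]
  have hgr2 : ∀ x ∈ O', ∀ Y, HasLocGrad f₂ Y x →
      HasLocGrad (fun y => f₁ y + f₂ y) (X - X₀ + Y) x := by
    rintro x ⟨⟨-, Z, rfl, hZ⟩, -⟩ Y hY
    exact hZ.add hY
  have hvol : ∀ E, MeasurableSet E →
      volume {x ∈ N ∪ O'' ∪ g₂ | X₀ + grad (fun y => f₁ y + f₂ y) x ∈ E} =
      volume {x ∈ g₁ | X₀ + grad f₁ x ∈ E \ {X}} + volume O'' * Measure.dirac X E +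
        volume {x ∈ g₂ | X + grad f₂ x ∈ E} := by
    intro E hE
    have hsep : {x ∈ N ∪ O'' ∪ g₂ | X₀ + grad (fun y => f₁ y + f₂ y) x ∈ E} =
        {x ∈ g₁ | X₀ + grad f₁ x ∈ E \ {X}} ∪ {x ∈ O'' | X ∈ E} ∪
          {x ∈ g₂ | X + grad f₂ x ∈ E} := by
      ext x
      have h1 : x ∈ N → (X₀ + grad (fun y => f₁ y + f₂ y) x = X₀ + grad f₁ x) := fun hx => by
        rw [grad_congr (hf₂ hN hNO' x hx)]
      have h2 : x ∈ O'' → (X₀ + grad (fun y => f₁ y + f₂ y) x = X) := fun hx => by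
        rw [grad_congr (hf₂ hO'' hOO x hx)]
        obtain ⟨⟨-, Z, rfl, hZ⟩, -⟩ := hx
        rw [hZ.grad_eq]
        abel
      have h3 : x ∈ g₂ → (X₀ + grad (fun y => f₁ y + f₂ y) x = X + grad f₂ x) := fun hx => by
        obtain ⟨Y, hY⟩ := R₂.grad_good x hx
        rw [(hgr2 x (R₂.good_subset hx) Y hY).grad_eq, hY.grad_eq]
        abel
      have h4 : x ∈ N ↔ x ∈ g₁ ∧ X₀ + grad f₁ x ≠ X := by
        constructor
        · rintro ⟨hx, Y, hne, hY⟩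
          refine ⟨hx, fun h => hne ?_⟩
          rw [hY.grad_eq] at h
          rw [← h]; abel
        · rintro ⟨hx, h⟩
          obtain ⟨Y, hY⟩ := R₁.grad_good x hx
          rw [hY.grad_eq] at h
          exact ⟨hx, Y, fun h' => h (by rw [h']; abel), hY⟩
      simp only [Set.mem_union, Set.mem_ofPred_eq, Set.mem_sdiff, Set.mem_singleton_iff]
      constructor
      · rintro ⟨(hx | hx) | hx, h⟩
        · rw [h1 hx] at h
          exact Or.inl (Or.inl ⟨(h4.1 hx).1, h, (h4.1 hx).2⟩)
        · rw [h2 hx] at h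
          exact Or.inl (Or.inr ⟨hx, h⟩)
        · rw [h3 hx] at h
          exact Or.inr ⟨hx, h⟩
      · rintro ((⟨hx, h, h'⟩ | ⟨hx, h⟩) | ⟨hx, h⟩)
        · have hxN := h4.2 ⟨hx, h'⟩
          exact ⟨Or.inl (Or.inl hxN), by rwa [h1 hxN]⟩
        · exact ⟨Or.inl (Or.inr hx), by rwa [h2 hx]⟩
        · exact ⟨Or.inr hx, by rwa [h3 hx]⟩
    have hO''vol : volume {x ∈ O'' | X ∈ E} = volume O'' * Measure.dirac X E := by
      rw [Measure.dirac_apply' _ hE]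
      by_cases hXE : X ∈ E <;> simp [hXE]
    have hO''m : MeasurableSet {x ∈ O'' | X ∈ E} := by
      by_cases hXE : X ∈ E
      · simpa [hXE] using hO''.measurableSet
      · simp [hXE]
    rw [hsep, measure_union _ (measurableSet_good R₂.isOpen_good hE), measure_union _ hO''m, hO''vol]
    · refine Set.disjoint_left.2 ?_
      rintro x ⟨-, h⟩ ⟨hx, -⟩
      have hx1 : x ∈ O₁ := hx.1
      rw [hO₁eq] at hx1
      exact h.2 hx1.2
    · refine Set.disjoint_left.2 ?_
      rintro x (⟨-, h⟩ | ⟨hx, -⟩) ⟨hx', -⟩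
      · have hx1 : x ∈ O₁ := (R₂.good_subset hx').1
        rw [hO₁eq] at hx1
        exact h.2 hx1.2
      · exact Set.disjoint_left.1 hOO hx (R₂.good_subset hx')
  refine ⟨fun y => f₁ y + f₂ y, N ∪ O'' ∪ g₂, e₁ ∪ e₂, R₁.lipschitz.add R₂.lipschitz, ?_, ?_,
    (hN.union hO'').union R₂.isOpen_good, R₁.isOpen_err.union R₂.isOpen_err, ?_, ?_, ?_, ?_, ?_, ?_,
    ?_, ?_⟩
  · intro x
    refine (norm_add_le _ _).trans ?_
    linarith [R₁.small x, R₂.small x]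
  · intro x hx
    rw [R₁.zero x hx, R₂.zero x fun h => hx (R₁.good_subset (hO'g h)), add_zero]
  · exact Set.union_subset (Set.union_subset (fun x hx => R₁.good_subset hx.1)
      fun x hx => R₁.good_subset hx.1.1) fun x hx => R₁.good_subset (hO'g (R₂.good_subset hx))
  · exact Set.union_subset R₁.err_subset fun x hx => R₁.good_subset (hO'g (R₂.err_subset hx))
  · refine Disjoint.union_right ?_ ?_
    · exact R₁.disjoint.mono_left (Set.union_subset (Set.union_subset (fun x hx => hx.1)
        fun x hx => hx.1.1) fun x hx => hO'g (R₂.good_subset hx))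
    · exact Disjoint.union_left ((Disjoint.union_left hNO' hOO).mono_right R₂.err_subset)
        R₂.disjoint
  · refine measure_mono_null ?_ (measure_union_null R₁.cover
      (measure_union_null (volume_inner_eq n hn τ) R₂.cover))
    rintro x ⟨hxO, hx⟩
    by_contra hcon
    simp only [Set.mem_union, not_or, Set.mem_sdiff, not_and, not_not, Set.mem_ofPred_eq] at hcon hx
    obtain ⟨k1, k2, k3⟩ := hcon
    by_cases hg : x ∈ g₁
    · obtain ⟨Y, hY⟩ := R₁.grad_good x hg
      by_cases hYX : Y = X - X₀
      · have hxO₁ : x ∈ O₁ := ⟨hg, Y, hYX, hY⟩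
        rcases lt_or_gt_of_ne k2 with h | h
        · exact hx.2.2 (k3 ⟨hxO₁, h⟩ hx.1.2)
        · exact hx.1.1.2 ⟨hxO₁, h⟩
      · exact hx.1.1.1 ⟨hg, Y, hYX, hY⟩
    · exact hx.2.1 (k1 hxO hg)
  · rintro x ((hx | hx) | hx)
    · obtain ⟨Y, hY⟩ := R₁.grad_good x hx.1
      exact ⟨Y, hY.congr (hf₂ hN hNO' x hx)⟩
    · obtain ⟨Y, hY⟩ := R₁.grad_good x hx.1.1
      exact ⟨Y, hY.congr (hf₂ hO'' hOO x hx)⟩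
    · obtain ⟨Y, hY⟩ := R₂.grad_good x hx
      exact ⟨_, hgr2 x (R₂.good_subset hx) Y hY⟩
  · rintro x (hx | hx)
    · obtain ⟨Y, hYU, hY⟩ := R₁.grad_err x hx
      exact ⟨Y, hYU, hY.congr (hf₂ R₁.isOpen_err heO x hx)⟩
    · obtain ⟨Y, hYU, hY⟩ := R₂.grad_err x hx
      refine ⟨_, ?_, hgr2 x (R₂.err_subset hx) Y hY⟩
      rwa [show X₀ + (X - X₀ + Y) = X + Y by abel]
  · intro E hE
    have hc1 : ENNReal.ofReal (1 - ε) ≤ ENNReal.ofReal (1 - ε') :=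
      ENNReal.ofReal_le_ofReal (by linarith)
    have hc2 : ENNReal.ofReal (1 - ε) ≤ ENNReal.ofReal (1 - ε') * ENNReal.ofReal (1 - ε') := by
      rw [← ENNReal.ofReal_mul (by linarith)]
      exact ENNReal.ofReal_le_ofReal (by nlinarith)
    rw [hvol E hE, hμE E hE, hτ2]
    calc ENNReal.ofReal (1 - ε) * volume O * (ν (E \ {X}) +
          ENNReal.ofReal (1 - θ) * ν {X} * Measure.dirac X E + ENNReal.ofReal θ * ν {X} * ρ E)
        = ENNReal.ofReal (1 - ε) * volume O * ν (E \ {X}) +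
          ENNReal.ofReal (1 - θ) * (ENNReal.ofReal (1 - ε) * volume O * ν {X}) *
            Measure.dirac X E +
          ENNReal.ofReal (1 - ε) * (ENNReal.ofReal θ * (volume O * ν {X})) * ρ E := by ring
      _ ≤ ENNReal.ofReal (1 - ε') * volume O * ν (E \ {X}) +
          ENNReal.ofReal (1 - θ) * (ENNReal.ofReal (1 - ε') * volume O * ν {X}) *
            Measure.dirac X E +
          ENNReal.ofReal (1 - ε') * ENNReal.ofReal (1 - ε') *
            (ENNReal.ofReal θ * (volume O * ν {X})) * ρ E := by gcongr
      _ = ENNReal.ofReal (1 - ε') * volume O * ν (E \ {X}) +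
          ENNReal.ofReal (1 - θ) * (ENNReal.ofReal (1 - ε') * volume O * ν {X}) *
            Measure.dirac X E +
          ENNReal.ofReal (1 - ε') *
            (ENNReal.ofReal θ * (ENNReal.ofReal (1 - ε') * volume O * ν {X})) * ρ E := by ring
      _ ≤ _ := by
        refine add_le_add (add_le_add (R₁.lower _ (hE.diff (measurableSet_singleton X))) ?_)
          (le_trans ?_ (R₂.lower E hE))
        · gcongr
        · rw [hτ1]
          gcongr
  · intro E hE
    have hc1 : ENNReal.ofReal (1 + ε') ≤ ENNReal.ofReal (1 + ε) :=
      ENNReal.ofReal_le_ofReal (by linarith)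
    have hc2 : ENNReal.ofReal (1 + ε') * ENNReal.ofReal (1 + ε') ≤ ENNReal.ofReal (1 + ε) := by
      rw [← ENNReal.ofReal_mul (by linarith)]
      exact ENNReal.ofReal_le_ofReal (by nlinarith)
    rw [hvol E hE, hμE E hE, hτ2]
    refine ge_iff_le.1 ?_
    calc ENNReal.ofReal (1 + ε) * volume O * (ν (E \ {X}) +
          ENNReal.ofReal (1 - θ) * ν {X} * Measure.dirac X E + ENNReal.ofReal θ * ν {X} * ρ E)
        = ENNReal.ofReal (1 + ε) * volume O * ν (E \ {X}) +
          ENNReal.ofReal (1 - θ) * (ENNReal.ofReal (1 + ε) * volume O * ν {X}) *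
            Measure.dirac X E +
          ENNReal.ofReal (1 + ε) * (ENNReal.ofReal θ * (volume O * ν {X})) * ρ E := by ring
      _ ≥ ENNReal.ofReal (1 + ε') * volume O * ν (E \ {X}) +
          ENNReal.ofReal (1 - θ) * (ENNReal.ofReal (1 + ε') * volume O * ν {X}) *
            Measure.dirac X E +
          ENNReal.ofReal (1 + ε') * ENNReal.ofReal (1 + ε') *
            (ENNReal.ofReal θ * (volume O * ν {X})) * ρ E := by gcongr
      _ = ENNReal.ofReal (1 + ε') * volume O * ν (E \ {X}) +
          ENNReal.ofReal (1 - θ) * (ENNReal.ofReal (1 + ε') * volume O * ν {X}) *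
            Measure.dirac X E +
          ENNReal.ofReal (1 + ε') *
            (ENNReal.ofReal θ * (ENNReal.ofReal (1 + ε') * volume O * ν {X})) * ρ E := by ring
      _ ≥ _ := by
        refine add_le_add (add_le_add (R₁.upper _ (hE.diff (measurableSet_singleton X))) ?_)
          (le_trans (R₂.upper E hE) ?_)
        · gcongr
        · rw [hτ1]
          gcongr

theorem IsLaminateOfFiniteOrder.realizable {U : Set (Mat d m)} (hU : IsOpen U) {X : Mat d m}
    {ν : Measure (Mat d m)} (h : IsLaminateOfFiniteOrder U X ν) : Realizable U X ν := by
  induction h with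
  | refl => exact Realizable.dirac U X
  | tail _ hs ih => exact ih.splitting hU hs

theorem IsLaminateOfFiniteOrder.barycenter {U : Set (Mat d m)} {X : Mat d m}
    {ν : Measure (Mat d m)} (h : IsLaminateOfFiniteOrder U X ν) :
    Integrable (fun Y : Mat d m => Y) ν ∧ ∫ Y, Y ∂ν = X := by
  induction h with
  | refl => exact ⟨integrable_dirac (by simp), integral_dirac _ _⟩
  | tail _ hs ih =>
    obtain ⟨t, s, Z, B, B', ν', ht, hs, -, -, hZB, -, rfl, rfl⟩ := hs
    obtain ⟨hi, hb⟩ := ih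
    obtain ⟨hi1, hi2⟩ := integrable_add_measure.1 hi
    have hdir : ∀ A : Mat d m, Integrable (fun Y : Mat d m => Y) (Measure.dirac A) := fun A =>
      integrable_dirac (by simp)
    have hB : Integrable (fun Y : Mat d m => Y) (ENNReal.ofReal s • Measure.dirac B) :=
      (hdir B).smul_measure ENNReal.ofReal_ne_top
    have hB' : Integrable (fun Y : Mat d m => Y) (ENNReal.ofReal (1 - s) • Measure.dirac B') :=
      (hdir B').smul_measure ENNReal.ofReal_ne_top
    have hρ := hB.add_measure hB'
    have hρ' := hρ.smul_measure (c := ENNReal.ofReal t) ENNReal.ofReal_ne_top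
    refine ⟨hρ'.add_measure hi2, ?_⟩
    rw [integral_add_measure hi1 hi2] at hb
    rw [integral_add_measure hρ' hi2, ← hb]
    congr 1
    rw [integral_smul_measure, integral_smul_measure, integral_add_measure hB hB',
      integral_smul_measure, integral_smul_measure, integral_dirac, integral_dirac, integral_dirac,
      hZB, ENNReal.toReal_ofReal hs.1.le,
      ENNReal.toReal_ofReal (by linarith [hs.2] : (0 : ℝ) ≤ 1 - s)]

/-! ### Staircase laminates -/

section Staircase

variable {K U : Set (Mat d m)} {X : ℕ → Mat d m} {μ : ℕ → Measure (Mat d m)} {γ : ℕ → ℝ}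
  {ν : Measure (Mat d m)}

theorem stairBeta_succ (γ : ℕ → ℝ) (n : ℕ) : stairBeta γ (n + 1) = stairBeta γ n * γ (n + 1) :=
  Finset.prod_range_succ _ _

theorem IsStaircaseWith.stairBeta_nonneg (h : IsStaircaseWith K U X μ γ ν) (n : ℕ) :
    0 ≤ stairBeta γ n :=
  Finset.prod_nonneg fun k _ => (h.gamma_mem k).1.le

/-- The last atom of `ν^N` has mass `β_N → 0`, so only the series remains in the limit. -/
theorem IsStaircaseWith.apply_eq_tsum (h : IsStaircaseWith K U X μ γ ν) {E : Set (Mat d m)}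
    (hE : MeasurableSet E) :
    ν E = ∑' n, ENNReal.ofReal (stairBeta γ n * (1 - γ (n + 1))) * μ (n + 1) E := by
  have h1 := h.tendsto E hE
  have h2 := ENNReal.tendsto_nat_tsum
    fun n => ENNReal.ofReal (stairBeta γ n * (1 - γ (n + 1))) * μ (n + 1) E
  have h3 : Tendsto (fun N => ENNReal.ofReal (stairBeta γ N) * Measure.dirac (X N) E) atTop
      (𝓝 0) := by
    have h4 := ENNReal.tendsto_ofReal h.beta_tendsto
    rw [ENNReal.ofReal_zero] at h4
    refine tendsto_of_tendsto_of_tendsto_of_le_of_le tendsto_const_nhds h4 (fun _ => zero_le)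
      fun N => ?_
    exact mul_le_of_le_one_right zero_le prob_le_one
  have h5 := h2.add h3
  rw [add_zero] at h5
  refine tendsto_nhds_unique h1 (h5.congr fun N => ?_)
  simp [stairNu, Measure.add_apply, Measure.finsetSum_apply]

theorem IsStaircaseWith.eq_sum (h : IsStaircaseWith K U X μ γ ν) :
    ν = Measure.sum fun n => ENNReal.ofReal (stairBeta γ n * (1 - γ (n + 1))) • μ (n + 1) := by
  ext E hE
  rw [h.apply_eq_tsum hE, Measure.sum_apply _ hE]
  rfl

/-- `K` need not be measurable. This countable set replaces it in the definition of the error set.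
-/
theorem IsStaircaseWith.exists_atoms (h : IsStaircaseWith K U X μ γ ν) :
    ∃ A : Set (Mat d m), A.Countable ∧ A ⊆ K ∧ ν Aᶜ = 0 := by
  choose _ s θ hsK hμ using h.atomic
  refine ⟨⋃ n, (s n : Set (Mat d m)), Set.countable_iUnion fun n => (s n).countable_toSet,
    Set.iUnion_subset fun n Y hY => hsK n Y hY, ?_⟩
  have hm : MeasurableSet (⋃ n, (s n : Set (Mat d m)))ᶜ :=
    (MeasurableSet.iUnion fun n => (s n).measurableSet).compl
  rw [h.apply_eq_tsum hm, ENNReal.tsum_eq_zero]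
  intro n
  rw [hμ n, Measure.finsetSum_apply, Finset.sum_eq_zero, mul_zero]
  intro Y hY
  rw [Measure.smul_apply, Measure.dirac_apply' _ hm, Set.indicator_of_notMem, smul_zero]
  exact fun h' => h' (Set.mem_iUnion.2 ⟨n, hY⟩)

/-- The `μ` live on `K` and the `X k` do not. Hence `X (n + 1)` has mass exactly `γ (n + 1)` in
`ω_{n+1}`, and the gradient alone tells which points are to be modified next. -/
theorem IsStaircaseWith.atomic_singleton (h : IsStaircaseWith K U X μ γ ν) (n k : ℕ) :
    μ (n + 1) {X k} = 0 := by
  obtain ⟨-, s, θ, hsK, hμ⟩ := h.atomic n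
  rw [hμ, Measure.finsetSum_apply, Finset.sum_eq_zero]
  intro Y hY
  rw [Measure.smul_apply, Measure.dirac_apply' _ (measurableSet_singleton _),
    Set.indicator_of_notMem, smul_zero]
  intro h'
  exact h.notMem k (Set.mem_singleton_iff.1 h' ▸ hsK Y hY)

theorem IsStaircaseWith.step_barycenter (h : IsStaircaseWith K U X μ γ ν) (n : ℕ) :
    X n = (1 - γ (n + 1)) • (∫ Y, Y ∂(μ (n + 1))) + γ (n + 1) • X (n + 1) := by
  obtain ⟨hi, hb⟩ := (h.laminate n).barycenter
  obtain ⟨hi1, hi2⟩ := integrable_add_measure.1 hi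
  have hγ := h.gamma_mem n
  rw [stairOmega, integral_add_measure hi1 hi2, integral_smul_measure, integral_smul_measure,
    integral_dirac, ENNReal.toReal_ofReal hγ.1.le,
    ENNReal.toReal_ofReal (by linarith [hγ.2] : (0 : ℝ) ≤ 1 - γ (n + 1))] at hb
  exact hb.symm

/-- Telescoping the barycenters of the steps, `β_N X_N` is `X 0` minus the `N`-th partial sum of the
series for `∫ Y dν`, whose value is `X 0`. This excludes concentration of the gradient in the limit.
-/
theorem IsStaircaseWith.tendsto_beta_smul (h : IsStaircaseWith K U X μ γ ν) :
    Tendsto (fun n => stairBeta γ n * ‖X n‖) atTop (𝓝 0) := by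
  have hsum : ∀ N, stairBeta γ N • X N = X 0 - ∑ n ∈ Finset.range N,
      (stairBeta γ n * (1 - γ (n + 1))) • ∫ Y, Y ∂(μ (n + 1)) := by
    intro N
    induction N with
    | zero => simp [stairBeta]
    | succ N ih =>
      rw [Finset.sum_range_succ, ← sub_sub, ← ih]
      nth_rewrite 1 [h.step_barycenter N]
      rw [stairBeta_succ]
      module
  have hint := h.integrable_id
  have hb := h.barycenter
  rw [h.eq_sum] at hint hb
  have hhs := hasSum_integral_measure hint
  rw [hb] at hhs
  have ht := hhs.tendsto_sum_nat
  have ht2 : Tendsto (fun N => stairBeta γ N • X N) atTop (𝓝 0) := by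
    have h3 := ht.const_sub (X 0)
    rw [sub_self] at h3
    refine h3.congr fun N => ?_
    rw [hsum N]
    congr 1
    refine Finset.sum_congr rfl fun n _ => ?_
    rw [integral_smul_measure, ENNReal.toReal_ofReal]
    exact mul_nonneg (h.stairBeta_nonneg n) (by linarith [(h.gamma_mem n).2])
  refine ht2.norm.congr' (Eventually.of_forall fun N => ?_) |>.trans (by simp)
  rw [norm_smul, Real.norm_eq_abs, abs_of_nonneg (h.stairBeta_nonneg N)]

theorem IsStaircaseWith.omega_diff (h : IsStaircaseWith K U X μ γ ν) (n : ℕ) {E : Set (Mat d m)}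
    (hE : MeasurableSet E) : stairOmega X μ γ (n + 1) (E \ {X (n + 1)}) =
      ENNReal.ofReal (1 - γ (n + 1)) * μ (n + 1) E := by
  rw [stairOmega, Measure.add_apply, Measure.smul_apply, Measure.smul_apply,
    Measure.dirac_apply' _ (hE.diff (measurableSet_singleton _)),
    measure_sdiff_null (h.atomic_singleton n (n + 1))]
  simp

theorem IsStaircaseWith.omega_singleton (h : IsStaircaseWith K U X μ γ ν) (n : ℕ) :
    stairOmega X μ γ (n + 1) {X (n + 1)} = ENNReal.ofReal (γ (n + 1)) := by
  rw [stairOmega, Measure.add_apply, Measure.smul_apply, Measure.smul_apply,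
    h.atomic_singleton n (n + 1)]
  simp

theorem IsStaircaseWith.omega_univ (h : IsStaircaseWith K U X μ γ ν) (n : ℕ) :
    stairOmega X μ γ (n + 1) Set.univ = 1 := by
  have := (h.atomic n).1
  have hγ := h.gamma_mem n
  rw [stairOmega, Measure.add_apply, Measure.smul_apply, Measure.smul_apply, measure_univ,
    measure_univ, smul_eq_mul, smul_eq_mul, mul_one, mul_one,
    ← ENNReal.ofReal_add (by linarith [hγ.2]) hγ.1.le]
  simp

/-! ### The inductive construction -/

/-- A stage of the construction: the current map `w`, the set `O` where its gradient is still to be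
modified, and the good and bad sets `g`, `e` split off in the last step. -/
structure Stage (d m : ℕ) where
  w : Vec m → Vec d
  O : Set (Vec m)
  g : Set (Vec m)
  e : Set (Vec m)

/-- The properties of the `n`-th stage. -/
structure Stage.IsValid (X : ℕ → Mat d m) (γ : ℕ → ℝ) (b : Vec d) (Ω : Set (Vec m)) (ε : ℝ)
    (n : ℕ) (S : Stage d m) : Prop where
  isOpen : IsOpen S.O
  subset : S.O ⊆ Ω
  lipschitz : ∃ L, LipschitzWith L S.w
  outside : ∀ x ∉ Ω, S.w x = affineMap (X 0) b x
  hasLocGrad : ∀ x ∈ S.O, HasLocGrad S.w (X n) x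
  lower : ENNReal.ofReal (1 - ε * (1 - (1 / 2) ^ n)) * volume Ω * ENNReal.ofReal (stairBeta γ n) ≤
    volume S.O
  upper : volume S.O ≤
    ENNReal.ofReal (1 + ε * (1 - (1 / 2) ^ n)) * volume Ω * ENNReal.ofReal (stairBeta γ n)

/-- The relation between the `n`-th stage and the next one. -/
structure Stage.IsNext (U : Set (Mat d m)) (μ : ℕ → Measure (Mat d m)) (γ : ℕ → ℝ)
    (Ω : Set (Vec m)) (ε α q : ℝ) (n : ℕ) (S T : Stage d m) : Prop where
  subset : T.O ⊆ S.O
  isOpen_good : IsOpen T.g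
  isOpen_err : IsOpen T.e
  good_subset : T.g ⊆ S.O
  err_subset : T.e ⊆ S.O
  disjoint_good : Disjoint T.g T.O
  disjoint_err : Disjoint T.e T.O
  disjoint : Disjoint T.g T.e
  cover : volume (S.O \ (T.O ∪ (T.g ∪ T.e))) = 0
  outside : ∀ x ∉ S.O, T.w x = S.w x
  small : ∀ x, ‖T.w x - S.w x‖ ≤ (1 / 2) ^ n
  holder : ∀ x y, ‖(T.w x - S.w x) - (T.w y - S.w y)‖ ≤ (1 / 2) ^ n * ‖x - y‖ ^ α
  grad_good : ∀ x ∈ T.g, ∃ Y, HasLocGrad T.w Y x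
  grad_err : ∀ x ∈ T.e, ∃ Y, Y ∈ U ∧ HasLocGrad T.w Y x
  lower : ∀ E, MeasurableSet E → ENNReal.ofReal (1 - ε) * volume Ω *
    (ENNReal.ofReal (stairBeta γ n * (1 - γ (n + 1))) * μ (n + 1) E) ≤
      volume {x ∈ T.g | grad T.w x ∈ E}
  upper : ∀ E, MeasurableSet E → volume {x ∈ T.g | grad T.w x ∈ E} ≤
    ENNReal.ofReal (1 + ε) * volume Ω *
      (ENNReal.ofReal (stairBeta γ n * (1 - γ (n + 1))) * μ (n + 1) E)
  integral_err : ∫⁻ x in T.e, ENNReal.ofReal ((1 + ‖grad T.w x‖) ^ q) ≤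
    ENNReal.ofReal (ε * (1 / 2) ^ (n + 1)) * volume Ω

/-- Interpolation: at distances below `ρ` the Lipschitz bound suffices because `L ρ^(1 - α) ≤ η`;
above `ρ` the sup bound `2 δ = η ρ^α` does. -/
theorem exists_holder_scale (L : ℝ≥0) {α : ℝ} (hα : α ∈ Set.Ioo (0 : ℝ) 1) {η : ℝ} (hη : 0 < η) :
    ∃ δ > 0, ∀ f : Vec m → Vec d, LipschitzWith L f → (∀ x, ‖f x‖ ≤ δ) →
      ∀ x y, ‖f x - f y‖ ≤ η * ‖x - y‖ ^ α := by
  have h1α : 0 < 1 - α := by linarith [hα.2]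
  obtain ⟨ρ, hρ, hρL⟩ : ∃ ρ > 0, L * ρ ^ (1 - α) ≤ η := by
    have hc : ContinuousAt (fun ρ : ℝ => (L : ℝ) * ρ ^ (1 - α)) 0 :=
      continuousAt_const.mul (Real.continuousAt_rpow_const _ _ (Or.inr h1α.le))
    have h1 := hc.eventually_lt (continuousAt_const (y := η)) (by
      rw [Real.zero_rpow h1α.ne', mul_zero]; exact hη)
    have h2 : ∀ᶠ ρ in 𝓝[>] (0 : ℝ), 0 < ρ ∧ (L : ℝ) * ρ ^ (1 - α) ≤ η := by
      filter_upwards [self_mem_nhdsWithin, nhdsWithin_le_nhds h1] with ρ h3 h4 using ⟨h3, h4.le⟩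
    exact h2.exists
  refine ⟨η * ρ ^ α / 2, by positivity, fun f hL hf x y => ?_⟩
  rcases le_total ρ ‖x - y‖ with h | h
  · have h3 : ρ ^ α ≤ ‖x - y‖ ^ α := Real.rpow_le_rpow hρ.le h hα.1.le
    have h4 := norm_sub_le (f x) (f y)
    have h5 := mul_le_mul_of_nonneg_left h3 hη.le
    linarith [hf x, hf y]
  · rcases eq_or_lt_of_le (norm_nonneg (x - y)) with h0 | h0
    · have : x = y := sub_eq_zero.1 (norm_eq_zero.1 h0.symm)
      rw [this, sub_self, norm_zero]
      positivity
    · have h3 := hL.dist_le_mul x y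
      rw [dist_eq_norm, dist_eq_norm] at h3
      refine h3.trans ?_
      have h4 : ‖x - y‖ = ‖x - y‖ ^ (1 - α) * ‖x - y‖ ^ α := by
        rw [← Real.rpow_add h0]; simp
      have h5 : ‖x - y‖ ^ (1 - α) ≤ ρ ^ (1 - α) := Real.rpow_le_rpow h0.le h h1α.le
      calc L * ‖x - y‖ = L * ‖x - y‖ ^ (1 - α) * ‖x - y‖ ^ α := by
            conv_lhs => rw [h4]
            ring
        _ ≤ L * ρ ^ (1 - α) * ‖x - y‖ ^ α := by gcongr
        _ ≤ η * ‖x - y‖ ^ α := by gcongr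

/-- With total mass one, the good set already fills the fraction `1 - ε` of `O`. -/
theorem Realizes.volume_err_le {ρ : Measure (Mat d m)} {Z : Mat d m} {L : ℝ≥0} {ε : ℝ}
    {O : Set (Vec m)} {f : Vec m → Vec d} {g e : Set (Vec m)} (R : Realizes U Z ρ L ε O f g e)
    (hε : 0 ≤ ε) (hε1 : ε ≤ 1) (hρ : ρ Set.univ = 1) (hO : volume O ≠ ∞) :
    volume e ≤ ENNReal.ofReal ε * volume O := by
  have h1 := R.lower Set.univ MeasurableSet.univ
  simp only [hρ, mul_one, Set.mem_univ, and_true, Set.ofPred_mem_eq] at h1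
  have h2 : volume g + volume e ≤ volume O := by
    rw [← measure_union R.disjoint R.isOpen_err.measurableSet]
    exact measure_mono (Set.union_subset R.good_subset R.err_subset)
  have hfin : ENNReal.ofReal (1 - ε) * volume O ≠ ∞ := ENNReal.mul_ne_top ENNReal.ofReal_ne_top hO
  refine (ENNReal.add_le_add_iff_left hfin).1 ?_
  calc ENNReal.ofReal (1 - ε) * volume O + volume e ≤ volume g + volume e := by gcongr
    _ ≤ volume O := h2
    _ = _ := by
      rw [← add_mul, ← ENNReal.ofReal_add (by linarith) hε]
      simp

/-- Perturb on `S.O` by a realization of `ω_{n+1}`. Its Lipschitz constant `L` is fixed first, and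
the precision `ε'` is chosen afterwards in terms of `L`. -/
theorem IsStaircaseWith.exists_next (h : IsStaircaseWith K U X μ γ ν) (hU : IsOpen U) {α q : ℝ}
    (hα : α ∈ Set.Ioo (0 : ℝ) 1) (hq : 0 ≤ q) {b : Vec d} {ε : ℝ} (hε : 0 < ε) (hε1 : ε ≤ 1)
    {Ω : Set (Vec m)} (hΩ : Bornology.IsBounded Ω) (n : ℕ) (S : Stage d m)
    (hS : S.IsValid X γ b Ω ε n) :
    ∃ T : Stage d m, T.IsValid X γ b Ω ε (n + 1) ∧ S.IsNext U μ γ Ω ε α q n T := by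
  obtain ⟨L, hL⟩ := (h.laminate n).realizable hU
  have hp : (0 : ℝ) < (1 / 2) ^ n := by positivity
  obtain ⟨δ, hδ, hhol⟩ := exists_holder_scale (d := d) (m := m) L hα hp
  -- A bound for `(1 + |∇w|)^q` on the new error set, independent of `ε'`; the integral there is at
  -- most `C ε' |S.O|`.
  set C : ℝ := (1 + (‖X n‖ + d * m * L)) ^ q with hC
  have hC0 : 0 < C := by positivity
  obtain ⟨ε', hε', h1, h2, h3, h4⟩ : ∃ ε' > 0, ε' ≤ ε * (1 / 2) ^ n / 4 ∧ ε' ≤ (1 / 2) ^ n ∧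
      ε' ≤ δ ∧ C * ε' * 2 ≤ ε * (1 / 2) ^ (n + 1) := by
    refine ⟨min (min (ε * (1 / 2) ^ n / 4) ((1 / 2) ^ n))
      (min δ (ε * (1 / 2) ^ (n + 1) / (C * 2))), by positivity,
      (min_le_left _ _).trans (min_le_left _ _), (min_le_left _ _).trans (min_le_right _ _),
      (min_le_right _ _).trans (min_le_left _ _), ?_⟩
    have h5 := (min_le_right (min (ε * (1 / 2) ^ n / 4) ((1 / 2) ^ n))
      (min δ (ε * (1 / 2) ^ (n + 1) / (C * 2)))).trans (min_le_right _ _)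
    rw [le_div_iff₀ (by positivity)] at h5
    linarith
  have hp1 : ((1 : ℝ) / 2) ^ n ≤ 1 := pow_le_one₀ (by norm_num) (by norm_num)
  have hε'1 : ε' ≤ 1 := h2.trans hp1
  obtain ⟨f, g, e, R⟩ := hL ε' hε' S.O hS.isOpen (hΩ.subset hS.subset)
  have hgr : ∀ x ∈ S.O, ∀ Y, HasLocGrad f Y x → HasLocGrad (fun y => S.w y + f y) (X n + Y) x :=
    fun x hx Y hY => (hS.hasLocGrad x hx).add hY
  have hΩfin : volume Ω ≠ ∞ := hΩ.measure_lt_top.ne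
  have hOfin : volume S.O ≠ ∞ := ne_top_of_le_ne_top hΩfin (measure_mono hS.subset)
  -- The accumulated relative error. As `a ≤ 1`, a step multiplies the bounds by `1 ± ε'` and raises
  -- the error by at most `2 ε' ≤ ε (1/2)^n / 2`, so it always stays below `ε`.
  set a := ε * (1 - (1 / 2) ^ n) with ha
  have ha0 : 0 ≤ a := mul_nonneg hε.le (by linarith)
  have ha1 : a ≤ 1 := by nlinarith
  have hpow : ((1 : ℝ) / 2) ^ (n + 1) = (1 / 2) ^ n / 2 := by ring
  have ha' : ε * (1 - (1 / 2) ^ (n + 1)) = a + ε * (1 / 2) ^ n / 2 := by rw [hpow, ha]; ring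
  have hlowc : ENNReal.ofReal (1 - ε * (1 - (1 / 2) ^ (n + 1))) ≤
      ENNReal.ofReal (1 - ε') * ENNReal.ofReal (1 - a) := by
    rw [← ENNReal.ofReal_mul (by linarith), ha']
    exact ENNReal.ofReal_le_ofReal (by nlinarith)
  have huppc : ENNReal.ofReal (1 + ε') * ENNReal.ofReal (1 + a) ≤
      ENNReal.ofReal (1 + ε * (1 - (1 / 2) ^ (n + 1))) := by
    rw [← ENNReal.ofReal_mul (by linarith), ha']
    exact ENNReal.ofReal_le_ofReal (by nlinarith)
  have hle : ε * (1 - (1 / 2) ^ (n + 1)) ≤ ε := by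
    have : (0 : ℝ) < (1 / 2) ^ (n + 1) := by positivity
    nlinarith
  have hlowc' : ENNReal.ofReal (1 - ε) ≤ ENNReal.ofReal (1 - ε') * ENNReal.ofReal (1 - a) :=
    (ENNReal.ofReal_le_ofReal (by linarith)).trans hlowc
  have huppc' : ENNReal.ofReal (1 + ε') * ENNReal.ofReal (1 + a) ≤ ENNReal.ofReal (1 + ε) :=
    huppc.trans (ENNReal.ofReal_le_ofReal (by linarith))
  have hβ := h.stairBeta_nonneg n
  have hγ := h.gamma_mem n
  let O' : Set (Vec m) := g ∩ {x | ∃ Y, Y = X (n + 1) - X n ∧ HasLocGrad f Y x}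
  let g' : Set (Vec m) := g ∩ {x | ∃ Y, Y ≠ X (n + 1) - X n ∧ HasLocGrad f Y x}
  have hO'eq : O' = {x ∈ g | X n + grad f x ∈ ({X (n + 1)} : Set (Mat d m))} := by
    ext x
    constructor
    · rintro ⟨hx, Y, rfl, hY⟩
      exact ⟨hx, by rw [hY.grad_eq]; simp⟩
    · rintro ⟨hx, h⟩
      obtain ⟨Y, hY⟩ := R.grad_good x hx
      rw [hY.grad_eq, Set.mem_singleton_iff] at h
      exact ⟨hx, Y, by rw [← h]; abel, hY⟩
  have hg'eq : ∀ E : Set (Mat d m), {x ∈ g' | grad (fun y => S.w y + f y) x ∈ E} =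
      {x ∈ g | X n + grad f x ∈ E \ {X (n + 1)}} := by
    intro E
    ext x
    constructor
    · rintro ⟨⟨hx, Y, hne, hY⟩, hE⟩
      rw [(hgr x (R.good_subset hx) Y hY).grad_eq] at hE
      refine ⟨hx, ?_⟩
      rw [hY.grad_eq]
      exact ⟨hE, fun h => hne (by rw [← Set.mem_singleton_iff.1 h]; abel)⟩
    · rintro ⟨hx, hE, hne⟩
      obtain ⟨Y, hY⟩ := R.grad_good x hx
      rw [hY.grad_eq] at hE hne
      refine ⟨⟨hx, Y, fun h => hne (by rw [h]; simp), hY⟩, ?_⟩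
      rw [(hgr x (R.good_subset hx) Y hY).grad_eq]
      exact hE
  have hO'l := R.lower _ (measurableSet_singleton (X (n + 1)))
  have hO'u := R.upper _ (measurableSet_singleton (X (n + 1)))
  rw [← hO'eq, h.omega_singleton] at hO'l hO'u
  have hdis : Disjoint g' O' := by
    refine Set.disjoint_left.2 ?_
    rintro x ⟨-, Y, hne, hY⟩ ⟨-, Z, rfl, hZ⟩
    exact hne (hY.unique hZ)
  have hβs : ENNReal.ofReal (stairBeta γ (n + 1)) =
      ENNReal.ofReal (stairBeta γ n) * ENNReal.ofReal (γ (n + 1)) := by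
    rw [stairBeta_succ, ENNReal.ofReal_mul hβ]
  have hβm : ENNReal.ofReal (stairBeta γ n * (1 - γ (n + 1))) =
      ENNReal.ofReal (stairBeta γ n) * ENNReal.ofReal (1 - γ (n + 1)) := ENNReal.ofReal_mul hβ
  refine ⟨⟨fun y => S.w y + f y, O', g', e⟩, ⟨?_, ?_, ?_, ?_, ?_, ?_, ?_⟩,
    ⟨?_, ?_, R.isOpen_err, ?_, R.err_subset, hdis, ?_, ?_, ?_, ?_, ?_, ?_, ?_, ?_, ?_, ?_, ?_⟩⟩
  · exact R.isOpen_good.inter (isOpen_hasLocGrad f _)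
  · exact fun x hx => hS.subset (R.good_subset hx.1)
  · obtain ⟨L', hL'⟩ := hS.lipschitz
    exact ⟨_, hL'.add R.lipschitz⟩
  · intro x hx
    simp only
    rw [R.zero x fun h => hx (hS.subset h), add_zero, hS.outside x hx]
  · rintro x ⟨hx, Y, rfl, hY⟩
    have := hgr x (R.good_subset hx) _ hY
    rwa [add_sub_cancel] at this
  · rw [hβs]
    calc ENNReal.ofReal (1 - ε * (1 - (1 / 2) ^ (n + 1))) * volume Ω *
          (ENNReal.ofReal (stairBeta γ n) * ENNReal.ofReal (γ (n + 1)))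
        ≤ ENNReal.ofReal (1 - ε') * ENNReal.ofReal (1 - a) * volume Ω *
          (ENNReal.ofReal (stairBeta γ n) * ENNReal.ofReal (γ (n + 1))) := by gcongr
      _ = ENNReal.ofReal (1 - ε') * (ENNReal.ofReal (1 - a) * volume Ω *
          ENNReal.ofReal (stairBeta γ n)) * ENNReal.ofReal (γ (n + 1)) := by ring
      _ ≤ ENNReal.ofReal (1 - ε') * volume S.O * ENNReal.ofReal (γ (n + 1)) := by
        gcongr; exact hS.lower
      _ ≤ _ := hO'l
  · rw [hβs]
    calc volume O' ≤ ENNReal.ofReal (1 + ε') * volume S.O * ENNReal.ofReal (γ (n + 1)) := hO'u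
      _ ≤ ENNReal.ofReal (1 + ε') * (ENNReal.ofReal (1 + a) * volume Ω *
          ENNReal.ofReal (stairBeta γ n)) * ENNReal.ofReal (γ (n + 1)) := by
        gcongr; exact hS.upper
      _ = ENNReal.ofReal (1 + ε') * ENNReal.ofReal (1 + a) * volume Ω *
          (ENNReal.ofReal (stairBeta γ n) * ENNReal.ofReal (γ (n + 1))) := by ring
      _ ≤ _ := by gcongr
  · exact fun x hx => R.good_subset hx.1
  · exact R.isOpen_good.inter (isOpen_hasLocGrad f _)
  · exact fun x hx => R.good_subset hx.1
  · exact R.disjoint.symm.mono_right Set.inter_subset_left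
  · exact R.disjoint.mono_left Set.inter_subset_left
  · refine measure_mono_null ?_ R.cover
    rintro x ⟨hxO, hx⟩
    refine ⟨hxO, ?_⟩
    rintro (hg | he)
    · obtain ⟨Y, hY⟩ := R.grad_good x hg
      by_cases hYX : Y = X (n + 1) - X n
      · exact hx (Or.inl ⟨hg, Y, hYX, hY⟩)
      · exact hx (Or.inr (Or.inl ⟨hg, Y, hYX, hY⟩))
    · exact hx (Or.inr (Or.inr he))
  · intro x hx
    simp only
    rw [R.zero x hx, add_zero]
  · intro x
    simp only [add_sub_cancel_left]
    exact (R.small x).trans h2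
  · intro x y
    simp only [add_sub_cancel_left]
    exact hhol f R.lipschitz (fun z => (R.small z).trans h3) x y
  · rintro x ⟨hx, Y, -, hY⟩
    exact ⟨_, hgr x (R.good_subset hx) Y hY⟩
  · intro x hx
    obtain ⟨Y, hYU, hY⟩ := R.grad_err x hx
    exact ⟨_, hYU, hgr x (R.err_subset hx) Y hY⟩
  · intro E hE
    simp only
    rw [hg'eq E, hβm]
    refine le_trans ?_ (R.lower _ (hE.diff (measurableSet_singleton _)))
    rw [h.omega_diff n hE]
    calc ENNReal.ofReal (1 - ε) * volume Ω * (ENNReal.ofReal (stairBeta γ n) *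
          ENNReal.ofReal (1 - γ (n + 1)) * μ (n + 1) E)
        ≤ ENNReal.ofReal (1 - ε') * ENNReal.ofReal (1 - a) * volume Ω *
            (ENNReal.ofReal (stairBeta γ n) * ENNReal.ofReal (1 - γ (n + 1)) * μ (n + 1) E) := by
          gcongr
      _ = ENNReal.ofReal (1 - ε') * (ENNReal.ofReal (1 - a) * volume Ω *
          ENNReal.ofReal (stairBeta γ n)) * (ENNReal.ofReal (1 - γ (n + 1)) * μ (n + 1) E) := by
        ring
      _ ≤ _ := by gcongr; exact hS.lower
  · intro E hE
    simp only
    rw [hg'eq E, hβm]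
    refine (R.upper _ (hE.diff (measurableSet_singleton _))).trans ?_
    rw [h.omega_diff n hE]
    calc ENNReal.ofReal (1 + ε') * volume S.O * (ENNReal.ofReal (1 - γ (n + 1)) * μ (n + 1) E)
        ≤ ENNReal.ofReal (1 + ε') * (ENNReal.ofReal (1 + a) * volume Ω *
          ENNReal.ofReal (stairBeta γ n)) * (ENNReal.ofReal (1 - γ (n + 1)) * μ (n + 1) E) := by
          gcongr; exact hS.upper
      _ = ENNReal.ofReal (1 + ε') * ENNReal.ofReal (1 + a) * volume Ω *
          (ENNReal.ofReal (stairBeta γ n) * ENNReal.ofReal (1 - γ (n + 1)) * μ (n + 1) E) := by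
        ring
      _ ≤ _ := by gcongr
  · simp only
    calc ∫⁻ x in e, ENNReal.ofReal ((1 + ‖grad (fun y => S.w y + f y) x‖) ^ q)
        ≤ ∫⁻ x in e, ENNReal.ofReal C := by
          refine setLIntegral_mono measurable_const fun x hx => ?_
          obtain ⟨Y, -, hY⟩ := R.grad_err x hx
          rw [(hgr x (R.err_subset hx) Y hY).grad_eq, ← hY.grad_eq]
          refine ENNReal.ofReal_le_ofReal (Real.rpow_le_rpow (by positivity) ?_ hq)
          have := norm_add_le (X n) (grad f x)
          have := norm_grad_le R.lipschitz x
          linarith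
      _ = ENNReal.ofReal C * volume e := setLIntegral_const _ _
      _ ≤ ENNReal.ofReal C * (ENNReal.ofReal ε' * volume S.O) := by
          gcongr
          exact R.volume_err_le hε'.le hε'1 (h.omega_univ n) hOfin
      _ = ENNReal.ofReal (C * ε') * volume S.O := by
          rw [← mul_assoc, ENNReal.ofReal_mul hC0.le]
      _ ≤ ENNReal.ofReal (ε * (1 / 2) ^ (n + 1)) * volume Ω := by
          refine mul_le_mul' (ENNReal.ofReal_le_ofReal ?_) (measure_mono hS.subset)
          linarith [mul_pos hC0 hε']

theorem IsStaircaseWith.exists_stages (h : IsStaircaseWith K U X μ γ ν) (hU : IsOpen U) {α q : ℝ}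
    (hα : α ∈ Set.Ioo (0 : ℝ) 1) (hq : 0 ≤ q) (b : Vec d) {ε : ℝ} (hε : 0 < ε) (hε1 : ε ≤ 1)
    {Ω : Set (Vec m)} (hΩo : IsOpen Ω) (hΩ : Bornology.IsBounded Ω) :
    ∃ S : ℕ → Stage d m, (S 0).O = Ω ∧ (S 0).w = affineMap (X 0) b ∧
      (∀ n, (S n).IsValid X γ b Ω ε n) ∧ ∀ n, (S n).IsNext U μ γ Ω ε α q n (S (n + 1)) := by
  have h0 : (⟨affineMap (X 0) b, Ω, ∅, ∅⟩ : Stage d m).IsValid X γ b Ω ε 0 := by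
    refine ⟨hΩo, subset_rfl, ⟨_, affineMap_lipschitz _ _⟩, fun _ _ => rfl,
      fun x _ => HasLocGrad.affine _ _ _, ?_, ?_⟩ <;> simp [stairBeta]
  choose next hvalid hnext using fun n (S : Stage d m) (hS : S.IsValid X γ b Ω ε n) =>
    h.exists_next hU hα hq hε hε1 hΩ n S hS
  -- The recursion carries the validity proof along, since the choice of the next stage depends on
  -- it.
  let T : (n : ℕ) → {S : Stage d m // S.IsValid X γ b Ω ε n} := fun n =>
    Nat.rec ⟨_, h0⟩ (fun n S => ⟨next n S.1 S.2, hvalid n S.1 S.2⟩) n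
  exact ⟨fun n => (T n).1, rfl, rfl, fun n => (T n).2, fun n => hnext n (T n).1 (T n).2⟩

end Staircase

/-! ### Weak gradients -/

/-- Lipschitz functions are differentiable almost everywhere and can be integrated by parts against
test functions. -/
theorem isWeakGradient_of_lipschitz {w : Vec m → Vec d} {L : ℝ≥0} (hw : LipschitzWith L w)
    (Ω : Set (Vec m)) : IsWeakGradient Ω w (grad w) := by
  intro φ hφ hc hsupp i j
  set v : Vec m := EuclideanSpace.single j 1 with hv
  have hwi : LipschitzWith L fun x => w x i := by
    refine LipschitzWith.of_dist_le_mul fun x y => ?_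
    refine le_trans ?_ (hw.dist_le_mul x y)
    rw [dist_eq_norm, dist_eq_norm, ← PiLp.sub_apply]
    exact PiLp.norm_apply_le _ i
  obtain ⟨D, hD⟩ := ContDiff.lipschitzWith_of_hasCompactSupport hc hφ (by simp)
  have hφd : Differentiable ℝ φ := hφ.differentiable (by simp)
  have key := LipschitzWith.integral_lineDeriv_mul_eq (μ := volume) hwi hD hc v
  have hz : ∀ x ∉ Ω, φ x = 0 := fun x hx => image_eq_zero_of_notMem_tsupport fun h => hx (hsupp h)
  have hz' : ∀ x ∉ Ω, fderiv ℝ φ x = 0 := fun x hx =>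
    fderiv_of_notMem_tsupport ℝ fun h => hx (hsupp h)
  rw [setIntegral_eq_integral_of_forall_compl_eq_zero fun x hx => by simp [hz' x hx],
    setIntegral_eq_integral_of_forall_compl_eq_zero fun x hx => by simp [hz x hx]]
  have h1 : ∫ x, lineDeriv ℝ (fun x => w x i) x v * φ x = ∫ x, grad w x (i, j) * φ x := by
    refine integral_congr_ae ?_
    filter_upwards [hw.ae_differentiableAt] with x hx
    have h2 : HasFDerivAt (fun x => w x i)
        ((EuclideanSpace.proj i : Vec d →L[ℝ] ℝ).comp (fderiv ℝ w x)) x :=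
      (EuclideanSpace.proj i : Vec d →L[ℝ] ℝ).hasFDerivAt.comp x hx.hasFDerivAt
    rw [(h2.hasLineDerivAt v).lineDeriv, grad_apply]
    rfl
  have h2 : ∫ x, lineDeriv ℝ φ x (-v) * w x i = -∫ x, w x i * fderiv ℝ φ x v := by
    rw [← integral_neg]
    congr 1
    ext x
    rw [(hφd x).lineDeriv_eq_fderiv, map_neg]
    ring
  rw [← h1, key, h2, neg_neg]

/-- The gradient of `w n` is `G` off `O n` and the constant `X n` on it. The second part contributes
at most a constant times `‖X n‖ |O n|`, which tends to zero, so the identity for `w n` passes to the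
limit. -/
theorem isWeakGradient_of_tendsto {Ω : Set (Vec m)} (hΩ : Bornology.IsBounded Ω)
    {w : ℕ → Vec m → Vec d} {W : Vec m → Vec d} {G : Vec m → Mat d m}
    (hw : ∀ n, ∃ L, LipschitzWith L (w n)) (hW : Continuous W)
    (hwW : ∀ n x, ‖w n x - W x‖ ≤ 2) (hlim : ∀ x, Tendsto (fun n => w n x) atTop (𝓝 (W x)))
    (hG : IntegrableOn G Ω) {O : ℕ → Set (Vec m)} (hO : ∀ n, MeasurableSet (O n))
    (hOΩ : ∀ n, O n ⊆ Ω) {X : ℕ → Mat d m} (hX : ∀ n, ∀ x ∈ O n, grad (w n) x = X n)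
    (hgrad : ∀ᵐ x ∂(volume.restrict Ω), ∀ n, x ∉ O n → grad (w n) x = G x)
    (hOev : ∀ᵐ x ∂(volume.restrict Ω), ∀ᶠ n in atTop, x ∉ O n)
    (hOX : Tendsto (fun n => ‖X n‖ * volume.real (O n)) atTop (𝓝 0)) :
    IsWeakGradient Ω W G := by
  intro φ hφ hc hsupp i j
  set v : Vec m := EuclideanSpace.single j 1 with hv
  have hfin : IsFiniteMeasure (volume.restrict Ω) := ⟨by simpa using hΩ.measure_lt_top⟩
  have hφ'c : Continuous fun x => fderiv ℝ φ x v :=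
    (hφ.continuous_fderiv (by simp)).clm_apply continuous_const
  have hφ's : HasCompactSupport fun x => fderiv ℝ φ x v := hc.fderiv_apply ℝ v
  obtain ⟨C, hC⟩ := hc.exists_bound_of_continuous hφ.continuous
  have hlhs : Tendsto (fun n => ∫ x in Ω, w n x i * fderiv ℝ φ x v) atTop
      (𝓝 (∫ x in Ω, W x i * fderiv ℝ φ x v)) := by
    refine tendsto_integral_of_dominated_convergence
      (fun x => (‖W x‖ + 2) * ‖fderiv ℝ φ x v‖) (fun n => ?_) ?_ (fun n => ?_) ?_
    · obtain ⟨L, hL⟩ := hw n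
      have hcont : Continuous fun x => w n x i :=
        (EuclideanSpace.proj i : Vec d →L[ℝ] ℝ).continuous.comp hL.continuous
      exact (hcont.mul hφ'c).aestronglyMeasurable
    · refine Integrable.integrableOn ?_
      refine Continuous.integrable_of_hasCompactSupport ((hW.norm.add continuous_const).mul
        hφ'c.norm) ?_
      exact hφ's.norm.mul_left
    · refine Eventually.of_forall fun x => ?_
      rw [norm_mul]
      refine mul_le_mul_of_nonneg_right ?_ (norm_nonneg _)
      refine (PiLp.norm_apply_le (w n x) i).trans ?_
      have := norm_add_le (W x) (w n x - W x)
      rw [add_sub_cancel] at this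
      linarith [hwW n x]
    · refine Eventually.of_forall fun x => ?_
      exact (((EuclideanSpace.proj i : Vec d →L[ℝ] ℝ).continuous.tendsto _).comp
        (hlim x)).mul_const _
  have hGi : IntegrableOn (fun x => G x (i, j)) Ω :=
    (EuclideanSpace.proj (i, j) : Mat d m →L[ℝ] ℝ).integrable_comp hG
  have hGφ : IntegrableOn (fun x => G x (i, j) * φ x) Ω := by
    refine (hGi.norm.mul_const C).mono'
      (hGi.aestronglyMeasurable.mul hφ.continuous.aestronglyMeasurable)
      (Eventually.of_forall fun x => ?_)
    rw [norm_mul]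
    exact mul_le_mul_of_nonneg_left (hC x) (norm_nonneg _)
  have hXint : ∀ n, IntegrableOn ((O n).indicator fun x => X n (i, j) * φ x) Ω := fun n => by
    refine IntegrableOn.indicator ?_ (hO n)
    exact ((hφ.continuous.integrable_of_hasCompactSupport hc).const_mul _).integrableOn
  have hGint : ∀ n, IntegrableOn ((O n)ᶜ.indicator fun x => G x (i, j) * φ x) Ω := fun n =>
    IntegrableOn.indicator hGφ (hO n).compl
  have hsplit : ∀ n, ∫ x in Ω, grad (w n) x (i, j) * φ x =
      (∫ x in Ω, (O n)ᶜ.indicator (fun x => G x (i, j) * φ x) x) +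
      ∫ x in Ω, (O n).indicator (fun x => X n (i, j) * φ x) x := by
    intro n
    rw [← integral_add (hGint n) (hXint n)]
    refine integral_congr_ae ?_
    filter_upwards [hgrad] with x hx
    by_cases h : x ∈ O n
    · simp [h, hX n x h]
    · simp [h, hx n h]
  have hrhs1 : Tendsto (fun n => ∫ x in Ω, (O n)ᶜ.indicator (fun x => G x (i, j) * φ x) x) atTop
      (𝓝 (∫ x in Ω, G x (i, j) * φ x)) := by
    refine tendsto_integral_of_dominated_convergence (fun x => ‖G x (i, j) * φ x‖)
      (fun n => (hGint n).aestronglyMeasurable) hGφ.norm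
      (fun n => Eventually.of_forall fun x => norm_indicator_le_norm_self _ _) ?_
    filter_upwards [hOev] with x hx
    refine tendsto_const_nhds.congr' ?_
    filter_upwards [hx] with n hn
    simp [hn]
  have hrhs2 : Tendsto (fun n => ∫ x in Ω, (O n).indicator (fun x => X n (i, j) * φ x) x) atTop
      (𝓝 0) := by
    have hb := hOX.const_mul C
    rw [mul_zero] at hb
    refine squeeze_zero_norm (fun n => ?_) hb
    rw [setIntegral_indicator (hO n), Set.inter_eq_right.2 (hOΩ n)]
    have hOfin : volume (O n) < ∞ := (hΩ.subset (hOΩ n)).measure_lt_top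
    refine (norm_setIntegral_le_of_norm_le_const (C := ‖X n‖ * C) hOfin fun x _ => ?_).trans
      (le_of_eq (by ring))
    rw [norm_mul]
    exact mul_le_mul (PiLp.norm_apply_le (X n) (i, j)) (hC x) (norm_nonneg _) (norm_nonneg _)
  have hrhs := (hrhs1.add hrhs2).neg
  rw [add_zero] at hrhs
  refine tendsto_nhds_unique hlhs (hrhs.congr fun n => ?_)
  obtain ⟨L, hL⟩ := hw n
  rw [← hsplit n, isWeakGradient_of_lipschitz hL Ω φ hφ hc hsupp i j]

/-- `W` is `w` plus a Hölder function, and a Lipschitz function is Hölder on bounded sets. -/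
theorem holderOnWith_of_norm_le {W w : Vec m → Vec d} {L : ℝ≥0} (hw : LipschitzWith L w) {α c : ℝ}
    (hα : α ∈ Set.Ioo (0 : ℝ) 1) (hc : 0 ≤ c)
    (h : ∀ x y, ‖(W x - w x) - (W y - w y)‖ ≤ c * ‖x - y‖ ^ α) {s : Set (Vec m)}
    (hs : Bornology.IsBounded s) : ∃ C : ℝ≥0, HolderOnWith C α.toNNReal W s := by
  obtain ⟨R, hR⟩ := Metric.isBounded_iff.1 hs
  have h1α : 0 < 1 - α := by linarith [hα.2]
  refine ⟨(c + L * |R| ^ (1 - α)).toNNReal, fun x hx y hy => ?_⟩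
  have hC0 : 0 ≤ c + L * |R| ^ (1 - α) := by positivity
  have hmain : dist (W x) (W y) ≤ (c + L * |R| ^ (1 - α)) * dist x y ^ α := by
    have h1 := h x y
    have h2 := hw.dist_le_mul x y
    have h3 : dist x y ≤ |R| ^ (1 - α) * dist x y ^ α := by
      rcases eq_or_lt_of_le (dist_nonneg (x := x) (y := y)) with h0 | h0
      · rw [← h0, Real.zero_rpow hα.1.ne', mul_zero]
      · calc dist x y = dist x y ^ (1 - α) * dist x y ^ α := by
              rw [← Real.rpow_add h0]; simp
          _ ≤ |R| ^ (1 - α) * dist x y ^ α := by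
              gcongr
              exact (hR hx hy).trans (le_abs_self R)
    have h4 := mul_le_mul_of_nonneg_left h3 L.2
    have h5 := norm_add_le ((W x - w x) - (W y - w y)) (w x - w y)
    rw [show (W x - w x) - (W y - w y) + (w x - w y) = W x - W y by abel,
      ← dist_eq_norm (W x) (W y), ← dist_eq_norm (w x) (w y)] at h5
    rw [← dist_eq_norm x y] at h1
    have h6 : (L : ℝ) * dist x y ≤ L * (|R| ^ (1 - α) * dist x y ^ α) := h4
    linarith
  rw [edist_dist, edist_dist, Real.coe_toNNReal _ hα.1.le,
    ENNReal.ofReal_rpow_of_nonneg dist_nonneg hα.1.le]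
  change _ ≤ ENNReal.ofReal _ * _
  rw [← ENNReal.ofReal_mul hC0]
  exact ENNReal.ofReal_le_ofReal hmain

/-! ### The limit of the construction -/

section Limit

variable {K U : Set (Mat d m)} {X : ℕ → Mat d m} {μ : ℕ → Measure (Mat d m)} {γ : ℕ → ℝ}
  {ν : Measure (Mat d m)} {b : Vec d} {ε α q : ℝ} {Ω : Set (Vec m)} {S : ℕ → Stage d m}

theorem Stage.antitone (hn : ∀ n, (S n).IsNext U μ γ Ω ε α q n (S (n + 1))) :
    Antitone fun n => (S n).O := antitone_nat_of_succ_le fun n => (hn n).subset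

/-- The part of `O_n` on which the map is not changed any more after the next step. -/
def Stage.done (S : ℕ → Stage d m) (n : ℕ) : Set (Vec m) := (S (n + 1)).g ∪ (S (n + 1)).e

theorem Stage.isOpen_done (hn : ∀ n, (S n).IsNext U μ γ Ω ε α q n (S (n + 1))) (n : ℕ) :
    IsOpen (Stage.done S n) := (hn n).isOpen_good.union (hn n).isOpen_err

theorem Stage.done_subset (hn : ∀ n, (S n).IsNext U μ γ Ω ε α q n (S (n + 1))) (n : ℕ) :
    Stage.done S n ⊆ (S n).O := Set.union_subset (hn n).good_subset (hn n).err_subset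

theorem Stage.done_disjoint (hn : ∀ n, (S n).IsNext U μ γ Ω ε α q n (S (n + 1))) {n k : ℕ}
    (h : n < k) : Disjoint (Stage.done S n) (S k).O :=
  (Disjoint.union_left (hn n).disjoint_good (hn n).disjoint_err).mono_right
    (Stage.antitone hn (Nat.succ_le_of_lt h))

theorem Stage.pairwise_done (hn : ∀ n, (S n).IsNext U μ γ Ω ε α q n (S (n + 1))) :
    Pairwise (Function.onFun Disjoint (Stage.done S)) := by
  refine (pairwise_disjoint_on _).2 fun n k h => ?_
  exact (Stage.done_disjoint hn h).mono_right (Stage.done_subset hn k)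

/-- The factor 2 absorbs `1 + ε (1 - (1/2)^n)`. -/
theorem Stage.volume_real_le (h : IsStaircaseWith K U X μ γ ν) (hε1 : ε ≤ 1) (hε : 0 ≤ ε)
    (hΩ : Bornology.IsBounded Ω) (hv : ∀ n, (S n).IsValid X γ b Ω ε n) (n : ℕ) :
    volume.real (S n).O ≤ 2 * volume.real Ω * stairBeta γ n := by
  have hβ := h.stairBeta_nonneg n
  have h1 := (hv n).upper
  have hp : (0 : ℝ) ≤ (1 / 2) ^ n := by positivity
  have hp1 : ((1 : ℝ) / 2) ^ n ≤ 1 := pow_le_one₀ (by norm_num) (by norm_num)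
  have h2 : ε * (1 - (1 / 2) ^ n) ≤ 1 := by nlinarith
  have h0 : 0 ≤ 1 + ε * (1 - (1 / 2) ^ n) := by nlinarith
  have h3 := ENNReal.toReal_mono (ENNReal.mul_ne_top (ENNReal.mul_ne_top ENNReal.ofReal_ne_top
    hΩ.measure_lt_top.ne) ENNReal.ofReal_ne_top) h1
  rw [ENNReal.toReal_mul, ENNReal.toReal_mul, ENNReal.toReal_ofReal h0,
    ENNReal.toReal_ofReal hβ] at h3
  refine h3.trans ?_
  have h4 : (0 : ℝ) ≤ (volume Ω).toReal := ENNReal.toReal_nonneg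
  rw [Measure.real]
  gcongr
  linarith

theorem Stage.volume_iInter (h : IsStaircaseWith K U X μ γ ν) (hε1 : ε ≤ 1) (hε : 0 ≤ ε)
    (hΩ : Bornology.IsBounded Ω) (hv : ∀ n, (S n).IsValid X γ b Ω ε n) :
    volume (⋂ n, (S n).O) = 0 := by
  have hfin : volume (⋂ n, (S n).O) ≠ ∞ :=
    (hΩ.subset ((Set.iInter_subset _ 0).trans (hv 0).subset)).measure_lt_top.ne
  have h1 : Tendsto (fun n => 2 * volume.real Ω * stairBeta γ n) atTop (𝓝 0) := by
    simpa using h.beta_tendsto.const_mul (2 * volume.real Ω)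
  have h2 : volume.real (⋂ n, (S n).O) ≤ 0 := by
    refine ge_of_tendsto' h1 fun n => le_trans ?_ (Stage.volume_real_le h hε1 hε hΩ hv n)
    exact measureReal_mono (Set.iInter_subset _ n)
      (hΩ.subset (hv n).subset).measure_lt_top.ne
  have h3 : volume.real (⋂ n, (S n).O) = 0 := le_antisymm h2 measureReal_nonneg
  exact (measureReal_eq_zero_iff hfin).1 h3

/-- Apart from the null sets missed by the steps, a point that is never done stays in every `O_n`,
and the intersection of these is null. -/
theorem Stage.volume_diff_done (h : IsStaircaseWith K U X μ γ ν) (hε1 : ε ≤ 1) (hε : 0 ≤ ε)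
    (hΩ : Bornology.IsBounded Ω) (h0 : (S 0).O = Ω) (hv : ∀ n, (S n).IsValid X γ b Ω ε n)
    (hn : ∀ n, (S n).IsNext U μ γ Ω ε α q n (S (n + 1))) :
    volume (Ω \ ⋃ n, Stage.done S n) = 0 := by
  refine measure_mono_null (fun x hx => ?_) (measure_union_null
    (Stage.volume_iInter h hε1 hε hΩ hv) (measure_iUnion_null fun n => (hn n).cover))
  by_contra hcon
  rw [Set.mem_union, not_or] at hcon
  refine hcon.1 (Set.mem_iInter.2 fun n => ?_)
  induction n with
  | zero => rw [h0]; exact hx.1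
  | succ n ih =>
    by_contra hO
    refine hcon.2 (Set.mem_iUnion.2 ⟨n, ih, ?_⟩)
    rintro (h' | h')
    · exact hO h'
    · exact hx.2 (Set.mem_iUnion.2 ⟨n, h'⟩)

theorem Stage.exists_limit (hn : ∀ n, (S n).IsNext U μ γ Ω ε α q n (S (n + 1))) :
    ∃ W : Vec m → Vec d, (∀ x, Tendsto (fun n => (S n).w x) atTop (𝓝 (W x))) ∧
      (∀ n x, ‖(S n).w x - W x‖ ≤ 2 / 2 ^ n) ∧
      (∀ n, ∀ x ∉ (S n).O, W x = (S n).w x) ∧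
      ∀ x y, ‖(W x - (S 0).w x) - (W y - (S 0).w y)‖ ≤ 2 * ‖x - y‖ ^ α := by
  -- The shape `2 / 2 / 2 ^ n` of the bound `(1/2)^n` is the one used by
  -- `cauchySeq_of_le_geometric_two`.
  have hstep : ∀ x n, dist ((S n).w x) ((S (n + 1)).w x) ≤ 2 / 2 / 2 ^ n := fun x n => by
    rw [dist_comm, dist_eq_norm]
    refine ((hn n).small x).trans (le_of_eq ?_)
    rw [div_self two_ne_zero, one_div, inv_pow, one_div]
  choose W hW using fun x => cauchySeq_tendsto_of_complete (cauchySeq_of_le_geometric_two (hstep x))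
  refine ⟨W, hW, fun n x => ?_, fun n x hx => ?_, fun x y => ?_⟩
  · rw [← dist_eq_norm]
    exact dist_le_of_le_geometric_two_of_tendsto (hstep x) (hW x) n
  · refine tendsto_nhds_unique (hW x) (tendsto_const_nhds.congr' ?_)
    filter_upwards [eventually_ge_atTop n] with k hk
    induction k, hk using Nat.le_induction with
    | base => rfl
    | succ k hk ih =>
      rw [(hn k).outside x fun h => hx (Stage.antitone hn hk h)]
      exact ih
  · have hind : ∀ n, ‖((S n).w x - (S 0).w x) - ((S n).w y - (S 0).w y)‖ ≤
        (2 - 2 * (1 / 2) ^ n) * ‖x - y‖ ^ α := by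
      intro n
      induction n with
      | zero => simp
      | succ n ih =>
        have h1 := (hn n).holder x y
        have h2 := norm_add_le (((S n).w x - (S 0).w x) - ((S n).w y - (S 0).w y))
          (((S (n + 1)).w x - (S n).w x) - ((S (n + 1)).w y - (S n).w y))
        rw [show ((S n).w x - (S 0).w x) - ((S n).w y - (S 0).w y) +
          (((S (n + 1)).w x - (S n).w x) - ((S (n + 1)).w y - (S n).w y)) =
          ((S (n + 1)).w x - (S 0).w x) - ((S (n + 1)).w y - (S 0).w y) by abel] at h2
        refine h2.trans ((add_le_add ih h1).trans (le_of_eq ?_))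
        rw [pow_succ]
        ring
    have hr : 0 ≤ ‖x - y‖ ^ α := Real.rpow_nonneg (norm_nonneg _) _
    refine le_of_tendsto' (((hW x).sub_const _).sub ((hW y).sub_const _)).norm fun n => ?_
    refine (hind n).trans (mul_le_mul_of_nonneg_right ?_ hr)
    have : (0 : ℝ) ≤ (1 / 2) ^ n := by positivity
    linarith

theorem Stage.eventuallyEq_of_mem_done (hn : ∀ n, (S n).IsNext U μ γ Ω ε α q n (S (n + 1)))
    {W : Vec m → Vec d} (hW : ∀ n, ∀ x ∉ (S n).O, W x = (S n).w x) {n k : ℕ} (hk : n < k)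
    {x : Vec m} (hx : x ∈ Stage.done S n) : ∀ᶠ y in 𝓝 x, W y = (S k).w y := by
  filter_upwards [(Stage.isOpen_done hn n).mem_nhds hx] with y hy
  exact hW k y (Set.disjoint_left.1 (Stage.done_disjoint hn hk) hy)

/-- The union of the good sets. -/
def Stage.good (S : ℕ → Stage d m) : Set (Vec m) := ⋃ n, (S (n + 1)).g

/-- The union of the bad sets. -/
def Stage.err (S : ℕ → Stage d m) : Set (Vec m) := ⋃ n, (S (n + 1)).e

theorem Stage.iUnion_done : ⋃ n, Stage.done S n = Stage.good S ∪ Stage.err S :=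
  Set.iUnion_union_distrib _ _

theorem Stage.volume_good (hn : ∀ n, (S n).IsNext U μ γ Ω ε α q n (S (n + 1)))
    {W : Vec m → Vec d} (hW : ∀ n, ∀ x ∉ (S n).O, W x = (S n).w x) {E : Set (Mat d m)}
    (hE : MeasurableSet E) : volume {x ∈ Stage.good S | grad W x ∈ E} =
      ∑' n, volume {x ∈ (S (n + 1)).g | grad (S (n + 1)).w x ∈ E} := by
  have hgr : ∀ n, ∀ x ∈ (S (n + 1)).g, grad W x = grad (S (n + 1)).w x := fun n x hx =>
    grad_congr (Stage.eventuallyEq_of_mem_done hn hW (Nat.lt_succ_self n) (Or.inl hx))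
  rw [← measure_iUnion]
  · congr 1
    ext x
    simp only [Stage.good, Set.mem_ofPred_eq, Set.mem_iUnion]
    constructor
    · rintro ⟨⟨n, hx⟩, h⟩
      exact ⟨n, hx, by rwa [← hgr n x hx]⟩
    · rintro ⟨n, hx, h⟩
      exact ⟨⟨n, hx⟩, by rwa [hgr n x hx]⟩
  · intro n k hnk
    exact (Stage.pairwise_done hn hnk).mono (fun x hx => Or.inl hx.1) fun x hx => Or.inl hx.1
  · exact fun n => (hn n).isOpen_good.measurableSet.inter (measurable_grad _ hE)

theorem Stage.le_volume_good (h : IsStaircaseWith K U X μ γ ν)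
    (hn : ∀ n, (S n).IsNext U μ γ Ω ε α q n (S (n + 1)))
    {W : Vec m → Vec d} (hW : ∀ n, ∀ x ∉ (S n).O, W x = (S n).w x) {E : Set (Mat d m)}
    (hE : MeasurableSet E) : ENNReal.ofReal (1 - ε) * volume Ω * ν E ≤
      volume {x ∈ Stage.good S | grad W x ∈ E} := by
  rw [Stage.volume_good hn hW hE, h.apply_eq_tsum hE, ← ENNReal.tsum_mul_left]
  exact ENNReal.tsum_le_tsum fun n => (hn n).lower E hE

theorem Stage.volume_good_le (h : IsStaircaseWith K U X μ γ ν)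
    (hn : ∀ n, (S n).IsNext U μ γ Ω ε α q n (S (n + 1)))
    {W : Vec m → Vec d} (hW : ∀ n, ∀ x ∉ (S n).O, W x = (S n).w x) {E : Set (Mat d m)}
    (hE : MeasurableSet E) : volume {x ∈ Stage.good S | grad W x ∈ E} ≤
      ENNReal.ofReal (1 + ε) * volume Ω * ν E := by
  rw [Stage.volume_good hn hW hE, h.apply_eq_tsum hE, ← ENNReal.tsum_mul_left]
  exact ENNReal.tsum_le_tsum fun n => (hn n).upper E hE

theorem Stage.lintegral_err (hε : 0 ≤ ε) (hn : ∀ n, (S n).IsNext U μ γ Ω ε α q n (S (n + 1)))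
    {W : Vec m → Vec d} (hW : ∀ n, ∀ x ∉ (S n).O, W x = (S n).w x) :
    ∫⁻ x in Stage.err S, ENNReal.ofReal ((1 + ‖grad W x‖) ^ q) ≤
      ENNReal.ofReal ε * volume Ω := by
  have hgr : ∀ n, ∀ x ∈ (S (n + 1)).e, grad W x = grad (S (n + 1)).w x := fun n x hx =>
    grad_congr (Stage.eventuallyEq_of_mem_done hn hW (Nat.lt_succ_self n) (Or.inr hx))
  rw [Stage.err, lintegral_iUnion (fun n => (hn n).isOpen_err.measurableSet)]
  · have hsum : ∑' n : ℕ, ENNReal.ofReal (ε * (1 / 2) ^ (n + 1)) = ENNReal.ofReal ε := by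
      have hs : HasSum (fun n : ℕ => ε * (1 / 2 : ℝ) ^ (n + 1)) ε := by
        have := (hasSum_geometric_two).mul_left (ε / 2)
        rw [div_mul_cancel₀ _ two_ne_zero] at this
        refine this.congr_fun ?_
        intro n
        rw [pow_succ]
        ring
      rw [← ENNReal.ofReal_tsum_of_nonneg (fun n => by positivity) hs.summable, hs.tsum_eq]
    rw [← hsum, ← ENNReal.tsum_mul_right]
    refine ENNReal.tsum_le_tsum fun n => ?_
    rw [setLIntegral_congr_fun (hn n).isOpen_err.measurableSet
      (g := fun x => ENNReal.ofReal ((1 + ‖grad (S (n + 1)).w x‖) ^ q))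
      (fun x hx => by simp only [hgr n x hx])]
    exact (hn n).integral_err
  · intro n k hnk
    exact (Stage.pairwise_done hn hnk).mono Set.subset_union_right Set.subset_union_right

/-- On the good set the distribution of the gradient is at most a multiple of `ν`, which has a
finite first moment. On the error set the bound with exponent `q ≥ 1` suffices. -/
theorem Stage.integrableOn_grad (h : IsStaircaseWith K U X μ γ ν) (hq : 1 ≤ q) (hε1 : ε ≤ 1)
    (hε : 0 ≤ ε) (hΩ : Bornology.IsBounded Ω) (h0 : (S 0).O = Ω)
    (hv : ∀ n, (S n).IsValid X γ b Ω ε n)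
    (hn : ∀ n, (S n).IsNext U μ γ Ω ε α q n (S (n + 1)))
    {W : Vec m → Vec d} (hW : ∀ n, ∀ x ∉ (S n).O, W x = (S n).w x) :
    IntegrableOn (grad W) Ω := by
  have hΩfin : volume Ω ≠ ∞ := hΩ.measure_lt_top.ne
  have hgood : IntegrableOn (grad W) (Stage.good S) := by
    have hle : Measure.map (grad W) (volume.restrict (Stage.good S)) ≤
        (ENNReal.ofReal (1 + ε) * volume Ω) • ν := by
      refine Measure.le_iff.2 fun E hE => ?_
      rw [Measure.map_apply (measurable_grad W) hE,
        Measure.restrict_apply (measurable_grad W hE), Set.inter_comm]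
      exact Stage.volume_good_le h hn hW hE
    have hint : Integrable (fun Y : Mat d m => Y)
        (Measure.map (grad W) (volume.restrict (Stage.good S))) :=
      (h.integrable_id.smul_measure (ENNReal.mul_ne_top ENNReal.ofReal_ne_top hΩfin)).mono_measure
        hle
    exact (integrable_map_measure aestronglyMeasurable_id (measurable_grad W).aemeasurable).1 hint
  have herr : IntegrableOn (grad W) (Stage.err S) := by
    refine ⟨(measurable_grad W).aestronglyMeasurable, ?_⟩
    refine lt_of_le_of_lt ?_ ((Stage.lintegral_err hε hn hW).trans_lt
      (ENNReal.mul_lt_top ENNReal.ofReal_lt_top hΩfin.lt_top))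
    refine lintegral_mono fun x => ?_
    rw [← ofReal_norm]
    refine ENNReal.ofReal_le_ofReal ?_
    have h1 : (1 : ℝ) ≤ 1 + ‖grad W x‖ := by linarith [norm_nonneg (grad W x)]
    have h2 := Real.self_le_rpow_of_one_le h1 hq
    linarith
  refine (hgood.union herr).mono_set_ae ?_
  rw [← Stage.iUnion_done]
  exact ae_le_set.2 (Stage.volume_diff_done h hε1 hε hΩ h0 hv hn)

/-- Almost every point is done at some stage, after which the gradient of the stages there is
already that of `W`. On `O_n` concentration is excluded by `β_n ‖X n‖ → 0`. -/
theorem Stage.isWeakGradient (h : IsStaircaseWith K U X μ γ ν) (hq : 1 ≤ q) (hε1 : ε ≤ 1)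
    (hε : 0 ≤ ε) (hΩo : IsOpen Ω) (hΩ : Bornology.IsBounded Ω) (h0 : (S 0).O = Ω)
    (hv : ∀ n, (S n).IsValid X γ b Ω ε n)
    (hn : ∀ n, (S n).IsNext U μ γ Ω ε α q n (S (n + 1)))
    {W : Vec m → Vec d} (hlim : ∀ x, Tendsto (fun n => (S n).w x) atTop (𝓝 (W x)))
    (hd : ∀ n x, ‖(S n).w x - W x‖ ≤ 2 / 2 ^ n)
    (hW : ∀ n, ∀ x ∉ (S n).O, W x = (S n).w x) (hWc : Continuous W) :
    IsWeakGradient Ω W (grad W) := by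
  have hae : ∀ᵐ x ∂(volume.restrict Ω), x ∈ ⋃ n, Stage.done S n := by
    rw [ae_restrict_iff' hΩo.measurableSet]
    filter_upwards [measure_eq_zero_iff_ae_notMem.1
      (Stage.volume_diff_done h hε1 hε hΩ h0 hv hn)] with x hx hxΩ
    by_contra hcon
    exact hx ⟨hxΩ, hcon⟩
  refine isWeakGradient_of_tendsto hΩ (w := fun n => (S n).w) (O := fun n => (S n).O) (X := X)
    (fun n => (hv n).lipschitz) hWc ?_ hlim (Stage.integrableOn_grad h hq hε1 hε hΩ h0 hv hn hW)
    (fun n => (hv n).isOpen.measurableSet) (fun n => (hv n).subset)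
    (fun n x hx => ((hv n).hasLocGrad x hx).grad_eq) ?_ ?_ ?_
  · intro n x
    refine (hd n x).trans ?_
    exact div_le_self zero_le_two (one_le_pow₀ one_le_two)
  · filter_upwards [hae] with x hx n hxn
    obtain ⟨k, hk⟩ := Set.mem_iUnion.1 hx
    have hkn : k < n := by
      by_contra hcon
      exact hxn (Stage.antitone hn (not_lt.1 hcon) (Stage.done_subset hn k hk))
    exact (grad_congr (Stage.eventuallyEq_of_mem_done hn hW hkn hk)).symm
  · filter_upwards [hae] with x hx
    obtain ⟨k, hk⟩ := Set.mem_iUnion.1 hx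
    filter_upwards [eventually_gt_atTop k] with n hkn
    exact Set.disjoint_left.1 (Stage.done_disjoint hn hkn) hk
  · have h1 := h.tendsto_beta_smul.const_mul (2 * volume.real Ω)
    rw [mul_zero] at h1
    refine squeeze_zero (fun n => mul_nonneg (norm_nonneg _) measureReal_nonneg) (fun n => ?_) h1
    have h2 := mul_le_mul_of_nonneg_left (Stage.volume_real_le h hε1 hε hΩ hv n)
      (norm_nonneg (X n))
    linarith

end Limit

end ConvexIntegration

end

/-! ### Conclusion: the limit map and its error set -/

theorem proposition3p9 {d m : ℕ}
    (K U : Set (ConvexIntegration.Mat d m)) (hU : IsOpen U)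
    (α : ℝ) (hα : α ∈ Set.Ioo (0 : ℝ) 1) (q : ℝ) (hq : 1 < q)
    (X₀ : ConvexIntegration.Mat d m) (ν : Measure (ConvexIntegration.Mat d m))
    (hν : ConvexIntegration.IsStaircaseLaminate K U X₀ ν)
    (p : ℝ) (hp : 1 < p) (M : ℝ) (hM : 0 < M)
    (htail : ∀ t : ℝ, 0 < t → ν {X | t < ‖X‖} ≤ ENNReal.ofReal (M * t ^ (-p)))
    (b : ConvexIntegration.Vec d) (ε : ℝ) (hε : 0 < ε)
    (Ω : Set (ConvexIntegration.Vec m)) (hΩ : ConvexIntegration.IsRegularDomain Ω) :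
    ∃ (w : ConvexIntegration.Vec m → ConvexIntegration.Vec d)
      (G : ConvexIntegration.Vec m → ConvexIntegration.Mat d m)
      (Ωerr : Set (ConvexIntegration.Vec m)),
      ConvexIntegration.IsPiecewiseAffine Ω w ∧
      ConvexIntegration.IsSobolevW11 Ω w G ∧
      (∃ C : ℝ≥0, HolderOnWith C α.toNNReal w (closure Ω)) ∧
      (∀ x ∈ frontier Ω, w x = ConvexIntegration.affineMap X₀ b x) ∧
      MeasurableSet Ωerr ∧ Ωerr ⊆ Ω ∧ {x ∈ Ω | G x ∉ K} ⊆ Ωerr ∧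
      (∫⁻ x in Ωerr, ENNReal.ofReal ((1 + ‖G x‖) ^ q) ≤ ENNReal.ofReal ε * volume Ω) ∧
      (∀ E : Set (ConvexIntegration.Mat d m), MeasurableSet E →
        (1 - ε) * ν.real E ≤ volume.real {x ∈ Ω \ Ωerr | G x ∈ E} / volume.real Ω ∧
        volume.real {x ∈ Ω \ Ωerr | G x ∈ E} / volume.real Ω ≤ (1 + ε) * ν.real E) ∧
      (∀ᵐ x ∂(volume.restrict Ωerr), G x ∈ U) := by
  obtain ⟨X, μ, γ, rfl, h⟩ := hν
  have hΩb := hΩ.isBounded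
  have hΩo := hΩ.isOpen
  have hΩfin : volume Ω ≠ ∞ := hΩb.measure_lt_top.ne
  have hΩpos : 0 < volume.real Ω :=
    ENNReal.toReal_pos (hΩo.measure_pos volume hΩ.isConnected.nonempty).ne' hΩfin
  obtain ⟨ε', hε', hε'1, hε'ε⟩ : ∃ ε' > 0, ε' ≤ 1 ∧ ε' ≤ ε :=
    ⟨min 1 ε, by positivity, min_le_left _ _, min_le_right _ _⟩
  obtain ⟨S, h0, hw0, hv, hn⟩ := h.exists_stages hU hα (by linarith : 0 ≤ q) b hε' hε'1 hΩo hΩb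
  obtain ⟨W, hlim, hd, hW, hhol⟩ := ConvexIntegration.Stage.exists_limit hn
  rw [hw0] at hhol
  have hWc : Continuous W := by
    refine (Metric.tendstoUniformly_iff.2 fun δ hδ => ?_ :
      TendstoUniformly (fun n => (S n).w) W atTop).continuous
      (Eventually.of_forall fun n => ?_).frequently
    · have h2 : Tendsto (fun n : ℕ => (2 : ℝ) / 2 ^ n) atTop (𝓝 0) :=
        tendsto_const_nhds.div_atTop (tendsto_pow_atTop_atTop_of_one_lt one_lt_two)
      filter_upwards [h2.eventually (Iio_mem_nhds hδ)] with n hnδ x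
      rw [dist_comm, dist_eq_norm]
      exact (hd n x).trans_lt hnδ
    · obtain ⟨L, hL⟩ := (hv n).lipschitz
      exact hL.continuous
  have hint := ConvexIntegration.Stage.integrableOn_grad h hq.le hε'1 hε'.le hΩb h0 hv hn hW
  obtain ⟨A, hA, hAK, hνA⟩ := h.exists_atoms
  have hAm : MeasurableSet A := hA.measurableSet
  have hνE : ∀ E, ν (E ∩ A) = ν E := fun E => by
    refine measure_congr (inter_ae_eq_left_of_ae_eq_univ ?_)
    exact ae_eq_univ.2 hνA
  have hdone := ConvexIntegration.Stage.volume_diff_done h hε'1 hε'.le hΩb h0 hv hn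
  have hdoneΩ : ⋃ n, ConvexIntegration.Stage.done S n ⊆ Ω := Set.iUnion_subset fun n =>
    (ConvexIntegration.Stage.done_subset hn n).trans (hv n).subset
  have hdoneO : IsOpen (⋃ n, ConvexIntegration.Stage.done S n) :=
    isOpen_iUnion fun n => ConvexIntegration.Stage.isOpen_done hn n
  -- Good points with gradient in the countable set `A ⊆ K`. The error set is the whole complement
  -- in `Ω`, so it also takes in the null set of points where `grad W` carries no information.
  set good := {x ∈ ConvexIntegration.Stage.good S | ConvexIntegration.grad W x ∈ A} with hgood
  have hgoodΩ : good ⊆ Ω := fun x hx => hdoneΩ (by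
    rw [ConvexIntegration.Stage.iUnion_done]
    exact Or.inl hx.1)
  have hSgood : IsOpen (ConvexIntegration.Stage.good S) :=
    isOpen_iUnion fun n => (hn n).isOpen_good
  have hgoodm : MeasurableSet good :=
    hSgood.measurableSet.inter (ConvexIntegration.measurable_grad W hAm)
  have hSnull : volume {x ∈ ConvexIntegration.Stage.good S | ConvexIntegration.grad W x ∈ Aᶜ} = 0 := by
    refine le_antisymm ((ConvexIntegration.Stage.volume_good_le h hn hW hAm.compl).trans ?_) zero_le
    rw [hνA, mul_zero]
  -- The points added to the error sets of the stages are null: those never done, and good points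
  -- with gradient outside `A`, since `ν Aᶜ = 0`.
  have herr : (Ω \ good : Set (ConvexIntegration.Vec m)) ≤ᵐ[volume] ConvexIntegration.Stage.err S := by
    refine ae_le_set.2 (measure_mono_null (fun x hx => ?_) (measure_union_null hdone hSnull))
    by_cases hxd : x ∈ ⋃ n, ConvexIntegration.Stage.done S n
    · right
      rw [ConvexIntegration.Stage.iUnion_done] at hxd
      have hxg := hxd.resolve_right hx.2
      exact ⟨hxg, fun hxA => hx.1.2 ⟨hxg, hxA⟩⟩
    · exact Or.inl ⟨hx.1.1, hxd⟩
  have hset : ∀ E : Set (ConvexIntegration.Mat d m),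
      {x ∈ Ω \ (Ω \ good) | ConvexIntegration.grad W x ∈ E} =
      {x ∈ ConvexIntegration.Stage.good S | ConvexIntegration.grad W x ∈ E ∩ A} := by
    intro E
    ext x
    simp only [Set.mem_ofPred_eq, sdiff_sdiff_right_self, Set.inf_eq_inter, Set.mem_inter_iff]
    constructor
    · rintro ⟨⟨-, hxg, hxA⟩, hxE⟩
      exact ⟨hxg, hxE, hxA⟩
    · rintro ⟨hxg, hxE, hxA⟩
      exact ⟨⟨hgoodΩ ⟨hxg, hxA⟩, hxg, hxA⟩, hxE⟩
  refine ⟨W, ConvexIntegration.grad W, Ω \ good, ?_, ⟨?_, hint, ?_⟩, ?_, ?_,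
    hΩo.measurableSet.diff hgoodm, Set.sdiff_subset, ?_, ?_, ?_, ?_⟩
  · refine ConvexIntegration.isPiecewiseAffine_of_hasLocGrad hdoneO hdoneΩ hdone fun x hx => ?_
    obtain ⟨n, hx⟩ := Set.mem_iUnion.1 hx
    have hev := ConvexIntegration.Stage.eventuallyEq_of_mem_done hn hW (Nat.lt_succ_self n) hx
    rcases hx with hx | hx
    · obtain ⟨Y, hY⟩ := (hn n).grad_good x hx
      exact ⟨Y, hY.congr hev⟩
    · obtain ⟨Y, -, hY⟩ := (hn n).grad_err x hx
      exact ⟨Y, hY.congr hev⟩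
  · exact (hWc.continuousOn.integrableOn_compact hΩb.isCompact_closure).mono_set subset_closure
  · exact ConvexIntegration.Stage.isWeakGradient h hq.le hε'1 hε'.le hΩo hΩb h0 hv hn hlim hd hW hWc
  · exact ConvexIntegration.holderOnWith_of_norm_le
      (ConvexIntegration.affineMap_lipschitz (X 0) b) hα zero_le_two hhol hΩb.closure
  · intro x hx
    rw [hW 0 x, hw0]
    rw [h0]
    exact fun hxΩ => (hΩo.frontier_eq ▸ hx).2 hxΩ
  · rintro x ⟨hxΩ, hxK⟩
    exact ⟨hxΩ, fun hxg => hxK (hAK hxg.2)⟩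
  · refine (lintegral_mono_set' herr).trans
      ((ConvexIntegration.Stage.lintegral_err hε'.le hn hW).trans ?_)
    exact mul_le_mul_left (ENNReal.ofReal_le_ofReal hε'ε) _
  · intro E hE
    -- Testing with `E ∩ A` selects exactly the points outside the error set with gradient in `E`,
    -- and `ν (E ∩ A) = ν E`.
    have hl := ConvexIntegration.Stage.le_volume_good h hn hW (hE.inter hAm)
    have hu := ConvexIntegration.Stage.volume_good_le h hn hW (hE.inter hAm)
    rw [hνE, ← hset E] at hl hu
    have hfin : volume {x ∈ Ω \ (Ω \ good) | ConvexIntegration.grad W x ∈ E} ≠ ∞ :=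
      ne_top_of_le_ne_top hΩfin (measure_mono fun x hx => hx.1.1)
    have := h.isProbabilityMeasure
    have hl' := ENNReal.toReal_mono hfin hl
    have hu' := ENNReal.toReal_mono (ENNReal.mul_ne_top (ENNReal.mul_ne_top ENNReal.ofReal_ne_top
      hΩfin) (measure_ne_top ν E)) hu
    rw [ENNReal.toReal_mul, ENNReal.toReal_mul, ENNReal.toReal_ofReal (by linarith)] at hl' hu'
    change (1 - ε') * volume.real Ω * ν.real E ≤ volume.real _ at hl'
    change volume.real _ ≤ (1 + ε') * volume.real Ω * ν.real E at hu'
    have hνnn : 0 ≤ ν.real E := measureReal_nonneg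
    have hm : ε' * (volume.real Ω * ν.real E) ≤ ε * (volume.real Ω * ν.real E) :=
      mul_le_mul_of_nonneg_right hε'ε (by positivity)
    rw [le_div_iff₀ hΩpos, div_le_iff₀ hΩpos]
    constructor <;> linarith
  · have hsub : ∀ᵐ x ∂(volume : Measure (ConvexIntegration.Vec m)), x ∈ Ω \ good →
        x ∈ ConvexIntegration.Stage.err S := herr
    rw [ae_restrict_iff' (hΩo.measurableSet.diff hgoodm)]
    filter_upwards [hsub] with x hx hxe
    obtain ⟨n, hx⟩ := Set.mem_iUnion.1 (hx hxe)
    have hev := ConvexIntegration.Stage.eventuallyEq_of_mem_done hn hW (Nat.lt_succ_self n) (Or.inr hx)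
    obtain ⟨Y, hYU, hY⟩ := (hn n).grad_err x hx
    rw [ConvexIntegration.grad_congr hev, hY.grad_eq]
    exact hYU
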